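/- Let $p=p(n)\in[0,1]$ satisfy, for all sufficiently large $n$, either $p=\alpha(n)\ln(n)/n$ for some $\alpha(n)\to\infty$, or $p=c\ln(n)/n$ for some constant $c>1$, and let $G_{n,p}$ be the random graph on $n$ nodes in which each edge is present independently with probability $p$. In the asynchronous push-pull protocol on a graph $G$, a rumor is known at time $0$ to exactly one node $s$; every node has an independent Poisson clock of rate $1$, and whenever its clock rings it contacts a uniformly random neighbour: if it is informed it pushes the rumor to that neighbour, and if it is uninformed it pulls the rumor from that neighbour if the neighbour is informed. Let $T(G)$ be the time until all nodes are informed, and let $\mathbb{E}[T(G)]$ be its expectation over the protocol for the fixed graph $G$ (so $\mathbb{E}[T(G_{n,p})]$ is a random variable depending on the graph). For a set $B$ of faulty nodes, let $T_B(G)$ be the time until all nodes are informed when the nodes in $B$ never push and never answer a pull request (they may still receive pushes and issue pulls themselves). Let $s=s_n$ be a fixed node, chosen independently of the graph, and let $B=B_n$ be a random set of nodes with $s_n\notin B_n$, independent of the graph and of the clocks and contacts of the protocol, such that $|B_n|=o(n)$, i.e. $|B_n|/n\to 0$ in probability. Then there is a deterministic sequence $\varepsilon_n\to0$ such that, with probability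 $1-o(1)$ as $n\to\infty$ (over the graph, $B_n$ and the protocol), $\mathbb{E}[T(G_{n,p})]$ and $T_B(G_{n,p})$ are finite and \[ \bigl|T_B(G_{n,p})-\mathbb{E}[T(G_{n,p})]\bigr|\le \varepsilon_n\,\mathbb{E}[T(G_{n,p})], \] that is, $T_B(G_{n,p})=(1+o(1))\,\mathbb{E}[T(G_{n,p})]$ with high probability. -/

import Mathlib

open Filter Topology MeasureTheory ProbabilityTheory
open scoped ENNReal NNReal

namespace RumorSpreading

/-- `expMeasure 1` is a probability measure (needed to form product measures). -/
instance instIsProbabilityMeasureExpOne : IsProbabilityMeasure (expMeasure 1) :=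
  isProbabilityMeasure_expMeasure one_pos

/-- Waiting times of the clocks: `w (v, k)` is the time between the `k`-th and the `(k+1)`-st ring
of the clock of node `v` (the `0`-th ring being time `0`). -/
abbrev Waits (n : ℕ) : Type := Fin n × ℕ → ℝ

/-- Contacts: `c (v, k)` is the node that `v` contacts when its clock rings for the
`(k+1)`-st time. -/
abbrev Contacts (n : ℕ) : Type := Fin n × ℕ → Fin n

/-- The time at which the clock of `v` rings for the `(k+1)`-st time. -/
noncomputable def ringTime {n : ℕ} (w : Waits n) (v : Fin n) (k : ℕ) : ℝ :=
  ∑ i ∈ Finset.range (k + 1), w (v, i)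

open Classical in
/-- The law of one contact of `v`: a uniformly random neighbour of `v` in `G`. (An isolated node
contacts itself, which has no effect on the spread of the rumor.) -/
noncomputable def contactLaw {n : ℕ} (G : SimpleGraph (Fin n)) (v : Fin n) : PMF (Fin n) :=
  if h : (G.neighborFinset v).Nonempty then PMF.uniformOfFinset (G.neighborFinset v) h
  else PMF.pure v

/-- The law of the randomness of the asynchronous protocol on the graph `G`: the clocks are
independent Poisson processes of rate `1` (independent `Exp(1)` waiting times), and at every ring
of its clock a node contacts a uniformly random neighbour, independently of everything else. -/
noncomputable def protocolLaw {n : ℕ} (G : SimpleGraph (Fin n)) :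
    Measure (Waits n × Contacts n) :=
  (Measure.infinitePi fun _ : Fin n × ℕ => expMeasure 1).prod
    (Measure.infinitePi fun i : Fin n × ℕ => (contactLaw G i.1).toMeasure)

/-- `Informed s B w c v t`: node `v` has received the rumor by time `t`, when the rumor starts at
node `s` at time `0`, the nodes in `B` are faulty, and clocks and contacts are given by `w`, `c`.
Faulty nodes never push and never answer a pull request; they can still receive pushes and they
still issue pull requests. -/
inductive Informed {n : ℕ} (s : Fin n) (B : Finset (Fin n)) (w : Waits n) (c : Contacts n) :
    Fin n → ℝ → Prop
  | source {t : ℝ} (ht : 0 ≤ t) : Informed s B w c s t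
  | push {v : Fin n} {k : ℕ} {r t : ℝ} (hv : Informed s B w c v r) (hvB : v ∉ B)
      (hr : r < ringTime w v k) (ht : ringTime w v k ≤ t) : Informed s B w c (c (v, k)) t
  | pull {v : Fin n} {k : ℕ} {r t : ℝ} (hu : Informed s B w c (c (v, k)) r)
      (huB : c (v, k) ∉ B)
      (hr : r < ringTime w v k) (ht : ringTime w v k ≤ t) : Informed s B w c v t

/-- The spreading time `T_B`: the first time at which all nodes have received the rumor
(`∞` if this never happens). -/
noncomputable def spreadTime {n : ℕ} (s : Fin n) (B : Finset (Fin n))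
    (ω : Waits n × Contacts n) : ℝ≥0∞ :=
  ⨅ (t : ℝ≥0) (_ : ∀ v : Fin n, Informed s B ω.1 ω.2 v t), (t : ℝ≥0∞)

/-- `𝔼[T(G)]`, the expected spreading time of the protocol without faulty nodes on the fixed
graph `G`, the expectation being over the protocol only; as a function of a random graph `G`
it is a random variable. -/
noncomputable def expectedSpreadTime {n : ℕ} (s : Fin n) (G : SimpleGraph (Fin n)) : ℝ≥0∞ :=
  ∫⁻ ω, spreadTime s ∅ ω ∂(protocolLaw G)

/-- The probability of an event `A G B ω` when `G` is the random graph `G_{n,p}`, the set `B` of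
faulty nodes has law `β` and is independent of `G`, and `ω` is the randomness of the protocol on
`G`. -/
noncomputable def jointProb {n : ℕ} (p : unitInterval) (β : PMF (Finset (Fin n)))
    (A : SimpleGraph (Fin n) → Finset (Fin n) → Waits n × Contacts n → Prop) : ℝ≥0∞ :=
  ∫⁻ G, ∑ B : Finset (Fin n), β B * protocolLaw G {ω | A G B ω}
    ∂(SimpleGraph.binomialRandom (Fin n) p)

end RumorSpreading

/-! The informed set is a continuous-time Markov chain on the finite space `Finset (Fin n)`: an
uninformed `x` joins at rate `∑ (1 / deg u + 1 / deg x)` over its informed non-faulty neighbours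
`u`, one term for a push and one for a pull. Clocks and contacts are used for three things:
decomposition at the first ring, which shows that the expectations `evolve` solve Kolmogorov's
equation; additivity in the set of sources (`InformedFrom.exists_source`); and monotonicity in the
faulty set (`InformedFrom.anti_faulty`). Phases are then controlled by functions that decrease in
mean along the chain (`evolve_le_of_supersolution`).

Both `T_B` and `𝔼[T]` are compared with a functional of the graph, `L = log n / 2 + t₂`, where `t₂`
solves `∑ exp (-r v * t₂) = 1` and `r v` is the total contact rate of `v`. An edge between two nodes
of degree about `np` has rate about `2 / np`, so the informed set grows like `exp (2 t)` and needs
about `log n / 2` to reach linear size. At the end the delay comes from single nodes: once almost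
all neighbours of `v` are informed, `v` waits for an exponential time of rate about `r v`. In the
regime `p = c log n / n` the degrees are only known to be of order `np`, so `t₂` has to be read off
the graph.

Upper bound (`GoodGraph.not_univ_le_of_scale`): the rumor reaches a typical non-faulty node, grows
to linear size, shrinks the uninformed set to a small fraction by expansion, removes in
logarithmically many short rounds all nodes with many uninformed neighbours, and then informs every
node at almost its full rate. All phases but the growth and the final one cost a small multiple of
`log n`. Few faulty nodes change nothing, because each node has few faulty neighbours.

Lower bound (`GoodGraph.sum_univ_le_of_scale`): the first moment grows at rate at most about `2`, so
shortly before `log n / 2` the informed nodes carry a negligible part of the weight `∑ exp (-r v *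
t)`; the others are no faster than independent clocks of rates `r v` (`evolve_univ_le`). The first
moment is controlled only on average over the source; exchangeability of the random graph transfers
this to a fixed source.

The upper bound holds from every nonempty start, so restarting gives a geometric tail and `𝔼[T]` is
also close to `L` (`le_protocolLaw_concentrated`). The graph properties in `GoodGraph` follow from
Chernoff bounds (`measureReal_not_goodGraph_le`); `c > 1` is what gives minimum degree of order
`np`. A diagonal argument replaces a fixed error by a null sequence. -/

namespace RumorSpreading

/-- The rumor process started from a set `I` of nodes informed at time `0`. -/
inductive InformedFrom {n : ℕ} (I B : Finset (Fin n)) (w : Waits n) (c : Contacts n) :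
    Fin n → ℝ → Prop
  | source {v : Fin n} {t : ℝ} (hv : v ∈ I) (ht : 0 ≤ t) : InformedFrom I B w c v t
  | push {v : Fin n} {k : ℕ} {r t : ℝ} (hv : InformedFrom I B w c v r) (hvB : v ∉ B)
      (hr : r < ringTime w v k) (ht : ringTime w v k ≤ t) : InformedFrom I B w c (c (v, k)) t
  | pull {v : Fin n} {k : ℕ} {r t : ℝ} (hu : InformedFrom I B w c (c (v, k)) r)
      (huB : c (v, k) ∉ B)
      (hr : r < ringTime w v k) (ht : ringTime w v k ≤ t) : InformedFrom I B w c v t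

namespace InformedFrom

variable {n : ℕ} {I B : Finset (Fin n)} {w : Waits n} {c : Contacts n} {v : Fin n} {t : ℝ}

theorem mono_time (h : InformedFrom I B w c v t) {t' : ℝ} (htt : t ≤ t') :
    InformedFrom I B w c v t' := by
  cases h with
  | source hv ht => exact .source hv (ht.trans htt)
  | push hv hvB hr ht => exact .push hv hvB hr (ht.trans htt)
  | pull hv hvB hr ht => exact .pull hv hvB hr (ht.trans htt)

theorem nonneg (h : InformedFrom I B w c v t) : 0 ≤ t := by
  induction h with
  | source _ ht => exact ht
  | push _ _ hr ht ih => linarith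
  | pull _ _ hr ht ih => linarith

/-- A chain of contacts leads back to a single source, so the process is additive in the initial
set. This is the union bound behind the first moment estimate. -/
theorem exists_source (h : InformedFrom I B w c v t) : ∃ s ∈ I, InformedFrom {s} B w c v t := by
  induction h with
  | source hv ht => exact ⟨_, hv, .source (by simp) ht⟩
  | push _ hvB hr ht ih =>
    obtain ⟨s, hs, h⟩ := ih
    exact ⟨s, hs, .push h hvB hr ht⟩
  | pull _ hvB hr ht ih =>
    obtain ⟨s, hs, h⟩ := ih
    exact ⟨s, hs, .pull h hvB hr ht⟩

/-- Coupling with the same clocks and contacts. It lets a lower bound for the fault-free process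
serve for every faulty set. -/
theorem anti_faulty (h : InformedFrom I B w c v t) {B' : Finset (Fin n)} (hB : B' ⊆ B) :
    InformedFrom I B' w c v t := by
  induction h with
  | source hv ht => exact .source hv ht
  | push _ hvB hr ht ih => exact .push ih (fun h => hvB (hB h)) hr ht
  | pull _ hvB hr ht ih => exact .pull ih (fun h => hvB (hB h)) hr ht

end InformedFrom

theorem informed_iff_informedFrom {n : ℕ} {s : Fin n} {B : Finset (Fin n)} {w : Waits n}
    {c : Contacts n} {v : Fin n} {t : ℝ} :
    Informed s B w c v t ↔ InformedFrom {s} B w c v t := by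
  constructor
  · intro h
    induction h with
    | source ht => exact .source (by simp) ht
    | push _ hvB hr ht ih => exact .push ih hvB hr ht
    | pull _ hvB hr ht ih => exact .pull ih hvB hr ht
  · intro h
    induction h with
    | source hv ht =>
      rw [Finset.mem_singleton] at hv
      subst hv
      exact .source ht
    | push _ hvB hr ht ih => exact .push ih hvB hr ht
    | pull _ hvB hr ht ih => exact .pull ih hvB hr ht

/-! ### Inserting a first ring -/

/-- Insert `x` as the `0`-th entry in the row of `v` and shift that row by one. -/
def insertRow {n : ℕ} {X : Type*} (v : Fin n) (x : X) (f : Fin n × ℕ → X) : Fin n × ℕ → X :=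
  fun i => if i.1 = v then (match i.2 with | 0 => x | k + 1 => f (v, k)) else f i

@[simp] theorem insertRow_zero {n : ℕ} {X : Type*} (v : Fin n) (x : X) (f : Fin n × ℕ → X) :
    insertRow v x f (v, 0) = x := by simp [insertRow]

@[simp] theorem insertRow_succ {n : ℕ} {X : Type*} (v : Fin n) (x : X) (f : Fin n × ℕ → X)
    (k : ℕ) : insertRow v x f (v, k + 1) = f (v, k) := by simp [insertRow]

theorem insertRow_of_ne {n : ℕ} {X : Type*} (v : Fin n) (x : X) (f : Fin n × ℕ → X)
    {u : Fin n} (h : u ≠ v) (k : ℕ) : insertRow v x f (u, k) = f (u, k) := by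
  simp [insertRow, h]

/-- Delay the first ring of every node other than `v` by `σ`. -/
noncomputable def delayFirst {n : ℕ} (v : Fin n) (σ : ℝ) (w : Waits n) : Waits n :=
  fun i => if i.1 ≠ v ∧ i.2 = 0 then w i + σ else w i

/-- Inserting `σ` in the row of `v` and delaying the first wait of every other row moves all old
rings by exactly `σ` and creates one new ring, that of `v` at time `σ`. The next two lemmas give the
shift. -/
theorem ringTime_insertRow_zero {n : ℕ} (v : Fin n) (σ : ℝ) (w : Waits n) :
    ringTime (insertRow v σ (delayFirst v σ w)) v 0 = σ := by
  simp [ringTime]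

theorem ringTime_insertRow_succ {n : ℕ} (v : Fin n) (σ : ℝ) (w : Waits n) (k : ℕ) :
    ringTime (insertRow v σ (delayFirst v σ w)) v (k + 1) = ringTime w v k + σ := by
  simp only [ringTime]
  rw [Finset.sum_range_succ']
  simp [delayFirst]

theorem ringTime_insertRow_of_ne {n : ℕ} (v : Fin n) (σ : ℝ) (w : Waits n) {u : Fin n}
    (h : u ≠ v) (k : ℕ) :
    ringTime (insertRow v σ (delayFirst v σ w)) u k = ringTime w u k + σ := by
  simp only [ringTime]
  rw [Finset.sum_range_succ', Finset.sum_range_succ']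
  simp [insertRow_of_ne, h, delayFirst, add_assoc]

theorem ringTime_pos {n : ℕ} {w : Waits n} (hw : ∀ i, 0 < w i) (v : Fin n) (k : ℕ) :
    0 < ringTime w v k :=
  Finset.sum_pos (fun i _ => hw _) (by simp)

/-- The informed set after `v` contacts `x`. -/
def contactStep {n : ℕ} (B I : Finset (Fin n)) (v x : Fin n) : Finset (Fin n) :=
  I ∪ ((if v ∈ I ∧ v ∉ B then {x} else ∅) ∪ (if x ∈ I ∧ x ∉ B then {v} else ∅))

theorem mem_contactStep {n : ℕ} {B I : Finset (Fin n)} {v x u : Fin n} :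
    u ∈ contactStep B I v x ↔
      u ∈ I ∨ (v ∈ I ∧ v ∉ B ∧ u = x) ∨ (x ∈ I ∧ x ∉ B ∧ u = v) := by
  unfold contactStep
  split_ifs <;> simp <;> tauto

theorem subset_contactStep {n : ℕ} (B I : Finset (Fin n)) (v x : Fin n) :
    I ⊆ contactStep B I v x := fun _ h => mem_contactStep.2 (Or.inl h)

section FirstRing

variable {n : ℕ} {I B : Finset (Fin n)} {w : Waits n} {c : Contacts n} {v₀ x₀ : Fin n} {σ : ℝ}

/-- Pathwise Markov property at the first ring: nothing changes before `σ`, one contact takes place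
at `σ`, and afterwards the process with the old clocks runs from the new set. Positive waits
guarantee that every other ring is strictly later than `σ`. -/
theorem InformedFrom.of_insert (hw : ∀ i, 0 < w i) {v : Fin n} {t : ℝ}
    (h : InformedFrom I B (insertRow v₀ σ (delayFirst v₀ σ w)) (insertRow v₀ x₀ c) v t) :
    (t < σ → v ∈ I) ∧ (σ ≤ t → InformedFrom (contactStep B I v₀ x₀) B w c v (t - σ)) := by
  -- Every ring is either the inserted one or an old one moved by `σ`.
  have key : ∀ u k, (u = v₀ ∧ k = 0) ∨
      ∃ k', ringTime (insertRow v₀ σ (delayFirst v₀ σ w)) u k = ringTime w u k' + σ ∧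
        insertRow v₀ x₀ c (u, k) = c (u, k') := by
    intro u k
    by_cases hu : u = v₀
    · subst hu
      cases k with
      | zero => simp
      | succ k => exact Or.inr ⟨k, ringTime_insertRow_succ _ _ _ _, insertRow_succ _ _ _ _⟩
    · exact Or.inr ⟨k, ringTime_insertRow_of_ne _ _ _ hu _, insertRow_of_ne _ _ _ hu _⟩
  -- A node known strictly before a moved ring is known strictly before the old ring: if it was
  -- informed before `σ`, time `0` works because the old ring time is positive.
  have lift : ∀ {u : Fin n} {r : ℝ} {r' : ℝ}, 0 ≤ r →
      ((r < σ → u ∈ I) ∧ (σ ≤ r → InformedFrom (contactStep B I v₀ x₀) B w c u (r - σ))) →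
      r < r' + σ → 0 < r' → ∃ q, InformedFrom (contactStep B I v₀ x₀) B w c u q ∧ q < r' := by
    intro u r r' hr0 ih hr hr'
    rcases lt_or_ge r σ with h | h
    · exact ⟨0, .source (subset_contactStep _ _ _ _ (ih.1 h)) le_rfl, hr'⟩
    · exact ⟨r - σ, ih.2 h, by linarith⟩
  induction h with
  | source hv ht =>
    exact ⟨fun _ => hv, fun h => .source (subset_contactStep _ _ _ _ hv) (by linarith)⟩
  | @push u k r t hv hvB hr ht ih =>
    rcases key u k with ⟨rfl, rfl⟩ | ⟨k', h1, h2⟩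
    · rw [ringTime_insertRow_zero] at hr ht
      refine ⟨fun h => by linarith, fun h => .source ?_ (by linarith)⟩
      rw [insertRow_zero]
      exact mem_contactStep.2 (Or.inr (Or.inl ⟨ih.1 hr, hvB, rfl⟩))
    · have hp := ringTime_pos hw u k'
      rw [h1] at hr ht
      rw [h2]
      refine ⟨fun h => by linarith, fun h => ?_⟩
      obtain ⟨q, hq, hq'⟩ := lift hv.nonneg ih hr hp
      exact .push hq hvB hq' (by linarith)
  | @pull u k r t hv hvB hr ht ih =>
    rcases key u k with ⟨rfl, rfl⟩ | ⟨k', h1, h2⟩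
    · rw [ringTime_insertRow_zero] at hr ht
      refine ⟨fun h => by linarith, fun h => .source ?_ (by linarith)⟩
      rw [insertRow_zero] at ih hvB
      exact mem_contactStep.2 (Or.inr (Or.inr ⟨ih.1 hr, hvB, rfl⟩))
    · have hp := ringTime_pos hw u k'
      rw [h1] at hr ht
      rw [h2] at ih hvB
      refine ⟨fun h => by linarith, fun h => ?_⟩
      obtain ⟨q, hq, hq'⟩ := lift hv.nonneg ih hr hp
      exact .pull hq hvB hq' (by linarith)

/-- Converse of `InformedFrom.of_insert`. Here `σ > 0` suffices: a node of `I`, informed at time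
`0`, is then informed strictly before the inserted ring. -/
theorem InformedFrom.insert (hσ : 0 < σ) {v : Fin n} {t : ℝ}
    (h : InformedFrom (contactStep B I v₀ x₀) B w c v t) :
    InformedFrom I B (insertRow v₀ σ (delayFirst v₀ σ w)) (insertRow v₀ x₀ c) v (t + σ) := by
  have key : ∀ u k, ∃ k',
      ringTime (insertRow v₀ σ (delayFirst v₀ σ w)) u k' = ringTime w u k + σ ∧
        insertRow v₀ x₀ c (u, k') = c (u, k) := by
    intro u k
    by_cases hu : u = v₀
    · subst hu
      exact ⟨k + 1, ringTime_insertRow_succ _ _ _ _, insertRow_succ _ _ _ _⟩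
    · exact ⟨k, ringTime_insertRow_of_ne _ _ _ hu _, insertRow_of_ne _ _ _ hu _⟩
  induction h with
  | @source u t hv ht =>
    rcases mem_contactStep.1 hv with h | ⟨h1, h2, rfl⟩ | ⟨h1, h2, rfl⟩
    · exact .source h (by linarith)
    · have := InformedFrom.push (I := I) (B := B) (w := insertRow v₀ σ (delayFirst v₀ σ w))
        (c := insertRow v₀ u c) (k := 0) (t := t + σ) (.source h1 le_rfl) h2
        (by rwa [ringTime_insertRow_zero]) (by rw [ringTime_insertRow_zero]; linarith)
      simpa using this
    · refine InformedFrom.pull (k := 0) (r := 0) ?_ ?_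
        (by rwa [ringTime_insertRow_zero]) (by rw [ringTime_insertRow_zero]; linarith)
      · simpa using InformedFrom.source h1 le_rfl
      · simpa using h2
  | @push u k r t hv hvB hr ht ih =>
    obtain ⟨k', h1, h2⟩ := key u k
    rw [← h2]
    exact .push ih hvB (by linarith) (by linarith)
  | @pull u k r t hv hvB hr ht ih =>
    obtain ⟨k', h1, h2⟩ := key u k
    rw [← h2] at ih hvB
    exact .pull ih hvB (by linarith) (by linarith)

end FirstRing

/-! ### The informed set -/

open Classical in
/-- The set of nodes informed at time `t`. -/
noncomputable def informedSet {n : ℕ} (I B : Finset (Fin n)) (ω : Waits n × Contacts n) (t : ℝ) :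
    Finset (Fin n) :=
  Finset.univ.filter fun v => InformedFrom I B ω.1 ω.2 v t

section InformedSet

variable {n : ℕ} {I B : Finset (Fin n)} {ω : Waits n × Contacts n} {t : ℝ}

@[simp] theorem mem_informedSet {v : Fin n} :
    v ∈ informedSet I B ω t ↔ InformedFrom I B ω.1 ω.2 v t := by
  simp [informedSet]

theorem subset_informedSet (ht : 0 ≤ t) : I ⊆ informedSet I B ω t := fun _ hv =>
  mem_informedSet.2 (.source hv ht)

theorem informedSet_insert_of_lt {w : Waits n} {c : Contacts n} {v₀ x₀ : Fin n} {σ : ℝ}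
    (hw : ∀ i, 0 < w i) (ht : 0 ≤ t) (htσ : t < σ) :
    informedSet I B (insertRow v₀ σ (delayFirst v₀ σ w), insertRow v₀ x₀ c) t = I := by
  refine Finset.Subset.antisymm (fun v hv => ?_) (subset_informedSet ht)
  exact ((mem_informedSet.1 hv).of_insert hw).1 htσ

theorem informedSet_insert_of_le {w : Waits n} {c : Contacts n} {v₀ x₀ : Fin n} {σ : ℝ}
    (hw : ∀ i, 0 < w i) (hσ : 0 < σ) (htσ : σ ≤ t) :
    informedSet I B (insertRow v₀ σ (delayFirst v₀ σ w), insertRow v₀ x₀ c) t =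
      informedSet (contactStep B I v₀ x₀) B (w, c) (t - σ) := by
  ext v
  rw [mem_informedSet, mem_informedSet]
  refine ⟨fun h => (h.of_insert hw).2 htσ, fun h => ?_⟩
  simpa using h.insert (I := I) hσ

theorem measurable_ringTime (v : Fin n) (k : ℕ) : Measurable fun w : Waits n => ringTime w v k := by
  unfold ringTime
  fun_prop

/-- Informed by time `t` along a chain of at most `j` contacts. -/
inductive InformedIn (I B : Finset (Fin n)) (w : Waits n) (c : Contacts n) :
    ℕ → Fin n → ℝ → Prop
  | source {j : ℕ} {v : Fin n} {t : ℝ} (hv : v ∈ I) (ht : 0 ≤ t) : InformedIn I B w c j v t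
  | push {j : ℕ} {v : Fin n} {k : ℕ} {r : ℚ} {t : ℝ} (hv : InformedIn I B w c j v r) (hvB : v ∉ B)
      (hr : r < ringTime w v k) (ht : ringTime w v k ≤ t) : InformedIn I B w c (j + 1) (c (v, k)) t
  | pull {j : ℕ} {v : Fin n} {k : ℕ} {r : ℚ} {t : ℝ} (hu : InformedIn I B w c j (c (v, k)) r)
      (huB : c (v, k) ∉ B)
      (hr : r < ringTime w v k) (ht : ringTime w v k ≤ t) : InformedIn I B w c (j + 1) v t

theorem InformedIn.mono_time {w : Waits n} {c : Contacts n} {j : ℕ} {v : Fin n}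
    (h : InformedIn I B w c j v t) {t' : ℝ} (htt : t ≤ t') : InformedIn I B w c j v t' := by
  cases h with
  | source hv ht => exact .source hv (ht.trans htt)
  | push hv hvB hr ht => exact .push hv hvB hr (ht.trans htt)
  | pull hv hvB hr ht => exact .pull hv hvB hr (ht.trans htt)

/-- The strict inequality before each ring leaves room for a rational time. With the chain length
bounded, the event becomes a countable union, which is what measurability needs. -/
theorem informedFrom_iff_exists_informedIn {w : Waits n} {c : Contacts n} {v : Fin n} :
    InformedFrom I B w c v t ↔ ∃ j, InformedIn I B w c j v t := by
  constructor
  · intro h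
    induction h with
    | source hv ht => exact ⟨0, .source hv ht⟩
    | push _ hvB hr ht ih =>
      obtain ⟨j, hj⟩ := ih
      obtain ⟨q, hq, hq'⟩ := exists_rat_btwn hr
      exact ⟨j + 1, .push (hj.mono_time hq.le) hvB hq' ht⟩
    | pull _ hvB hr ht ih =>
      obtain ⟨j, hj⟩ := ih
      obtain ⟨q, hq, hq'⟩ := exists_rat_btwn hr
      exact ⟨j + 1, .pull (hj.mono_time hq.le) hvB hq' ht⟩
  · rintro ⟨j, h⟩
    induction h with
    | source hv ht => exact .source hv ht
    | push _ hvB hr ht ih => exact .push ih hvB hr ht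
    | pull _ hvB hr ht ih => exact .pull ih hvB hr ht

/-- Measurability is joint in time and randomness, since the renewal equation integrates transition
probabilities over time. -/
theorem measurableSet_informedIn (I B : Finset (Fin n)) (j : ℕ) (v : Fin n) :
    MeasurableSet {x : ℝ × (Waits n × Contacts n) | InformedIn I B x.2.1 x.2.2 j v x.1} := by
  have hring : ∀ (v : Fin n) (k : ℕ),
      Measurable fun x : ℝ × (Waits n × Contacts n) => ringTime x.2.1 v k :=
    fun v k => (measurable_ringTime v k).comp (by fun_prop)
  have hc : ∀ (i : Fin n × ℕ) (u : Fin n),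
      MeasurableSet {x : ℝ × (Waits n × Contacts n) | x.2.2 i = u} := fun i u =>
    (measurableSet_singleton u).preimage
      (f := fun x : ℝ × (Waits n × Contacts n) => x.2.2 i) (by fun_prop)
  induction j generalizing v with
  | zero =>
    have : {x : ℝ × (Waits n × Contacts n) | InformedIn I B x.2.1 x.2.2 0 v x.1} =
        {x | v ∈ I ∧ 0 ≤ x.1} := by
      ext x
      constructor
      · rintro (⟨hv, ht⟩)
        exact ⟨hv, ht⟩
      · rintro ⟨hv, ht⟩
        exact .source hv ht
    rw [this]
    exact (MeasurableSet.const _).inter (measurableSet_le measurable_const measurable_fst)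
  | succ j ih =>
    have hq : ∀ (v : Fin n) (q : ℚ), MeasurableSet
        {x : ℝ × (Waits n × Contacts n) | InformedIn I B x.2.1 x.2.2 j v (q : ℝ)} := fun v q =>
      (ih v).preimage (f := fun x : ℝ × (Waits n × Contacts n) => ((q : ℝ), x.2)) (by fun_prop)
    have : {x : ℝ × (Waits n × Contacts n) | InformedIn I B x.2.1 x.2.2 (j + 1) v x.1} =
        {x | v ∈ I ∧ 0 ≤ x.1} ∪
        ((⋃ (u : Fin n) (k : ℕ) (q : ℚ), {x | InformedIn I B x.2.1 x.2.2 j u (q : ℝ)} ∩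
          {x | u ∉ B} ∩ {x | (q : ℝ) < ringTime x.2.1 u k} ∩ {x | ringTime x.2.1 u k ≤ x.1} ∩
          {x | x.2.2 (u, k) = v}) ∪
        (⋃ (u : Fin n) (k : ℕ) (q : ℚ), {x | InformedIn I B x.2.1 x.2.2 j u (q : ℝ)} ∩
          {x | u ∉ B} ∩ {x | (q : ℝ) < ringTime x.2.1 v k} ∩ {x | ringTime x.2.1 v k ≤ x.1} ∩
          {x | x.2.2 (v, k) = u})) := by
      ext x
      simp only [Set.mem_ofPred_eq, Set.mem_union, Set.mem_iUnion, Set.mem_inter_iff]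
      constructor
      · intro h
        generalize hj : j + 1 = j' at h
        cases h with
        | source hv ht => exact Or.inl ⟨hv, ht⟩
        | @push j' u k r _ h1 h2 h3 h4 =>
          cases hj
          exact Or.inr (Or.inl ⟨u, k, r, ⟨⟨⟨h1, h2⟩, h3⟩, h4⟩, rfl⟩)
        | @pull j' u k r _ h1 h2 h3 h4 =>
          cases hj
          exact Or.inr (Or.inr ⟨_, k, r, ⟨⟨⟨h1, h2⟩, h3⟩, h4⟩, rfl⟩)
      · rintro (⟨hv, ht⟩ | ⟨u, k, r, ⟨⟨⟨h1, h2⟩, h3⟩, h4⟩, rfl⟩ | ⟨u, k, r, ⟨⟨⟨h1, h2⟩, h3⟩, h4⟩, rfl⟩)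
        · exact .source hv ht
        · exact .push h1 h2 h3 h4
        · exact .pull h1 h2 h3 h4
    rw [this]
    refine ((MeasurableSet.const _).inter (measurableSet_le measurable_const measurable_fst)).union
      (MeasurableSet.union ?_ ?_)
    · refine .iUnion fun u => .iUnion fun k => .iUnion fun q => ?_
      exact ((((hq u q).inter (MeasurableSet.const _)).inter
        (measurableSet_lt measurable_const (hring u k))).inter
        (measurableSet_le (hring u k) measurable_fst)).inter (hc _ _)
    · refine .iUnion fun u => .iUnion fun k => .iUnion fun q => ?_
      exact ((((hq u q).inter (MeasurableSet.const _)).inter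
        (measurableSet_lt measurable_const (hring v k))).inter
        (measurableSet_le (hring v k) measurable_fst)).inter (hc _ _)

theorem measurableSet_informedFrom (I B : Finset (Fin n)) (v : Fin n) :
    MeasurableSet {x : ℝ × (Waits n × Contacts n) | InformedFrom I B x.2.1 x.2.2 v x.1} := by
  simp only [informedFrom_iff_exists_informedIn, Set.ofPred_exists]
  exact .iUnion fun j => measurableSet_informedIn I B j v

theorem measurableSet_informedSet_eq (I B J : Finset (Fin n)) :
    MeasurableSet {x : ℝ × (Waits n × Contacts n) | informedSet I B x.2 x.1 = J} := by
  have : {x : ℝ × (Waits n × Contacts n) | informedSet I B x.2 x.1 = J} =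
      ⋂ v : Fin n, {x | InformedFrom I B x.2.1 x.2.2 v x.1 ↔ v ∈ J} := by
    ext x
    simp [Finset.ext_iff]
  rw [this]
  refine .iInter fun v => ?_
  by_cases hv : v ∈ J
  · simpa [hv] using measurableSet_informedFrom I B v
  · simp only [hv, iff_false]
    exact (measurableSet_informedFrom I B v).compl

theorem measurableSet_informedSet_eq_at (I B J : Finset (Fin n)) (t : ℝ) :
    MeasurableSet {ω : Waits n × Contacts n | informedSet I B ω t = J} :=
  (measurableSet_informedSet_eq I B J).preimage
    (f := fun ω : Waits n × Contacts n => (t, ω)) (by fun_prop)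

end InformedSet

/-! ### Decomposition of the protocol at the first ring -/

theorem measurable_insertRow {n : ℕ} {X : Type*} [MeasurableSpace X] (v : Fin n) :
    Measurable fun y : X × (Fin n × ℕ → X) => insertRow v y.1 y.2 := by
  refine measurable_pi_lambda _ fun i => ?_
  obtain ⟨u, k⟩ := i
  by_cases hu : u = v
  · subst hu
    cases k with
    | zero => simpa using measurable_fst
    | succ k => simp only [insertRow_succ]; fun_prop
  · simp only [insertRow_of_ne _ _ _ hu]; fun_prop

/-- Shifting the row of `v` by one. -/
def shiftRow {n : ℕ} (v : Fin n) : Fin n × ℕ ↪ Fin n × ℕ where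
  toFun i := if i.1 = v then (v, i.2 + 1) else i
  inj' := by
    rintro ⟨a, k⟩ ⟨b, l⟩ h
    simp only at h
    split_ifs at h <;> simp_all

theorem shiftRow_apply {n : ℕ} (v : Fin n) (i : Fin n × ℕ) :
    shiftRow v i = if i.1 = v then (v, i.2 + 1) else i := rfl

theorem shiftRow_fst {n : ℕ} (v : Fin n) (i : Fin n × ℕ) : (shiftRow v i).1 = i.1 := by
  rw [shiftRow_apply]
  split_ifs with h <;> simp [h]

theorem insertRow_shiftRow {n : ℕ} {X : Type*} (v : Fin n) (x : X) (f : Fin n × ℕ → X)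
    (i : Fin n × ℕ) : insertRow v x f (shiftRow v i) = f i := by
  obtain ⟨u, k⟩ := i
  by_cases hu : u = v
  · subst hu; simp [shiftRow_apply]
  · simp [shiftRow_apply, hu, insertRow_of_ne]

theorem shiftRow_ne {n : ℕ} (v : Fin n) (i : Fin n × ℕ) : shiftRow v i ≠ (v, 0) := by
  obtain ⟨u, k⟩ := i
  rw [shiftRow_apply]
  split_ifs with h
  · simp
  · intro h'; exact h (congrArg Prod.fst h')

theorem exists_shiftRow {n : ℕ} (v : Fin n) {i : Fin n × ℕ} (hi : i ≠ (v, 0)) :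
    ∃ j, shiftRow v j = i := by
  obtain ⟨u, k⟩ := i
  by_cases hu : u = v
  · subst hu
    cases k with
    | zero => simp at hi
    | succ k => exact ⟨(u, k), by simp [shiftRow_apply]⟩
  · exact ⟨(u, k), by simp [shiftRow_apply, hu]⟩

/-- An independent entry of the same law put in front of an i.i.d. row gives an i.i.d. row again. It
is enough to compare finite boxes, whose coordinates other than `(v, 0)` are reindexed by
`shiftRow`. -/
theorem map_insertRow_prod_infinitePi {n : ℕ} {X : Type*} [MeasurableSpace X]
    (μ : Fin n → Measure X) [∀ v, IsProbabilityMeasure (μ v)] (v : Fin n) :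
    ((μ v).prod (Measure.infinitePi fun i : Fin n × ℕ => μ i.1)).map
      (fun y => insertRow v y.1 y.2) = Measure.infinitePi fun i : Fin n × ℕ => μ i.1 := by
  classical
  refine Measure.eq_infinitePi _ fun s t ht => ?_
  rw [Measure.map_apply (measurable_insertRow v)
    (.pi s.countable_toSet fun i _ => ht i)]
  set s' : Finset (Fin n × ℕ) := s.preimage (shiftRow v) (shiftRow v).injective.injOn
  have hpre : (fun y : X × (Fin n × ℕ → X) => insertRow v y.1 y.2) ⁻¹' Set.pi s t =
      (if (v, 0) ∈ s then t (v, 0) else Set.univ) ×ˢ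
        Set.pi s' (fun j => t (shiftRow v j)) := by
    ext ⟨x, f⟩
    simp only [Set.mem_preimage, Set.mem_pi, Finset.mem_coe, Set.mem_prod]
    constructor
    · intro h
      refine ⟨?_, fun j hj => ?_⟩
      · split_ifs with h0
        · simpa using h _ h0
        · trivial
      · have := h _ (Finset.mem_preimage.1 hj)
        rwa [insertRow_shiftRow] at this
    · rintro ⟨h1, h2⟩ i hi
      by_cases h0 : i = (v, 0)
      · subst h0
        simpa [hi] using h1
      · obtain ⟨j, rfl⟩ := exists_shiftRow v h0
        rw [insertRow_shiftRow]
        exact h2 j (Finset.mem_preimage.2 hi)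
  rw [hpre, Measure.prod_prod, Measure.infinitePi_pi _ (fun j _ => ht _)]
  have hmap : ∏ j ∈ s', μ j.1 (t (shiftRow v j)) = ∏ i ∈ s.erase (v, 0), μ i.1 (t i) := by
    have : s.erase (v, 0) = s'.map (shiftRow v) := by
      ext i
      simp only [Finset.mem_erase, Finset.mem_map]
      constructor
      · rintro ⟨h0, hi⟩
        obtain ⟨j, rfl⟩ := exists_shiftRow v h0
        exact ⟨j, Finset.mem_preimage.2 hi, rfl⟩
      · rintro ⟨j, hj, rfl⟩
        exact ⟨shiftRow_ne v j, Finset.mem_preimage.1 hj⟩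
    rw [this, Finset.prod_map]
    exact Finset.prod_congr rfl fun j _ => by rw [shiftRow_fst]
  rw [hmap]
  by_cases h0 : (v, 0) ∈ s
  · rw [if_pos h0, Finset.mul_prod_erase s (fun i => μ i.1 (t i)) h0]
  · rw [if_neg h0, measure_univ, one_mul, Finset.erase_eq_of_notMem h0]

theorem lintegral_expMeasure_one {f : ℝ → ℝ≥0∞} (hf : Measurable f) :
    ∫⁻ x, f x ∂(expMeasure 1) = ∫⁻ x in Set.Ioi 0, ENNReal.ofReal (Real.exp (-x)) * f x := by
  have h1 : expMeasure 1 = volume.withDensity (exponentialPDF 1) := rfl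
  have hm : Measurable (exponentialPDF 1) := (measurable_exponentialPDFReal 1).ennreal_ofReal
  rw [h1, lintegral_withDensity_eq_lintegral_mul _ hm hf,
    ← lintegral_indicator measurableSet_Ioi]
  refine lintegral_congr_ae ?_
  have : ∀ᵐ x : ℝ, x ≠ 0 := by simp [ae_iff]
  filter_upwards [this] with x hx
  rcases lt_or_gt_of_ne hx with h | h
  · simp [exponentialPDF_of_neg h, h.le]
  · simp [exponentialPDF_of_nonneg h.le, h]

/-- Memorylessness in the form of a density: the shift by `σ` sends the exponential law to `exp σ`
times its restriction to times after `σ`. -/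
theorem expMeasure_one_preimage_add {σ : ℝ} (hσ : 0 ≤ σ) {A : Set ℝ} (hA : MeasurableSet A) :
    expMeasure 1 ((fun x => x + σ) ⁻¹' A) =
      ENNReal.ofReal (Real.exp σ) * expMeasure 1 (A ∩ Set.Ioi σ) := by
  have hA' : MeasurableSet ((fun x => x + σ) ⁻¹' A) := hA.preimage (by fun_prop)
  have hI : MeasurableSet (A ∩ Set.Ioi σ) := hA.inter measurableSet_Ioi
  rw [← lintegral_indicator_one hA', ← lintegral_indicator_one hI,
    lintegral_expMeasure_one (measurable_one.indicator hA'),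
    lintegral_expMeasure_one (measurable_one.indicator hI),
    ← lintegral_indicator measurableSet_Ioi, ← lintegral_indicator measurableSet_Ioi,
    ← lintegral_const_mul' _ _ ENNReal.ofReal_ne_top]
  refine Eq.trans ?_ (lintegral_add_right_eq_self _ σ)
  refine lintegral_congr fun x => ?_
  by_cases hx : 0 < x
  · by_cases hxA : x + σ ∈ A
    · have : 0 < x + σ := by linarith
      simp only [Set.indicator, Set.mem_Ioi, this, if_true, Set.mem_inter_iff, hxA, hx, true_and,
        Set.mem_preimage, Pi.one_apply, mul_one, lt_add_iff_pos_left]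
      rw [← ENNReal.ofReal_mul (Real.exp_nonneg _), ← Real.exp_add]
      congr 2
      ring
    · simp [Set.indicator, hxA]
  · simp [Set.indicator, hx]

theorem measurable_delayFirst {n : ℕ} (v : Fin n) :
    Measurable fun y : ℝ × Waits n => delayFirst v y.1 y.2 := by
  refine measurable_pi_lambda _ fun i => ?_
  simp only [delayFirst]
  split_ifs <;> fun_prop

/-- The law of the waiting times. -/
noncomputable abbrev waitsLaw (n : ℕ) : Measure (Waits n) :=
  Measure.infinitePi fun _ : Fin n × ℕ => expMeasure 1

/-- The factor `exp σ` of memorylessness appears once for each of the `n - 1` clocks other than that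
of `v`. -/
theorem map_delayFirst_waitsLaw {n : ℕ} (v : Fin n) {σ : ℝ} (hσ : 0 ≤ σ) :
    (waitsLaw n).map (delayFirst v σ) = ENNReal.ofReal (Real.exp σ) ^ (n - 1) •
      (waitsLaw n).restrict {w | ∀ u, u ≠ v → σ < w (u, 0)} := by
  classical
  set f : Fin n × ℕ → ℝ → ℝ := fun i x => if i.1 ≠ v ∧ i.2 = 0 then x + σ else x with hf
  have hfm : ∀ i, Measurable (f i) := fun i => by
    simp only [hf]; split_ifs <;> fun_prop
  have h1 : (waitsLaw n).map (delayFirst v σ) =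
      Measure.infinitePi fun i => (expMeasure 1).map (f i) :=
    Measure.infinitePi_map_pi (fun _ : Fin n × ℕ => expMeasure 1) hfm
  have (i : Fin n × ℕ) : IsProbabilityMeasure ((expMeasure 1).map (f i)) :=
    Measure.isProbabilityMeasure_map (hfm i).aemeasurable
  rw [h1]
  symm
  refine Measure.eq_infinitePi _ fun s t ht => ?_
  set T : Finset (Fin n × ℕ) := (Finset.univ.erase v).image fun u => (u, 0) with hT
  have hmemT : ∀ i : Fin n × ℕ, i ∈ T ↔ i.1 ≠ v ∧ i.2 = 0 := by
    rintro ⟨u, k⟩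
    simp [hT, eq_comm]
  -- Coordinates outside the box get the full line, so that both sides become products over the same
  -- index set `s ∪ T`.
  set t' : Fin n × ℕ → Set ℝ := fun i => if i ∈ s then t i else Set.univ with ht'
  have ht'm : ∀ i, MeasurableSet (t' i) := fun i => by
    simp only [ht']; split_ifs <;> simp [ht]
  set t'' : Fin n × ℕ → Set ℝ := fun i => t' i ∩ if i ∈ T then Set.Ioi σ else Set.univ with ht''
  have ht''m : ∀ i, MeasurableSet (t'' i) := fun i =>
    (ht'm i).inter (by split_ifs; exacts [measurableSet_Ioi, .univ])
  have hset : Set.pi s t ∩ {w : Waits n | ∀ u, u ≠ v → σ < w (u, 0)} =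
      Set.pi (s ∪ T : Finset _) t'' := by
    ext w
    simp only [Set.mem_inter_iff, Set.mem_pi, Finset.mem_coe, Set.mem_ofPred_eq, Finset.mem_union,
      ht'', ht']
    constructor
    · rintro ⟨h1, h2⟩ i hi
      refine ⟨?_, ?_⟩
      · split_ifs with h
        · exact h1 i h
        · trivial
      · split_ifs with h
        · obtain ⟨u, k⟩ := i
          obtain ⟨hu, hk⟩ := (hmemT _).1 h
          simp only at hk hu
          subst hk
          exact h2 u hu
        · trivial
    · intro h
      refine ⟨fun i hi => ?_, fun u hu => ?_⟩
      · simpa [hi] using (h i (Or.inl hi)).1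
      · have hT' : (u, 0) ∈ T := (hmemT _).2 ⟨hu, rfl⟩
        simpa [hT'] using (h (u, 0) (Or.inr hT')).2
  have hprod : ∏ i ∈ s, ((expMeasure 1).map (f i)) (t i) =
      ∏ i ∈ s ∪ T, ((expMeasure 1).map (f i)) (t' i) := by
    rw [← Finset.prod_subset Finset.subset_union_left]
    · exact Finset.prod_congr rfl fun i hi => by simp [ht', hi]
    · intro i _ hi
      simp [ht', hi]
  have hfac : ∀ i, ((expMeasure 1).map (f i)) (t' i) =
      (if i ∈ T then ENNReal.ofReal (Real.exp σ) else 1) * expMeasure 1 (t'' i) := by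
    intro i
    rw [Measure.map_apply (hfm i) (ht'm i)]
    by_cases hi : i ∈ T
    · have : f i = fun x => x + σ := by
        funext x
        simp only [hf, (hmemT i).1 hi, ne_eq, not_false_eq_true, and_self, if_true]
      rw [this, expMeasure_one_preimage_add hσ (ht'm i)]
      simp [ht'', hi]
    · have : f i = fun x => x := by
        funext x
        simp only [hf, (hmemT i).not.1 hi, if_false]
      rw [this]
      simp [ht'', hi]
  have hcard : T.card = n - 1 := by
    rw [hT, Finset.card_image_of_injective _ (fun a b h => by simpa using h)]
    simp
  rw [hprod, Finset.prod_congr rfl fun i _ => hfac i, Finset.prod_mul_distrib,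
    Finset.prod_ite_mem, Finset.union_inter_cancel_right, Finset.prod_const, hcard,
    Measure.smul_apply, Measure.restrict_apply (.pi s.countable_toSet fun i _ => ht i), hset,
    Measure.infinitePi_pi _ (fun i _ => ht''m i), smul_eq_mul]

/-- The event that the clock of `v` is the first to ring. -/
def firstRing {n : ℕ} (v : Fin n) : Set (Waits n) :=
  {w | 0 < w (v, 0) ∧ ∀ u, u ≠ v → w (v, 0) < w (u, 0)}

theorem measurableSet_firstRing {n : ℕ} (v : Fin n) : MeasurableSet (firstRing v) := by
  have : firstRing v = {w : Waits n | 0 < w (v, 0)} ∩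
      ⋂ u, {w | u ≠ v → w (v, 0) < w (u, 0)} := by
    ext; simp [firstRing]
  rw [this]
  refine (measurableSet_lt measurable_const (measurable_pi_apply _)).inter (.iInter fun u => ?_)
  by_cases hu : u = v
  · simp [hu]
  · simpa only [ne_eq, hu, not_false_eq_true, forall_const] using
      measurableSet_lt (measurable_pi_apply (v, 0)) (measurable_pi_apply (u, 0))

/-- The density `exp (-σ)` of the first wait of `v` meets the probability `exp (-(n - 1) σ)` that
the other clocks stay silent; given this silence, their remaining waits are fresh. -/
theorem setLIntegral_firstRing {n : ℕ} (v : Fin n) {H : Waits n → ℝ≥0∞} (hH : Measurable H) :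
    ∫⁻ w in firstRing v, H w ∂(waitsLaw n) =
      ∫⁻ σ in Set.Ioi 0, ENNReal.ofReal (Real.exp (-(n * σ))) *
        ∫⁻ w, H (insertRow v σ (delayFirst v σ w)) ∂(waitsLaw n) := by
  have hn : 0 < n := v.pos
  have hmeas := measurable_insertRow (X := ℝ) v
  rw [← lintegral_indicator (measurableSet_firstRing v)]
  conv_lhs => rw [waitsLaw, ← map_insertRow_prod_infinitePi (fun _ : Fin n => expMeasure 1) v]
  have hHm := hH.indicator (measurableSet_firstRing v)
  rw [lintegral_map hHm hmeas, lintegral_prod (fun y => (firstRing v).indicator H (insertRow v y.1 y.2))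
    (hHm.comp hmeas).aemeasurable]
  refine (lintegral_expMeasure_one (hHm.comp hmeas).lintegral_prod_right').trans ?_
  refine setLIntegral_congr_fun measurableSet_Ioi fun σ hσ => ?_
  have hσ : 0 < σ := hσ
  have hE : MeasurableSet {w : Waits n | ∀ u, u ≠ v → σ < w (u, 0)} := by
    have : {w : Waits n | ∀ u, u ≠ v → σ < w (u, 0)} = ⋂ u, {w | u ≠ v → σ < w (u, 0)} := by
      ext; simp
    rw [this]
    refine .iInter fun u => ?_
    by_cases hu : u = v
    · simp [hu]
    · simpa only [ne_eq, hu, not_false_eq_true, forall_const] using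
        measurableSet_lt measurable_const (measurable_pi_apply _)
  have hins : Measurable fun w : Waits n => insertRow v σ w :=
    hmeas.comp (measurable_const.prodMk measurable_id)
  have hdel : Measurable fun w : Waits n => delayFirst v σ w :=
    (measurable_delayFirst v).comp (measurable_const.prodMk measurable_id)
  have h1 : ∀ w : Waits n, (firstRing v).indicator H (insertRow v σ w) =
      {w : Waits n | ∀ u, u ≠ v → σ < w (u, 0)}.indicator (fun w => H (insertRow v σ w)) w := by
    intro w
    simp only [Set.indicator]
    congr 1
    simp only [firstRing, Set.mem_ofPred_eq, insertRow_zero, hσ, true_and, eq_iff_iff]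
    refine forall_congr' fun u => ⟨fun h hu => ?_, fun h hu => ?_⟩
    · simpa [insertRow_of_ne, hu] using h hu
    · simpa [insertRow_of_ne, hu] using h hu
  have h2 : ∫⁻ w, H (insertRow v σ (delayFirst v σ w)) ∂(waitsLaw n) =
      ENNReal.ofReal (Real.exp σ) ^ (n - 1) *
      ∫⁻ w in {w : Waits n | ∀ u, u ≠ v → σ < w (u, 0)}, H (insertRow v σ w) ∂(waitsLaw n) := by
    rw [← lintegral_map (f := fun w => H (insertRow v σ w)) (hH.comp hins) hdel,
      map_delayFirst_waitsLaw v hσ.le, lintegral_smul_measure, smul_eq_mul]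
  simp only [Function.comp_def, h1, h2]
  rw [lintegral_indicator hE, ← mul_assoc, ← ENNReal.ofReal_pow (Real.exp_nonneg _),
    ← ENNReal.ofReal_mul (Real.exp_nonneg _), ← Real.exp_nat_mul, ← Real.exp_add]
  congr 3
  rw [Nat.cast_sub hn]
  push_cast
  ring

/-- Markov property at the first ring in law: ring time, first contact and the remaining protocol
are independent, and the remaining protocol has the original law. -/
theorem protocolLaw_inter_firstRing {n : ℕ} (G : SimpleGraph (Fin n)) (v : Fin n)
    {A : Set (Waits n × Contacts n)} (hA : MeasurableSet A) :
    protocolLaw G (A ∩ Prod.fst ⁻¹' firstRing v) =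
      ∫⁻ σ in Set.Ioi 0, ENNReal.ofReal (Real.exp (-(n * σ))) *
        ∑ x, contactLaw G v x * protocolLaw G
          {ω | (insertRow v σ (delayFirst v σ ω.1), insertRow v x ω.2) ∈ A} := by
  have hC := map_insertRow_prod_infinitePi (fun u => (contactLaw G u).toMeasure) v
  set C : Measure (Contacts n) := Measure.infinitePi fun i => (contactLaw G i.1).toMeasure with hCdef
  have hP : protocolLaw G = (waitsLaw n).prod C := rfl
  have hins := measurable_insertRow (X := Fin n) v
  have hfst : MeasurableSet (Prod.fst ⁻¹' firstRing v : Set (Waits n × Contacts n)) :=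
    (measurableSet_firstRing v).preimage measurable_fst
  have hsec : ∀ w, C (Prod.mk w ⁻¹' A) =
      ∑ x, contactLaw G v x * C {c | (w, insertRow v x c) ∈ A} := by
    intro w
    have hAw : MeasurableSet (Prod.mk w ⁻¹' A) := hA.preimage measurable_prodMk_left
    conv_lhs => rw [← hC]
    rw [Measure.map_apply hins hAw, Measure.prod_apply (hAw.preimage hins), lintegral_fintype]
    refine Finset.sum_congr rfl fun x _ => ?_
    rw [mul_comm, PMF.toMeasure_apply_singleton _ _ (measurableSet_singleton x)]
    rfl
  have hsm : ∀ x : Fin n, MeasurableSet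
      {y : Waits n × Contacts n | (y.1, insertRow v x y.2) ∈ A} := fun x =>
    hA.preimage (measurable_fst.prodMk
      (hins.comp (measurable_const.prodMk measurable_snd)))
  rw [hP, Measure.prod_apply (hA.inter hfst)]
  have h1 : ∀ w, C (Prod.mk w ⁻¹' (A ∩ Prod.fst ⁻¹' firstRing v)) =
      (firstRing v).indicator (fun w => C (Prod.mk w ⁻¹' A)) w := by
    intro w
    by_cases hw : w ∈ firstRing v
    · rw [Set.indicator_of_mem hw]
      congr 1
      ext c
      simp [hw]
    · rw [Set.indicator_of_notMem hw]
      convert measure_empty (μ := C)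
      ext c
      simp [hw]
  simp only [h1]
  rw [lintegral_indicator (measurableSet_firstRing v), setLIntegral_firstRing v
    (measurable_measure_prodMk_left hA)]
  refine lintegral_congr fun σ => ?_
  congr 1
  simp only [hsec]
  have hid : Measurable fun w : Waits n => insertRow v σ (delayFirst v σ w) :=
    (measurable_insertRow v).comp (measurable_const.prodMk
      ((measurable_delayFirst v).comp (measurable_const.prodMk measurable_id)))
  rw [lintegral_finsetSum]
  · refine Finset.sum_congr rfl fun x _ => ?_
    have hm : MeasurableSet {ω : Waits n × Contacts n |
        (insertRow v σ (delayFirst v σ ω.1), insertRow v x ω.2) ∈ A} :=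
      (hsm x).preimage (f := fun ω : Waits n × Contacts n =>
        (insertRow v σ (delayFirst v σ ω.1), ω.2)) ((hid.comp measurable_fst).prodMk measurable_snd)
    rw [lintegral_const_mul, Measure.prod_apply hm]
    · rfl
    · exact (measurable_measure_prodMk_left (hsm x)).comp hid
  · intro x _
    exact ((measurable_measure_prodMk_left (hsm x)).comp hid).const_mul _

/-! ### The Markov chain of informed sets -/

instance instIsProbabilityMeasureProtocolLaw {n : ℕ} (G : SimpleGraph (Fin n)) :
    IsProbabilityMeasure (protocolLaw G) := by
  unfold protocolLaw
  infer_instance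

theorem ae_waits_pos {n : ℕ} (G : SimpleGraph (Fin n)) :
    ∀ᵐ ω ∂(protocolLaw G), ∀ i, 0 < ω.1 i := by
  rw [ae_all_iff]
  intro i
  have h1 : ∀ᵐ x ∂(expMeasure 1), 0 < x := by
    rw [ae_iff]
    have hm : MeasurableSet {x : ℝ | ¬ 0 < x} := by
      simp only [not_lt]
      exact measurableSet_Iic
    rw [← lintegral_indicator_one hm, lintegral_expMeasure_one (measurable_one.indicator hm),
      setLIntegral_congr_fun (g := fun _ => 0) measurableSet_Ioi]
    · simp
    · intro x hx
      have : 0 < x := hx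
      simp [Set.indicator, this]
  have h2 := ((measurePreserving_eval_infinitePi
    (fun _ : Fin n × ℕ => expMeasure 1) i).quasiMeasurePreserving.ae h1)
  exact (Measure.quasiMeasurePreserving_fst (μ := waitsLaw n)
    (ν := Measure.infinitePi fun i : Fin n × ℕ => (contactLaw G i.1).toMeasure)).ae h2

theorem integrableOn_exp_neg_mul {a : ℝ} (ha : 0 < a) (t : ℝ) :
    IntegrableOn (fun σ => Real.exp (-(a * σ))) (Set.Ioi t) := by
  simpa only [neg_mul] using exp_neg_integrableOn_Ioi t ha

theorem setIntegral_exp_neg_mul {a : ℝ} (ha : 0 < a) (t : ℝ) :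
    ∫ σ in Set.Ioi t, Real.exp (-(a * σ)) = Real.exp (-(a * t)) / a := by
  have := integral_exp_mul_Ioi (a := -a) (by linarith) t
  simp only [neg_mul] at this
  rw [this, neg_div_neg_eq]

theorem setLIntegral_exp_neg_mul {a : ℝ} (ha : 0 < a) :
    ∫⁻ σ in Set.Ioi (0 : ℝ), ENNReal.ofReal (Real.exp (-(a * σ))) = ENNReal.ofReal a⁻¹ := by
  rw [← ofReal_integral_eq_lintegral_ofReal (integrableOn_exp_neg_mul ha 0)
    (ae_of_all _ fun _ => (Real.exp_pos _).le), setIntegral_exp_neg_mul ha]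
  simp

theorem sum_contactLaw {n : ℕ} (G : SimpleGraph (Fin n)) (v : Fin n) :
    ∑ x, contactLaw G v x = 1 := by
  rw [← tsum_fintype (L := .unconditional _)]
  exact (contactLaw G v).tsum_coe

/-- The `n` events `firstRing v` are disjoint and each has probability `1 / n`, so they cover almost
everything; ties need no separate argument. -/
theorem protocolLaw_eq_sum_firstRing {n : ℕ} [NeZero n] (G : SimpleGraph (Fin n))
    {A : Set (Waits n × Contacts n)} (hA : MeasurableSet A) :
    protocolLaw G A = ∑ v, protocolLaw G (A ∩ Prod.fst ⁻¹' firstRing v) := by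
  have hn : (0 : ℝ) < n := by exact_mod_cast Nat.pos_of_ne_zero (NeZero.ne n)
  have hm : ∀ v : Fin n,
      MeasurableSet (Prod.fst ⁻¹' firstRing v : Set (Waits n × Contacts n)) :=
    fun v => (measurableSet_firstRing v).preimage measurable_fst
  have hdisj : Pairwise (Function.onFun Disjoint
      fun v => (Prod.fst ⁻¹' firstRing v : Set (Waits n × Contacts n))) := by
    intro u v huv
    refine Disjoint.preimage _ (Set.disjoint_left.2 fun w hu hv => ?_)
    exact lt_asymm (hu.2 v huv.symm) (hv.2 u huv)
  have hcover : protocolLaw G (⋃ v, Prod.fst ⁻¹' firstRing v) = 1 := by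
    rw [measure_iUnion hdisj hm, tsum_fintype]
    have : ∀ v : Fin n, protocolLaw G (Prod.fst ⁻¹' firstRing v) = ENNReal.ofReal (n : ℝ)⁻¹ := by
      intro v
      have := protocolLaw_inter_firstRing G v (A := Set.univ) .univ
      rw [Set.univ_inter] at this
      rw [this, ← setLIntegral_exp_neg_mul hn]
      refine lintegral_congr fun σ => ?_
      simp [sum_contactLaw]
    simp only [this, Finset.sum_const, Finset.card_univ, Fintype.card_fin, nsmul_eq_mul]
    rw [← ENNReal.ofReal_natCast, ← ENNReal.ofReal_mul (Nat.cast_nonneg _),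
      mul_inv_cancel₀ hn.ne', ENNReal.ofReal_one]
  have hnull : protocolLaw G (⋃ v, Prod.fst ⁻¹' firstRing v : Set (Waits n × Contacts n))ᶜ = 0 := by
    rw [prob_compl_eq_zero_iff (.iUnion hm)]
    exact hcover
  rw [← measure_inter_add_sdiff A (.iUnion hm), measure_mono_null
    (fun x hx => hx.2 : A \ _ ⊆ (⋃ v, Prod.fst ⁻¹' firstRing v)ᶜ) hnull, add_zero,
    Set.inter_iUnion, measure_iUnion (fun u v huv => (hdisj huv).mono Set.inter_subset_right
      Set.inter_subset_right) (fun v => hA.inter (hm v)), tsum_fintype]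

/-- The probability that the informed set is `J` at time `t`, when it is `I` at time `0`. -/
noncomputable def transProb {n : ℕ} (G : SimpleGraph (Fin n)) (B I J : Finset (Fin n)) (t : ℝ) :
    ℝ :=
  (protocolLaw G).real {ω | informedSet I B ω t = J}

/-! ### Transition probabilities and their renewal equation -/

section TransProb

variable {n : ℕ} (G : SimpleGraph (Fin n)) (B I J : Finset (Fin n))

theorem transProb_nonneg (t : ℝ) : 0 ≤ transProb G B I J t := measureReal_nonneg

theorem transProb_le_one (t : ℝ) : transProb G B I J t ≤ 1 := measureReal_le_one

theorem measurable_transProb : Measurable (transProb G B I J) :=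
  (measurable_measure_prodMk_left (ν := protocolLaw G)
    (measurableSet_informedSet_eq I B J)).ennreal_toReal

theorem sum_transProb (t : ℝ) : ∑ J, transProb G B I J t = 1 := by
  have := measureReal_iUnion_fintype (μ := protocolLaw G)
    (f := fun J : Finset (Fin n) => {ω : Waits n × Contacts n | informedSet I B ω t = J})
    (fun J K hJK => Set.disjoint_left.2 fun ω h h' => hJK (h.symm.trans h'))
    (fun J => measurableSet_informedSet_eq_at I B J t)
  unfold transProb
  rw [← this]
  have h : (⋃ J, {ω : Waits n × Contacts n | informedSet I B ω t = J}) = Set.univ := by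
    ext ω; simp
  rw [h]
  simp

theorem transProb_eq_zero {t : ℝ} (ht : 0 ≤ t) (h : ¬ I ⊆ J) : transProb G B I J t = 0 := by
  unfold transProb
  convert measureReal_empty
  ext ω
  simp only [Set.mem_ofPred_eq, Set.mem_empty_iff_false, iff_false]
  rintro rfl
  exact h (subset_informedSet ht)

/-- The probability that `v` contacts `x` at a given ring of its clock. -/
noncomputable def contactProb (v x : Fin n) : ℝ := (contactLaw G v x).toReal

theorem contactProb_nonneg (v x : Fin n) : 0 ≤ contactProb G v x := ENNReal.toReal_nonneg

theorem sum_contactProb (v : Fin n) : ∑ x, contactProb G v x = 1 := by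
  unfold contactProb
  rw [← ENNReal.toReal_sum (fun x _ => PMF.apply_ne_top _ _), sum_contactLaw, ENNReal.toReal_one]

/-- Averaging over the first contact. -/
noncomputable def jumpSum (Φ : Finset (Fin n) → ℝ) : ℝ :=
  ∑ v, ∑ x, contactProb G v x * Φ (contactStep B I v x)

-- Conditioning on the first ring. If it comes after `t` the set is still `I`; the value `n` in that
-- case collects one unit from each of the `n` clocks.
open Classical in
theorem transProb_renewal_lintegral [NeZero n] {t : ℝ} (ht : 0 ≤ t) :
    ENNReal.ofReal (transProb G B I J t) = ∫⁻ σ in Set.Ioi 0, ENNReal.ofReal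
      (Real.exp (-(n * σ)) * if σ ≤ t then jumpSum G B I (fun K => transProb G B K J (t - σ))
        else if I = J then (n : ℝ) else 0) := by
  have hA := measurableSet_informedSet_eq_at I B J t
  unfold transProb
  rw [ofReal_measureReal, protocolLaw_eq_sum_firstRing G hA,
    Finset.sum_congr rfl fun v _ => protocolLaw_inter_firstRing G v hA]
  -- The pathwise Markov property needs positive waits, hence the identity only holds up to a null
  -- set.
  have hval : ∀ v x : Fin n, ∀ σ : ℝ, 0 < σ → protocolLaw G
      {ω | (insertRow v σ (delayFirst v σ ω.1), insertRow v x ω.2) ∈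
        {ω | informedSet I B ω t = J}} =
      ENNReal.ofReal (if σ ≤ t then transProb G B (contactStep B I v x) J (t - σ)
        else if I = J then 1 else 0) := by
    intro v x σ hσ
    have : ENNReal.ofReal (if σ ≤ t then transProb G B (contactStep B I v x) J (t - σ)
        else if I = J then 1 else 0) = protocolLaw G {ω |
          if σ ≤ t then informedSet (contactStep B I v x) B ω (t - σ) = J else I = J} := by
      split_ifs with h1 h2
      · unfold transProb
        rw [ofReal_measureReal]
      · simp [h2]
      · simp [h2]
    rw [this]
    refine measure_congr ?_
    filter_upwards [ae_waits_pos G] with ω hω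
    refine propext ?_
    change informedSet I B (insertRow v σ (delayFirst v σ ω.1), insertRow v x ω.2) t = J ↔
      (if σ ≤ t then informedSet (contactStep B I v x) B ω (t - σ) = J else I = J)
    split_ifs with h
    · rw [informedSet_insert_of_le hω hσ h]
    · rw [informedSet_insert_of_lt hω ht (not_le.1 h)]
  have hmeas : ∀ v x : Fin n, Measurable fun σ : ℝ => 
      (if σ ≤ t then transProb G B (contactStep B I v x) J (t - σ)
        else if I = J then 1 else 0) := fun v x =>
    Measurable.ite measurableSet_Iic
      ((measurable_transProb G B _ J).comp (by fun_prop)) measurable_const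
  have hnn : ∀ (v x : Fin n) (σ : ℝ), 0 ≤ (if σ ≤ t then transProb G B (contactStep B I v x) J (t - σ)
        else if I = J then (1 : ℝ) else 0) := fun v x σ => by
    split_ifs
    exacts [transProb_nonneg _ _ _ _ _, zero_le_one, le_rfl]
  have hstep : ∀ v : Fin n, ∫⁻ σ in Set.Ioi 0, ENNReal.ofReal (Real.exp (-(n * σ))) *
        ∑ x, contactLaw G v x * protocolLaw G
          {ω | (insertRow v σ (delayFirst v σ ω.1), insertRow v x ω.2) ∈
            {ω | informedSet I B ω t = J}} =
      ∫⁻ σ in Set.Ioi 0, ENNReal.ofReal (Real.exp (-(n * σ)) * ∑ x, contactProb G v x *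
        (if σ ≤ t then transProb G B (contactStep B I v x) J (t - σ)
        else if I = J then (1 : ℝ) else 0)) := by
    intro v
    refine setLIntegral_congr_fun measurableSet_Ioi fun σ hσ => ?_
    rw [ENNReal.ofReal_mul (Real.exp_nonneg _), ENNReal.ofReal_sum_of_nonneg
      (fun x _ => mul_nonneg (contactProb_nonneg _ _ _) (hnn v x σ))]
    congr 1
    refine Finset.sum_congr rfl fun x _ => ?_
    rw [hval v x σ hσ, ENNReal.ofReal_mul (contactProb_nonneg _ _ _), contactProb,
      ENNReal.ofReal_toReal (PMF.apply_ne_top _ _)]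
  rw [Finset.sum_congr rfl fun v _ => hstep v, ← lintegral_finsetSum]
  · refine lintegral_congr fun σ => ?_
    rw [← ENNReal.ofReal_sum_of_nonneg (fun v _ => mul_nonneg (Real.exp_nonneg _)
      (Finset.sum_nonneg fun x _ => mul_nonneg (contactProb_nonneg _ _ _) (hnn v x σ))),
      ← Finset.mul_sum]
    congr 2
    by_cases h : σ ≤ t
    · simp only [h, if_true]
      rfl
    · simp only [h, if_false, ← Finset.sum_mul, sum_contactProb]
      split_ifs <;> simp
  · intro v _
    refine ((by fun_prop : Measurable fun σ : ℝ => Real.exp (-(n * σ))).mul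
      (Finset.measurable_sum _ fun x _ => (hmeas v x).const_mul _)).ennreal_ofReal

end TransProb

/-! ### Kolmogorov's equation and the semigroup of the chain -/

section Generator

variable {n : ℕ} (G : SimpleGraph (Fin n)) (B I J : Finset (Fin n))

theorem measurable_jumpSum_transProb :
    Measurable fun r => jumpSum G B I (fun K => transProb G B K J r) := by
  unfold jumpSum
  exact Finset.measurable_sum _ fun v _ => Finset.measurable_sum _ fun x _ =>
    (measurable_transProb G B _ J).const_mul _

theorem jumpSum_nonneg {Φ : Finset (Fin n) → ℝ} (h : ∀ K, 0 ≤ Φ K) : 0 ≤ jumpSum G B I Φ :=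
  Finset.sum_nonneg fun v _ => Finset.sum_nonneg fun x _ =>
    mul_nonneg (contactProb_nonneg G v x) (h _)

theorem jumpSum_le {Φ : Finset (Fin n) → ℝ} {a : ℝ} (h : ∀ K, Φ K ≤ a) :
    jumpSum G B I Φ ≤ n * a := by
  unfold jumpSum
  calc ∑ v, ∑ x, contactProb G v x * Φ (contactStep B I v x)
      ≤ ∑ v, ∑ x, contactProb G v x * a :=
        Finset.sum_le_sum fun v _ => Finset.sum_le_sum fun x _ =>
          mul_le_mul_of_nonneg_left (h _) (contactProb_nonneg G v x)
    _ = n * a := by simp [← Finset.sum_mul, sum_contactProb]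

theorem integrableOn_of_bounded {f : ℝ → ℝ} (hf : Measurable f) {C : ℝ} (hC : ∀ x, |f x| ≤ C)
    (a b : ℝ) : IntervalIntegrable f volume a b :=
  ⟨Measure.integrableOn_of_bounded (M := C) (by simp) hf.aestronglyMeasurable
    (ae_of_all _ fun x => by simpa using hC x),
   Measure.integrableOn_of_bounded (M := C) (by simp) hf.aestronglyMeasurable
    (ae_of_all _ fun x => by simpa using hC x)⟩

-- The substitution `r = t - σ` turns the convolution into a smooth factor times a primitive. This
-- form permits a bootstrap: a bounded integrand gives continuity, and a continuous integrand gives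
-- differentiability.
open Classical in
theorem transProb_renewal [NeZero n] {t : ℝ} (ht : 0 ≤ t) :
    transProb G B I J t = Real.exp (-(n * t)) * ((if I = J then 1 else 0) +
      ∫ r in (0 : ℝ)..t, Real.exp (n * r) * jumpSum G B I (fun K => transProb G B K J r)) := by
  have hn : (0 : ℝ) < n := by exact_mod_cast Nat.pos_of_ne_zero (NeZero.ne n)
  set g : ℝ → ℝ := fun r => jumpSum G B I (fun K => transProb G B K J r) with hg
  have hgm : Measurable g := measurable_jumpSum_transProb G B I J
  have hg0 : ∀ r, 0 ≤ g r := fun r => jumpSum_nonneg _ _ _ fun K => transProb_nonneg _ _ _ _ _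
  have hg1 : ∀ r, g r ≤ n := fun r => by
    simpa using jumpSum_le G B I (fun K => transProb_le_one G B K J r)
  set c : ℝ := if I = J then (n : ℝ) else 0 with hc
  have hc0 : 0 ≤ c := by simp only [hc]; split_ifs <;> positivity
  have hc1 : c ≤ n := by simp only [hc]; split_ifs <;> simp
  set f : ℝ → ℝ := fun σ => Real.exp (-(n * σ)) * if σ ≤ t then g (t - σ) else c with hf
  have hin0 : ∀ σ, 0 ≤ (if σ ≤ t then g (t - σ) else c) := fun σ => by
    split_ifs; exacts [hg0 _, hc0]
  have hin1 : ∀ σ, (if σ ≤ t then g (t - σ) else c) ≤ n := fun σ => by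
    split_ifs; exacts [hg1 _, hc1]
  have hf0 : ∀ σ, 0 ≤ f σ := fun σ => mul_nonneg (Real.exp_nonneg _) (hin0 σ)
  have hfm : Measurable f := (by fun_prop : Measurable fun σ : ℝ => Real.exp (-(n * σ))).mul
    (Measurable.ite measurableSet_Iic (hgm.comp (by fun_prop)) measurable_const)
  have hfint : IntegrableOn f (Set.Ioi 0) := by
    refine Integrable.mono' ((integrableOn_exp_neg_mul hn 0).mul_const (n : ℝ))
      hfm.aestronglyMeasurable (ae_of_all _ fun σ => ?_)
    rw [Real.norm_of_nonneg (hf0 σ)]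
    exact mul_le_mul_of_nonneg_left (hin1 σ) (Real.exp_nonneg _)
  have h1 : transProb G B I J t = ∫ σ in Set.Ioi 0, f σ := by
    rw [integral_eq_lintegral_of_nonneg_ae (ae_of_all _ hf0) hfm.aestronglyMeasurable,
      ← transProb_renewal_lintegral G B I J ht,
      ENNReal.toReal_ofReal (transProb_nonneg _ _ _ _ _)]
  have h2 : ∫ σ in Set.Ioi 0, f σ = (∫ σ in (0 : ℝ)..t, f σ) + ∫ σ in Set.Ioi t, f σ :=
    (intervalIntegral.integral_interval_add_Ioi hfint
      (hfint.mono_set (Set.Ioi_subset_Ioi ht))).symm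
  have h3 : ∫ σ in Set.Ioi t, f σ = Real.exp (-(n * t)) * if I = J then 1 else 0 := by
    rw [setIntegral_congr_fun (g := fun σ => Real.exp (-(n * σ)) * c) measurableSet_Ioi,
      integral_mul_const, setIntegral_exp_neg_mul hn]
    · simp only [hc]
      split_ifs
      · field_simp
      · simp
    · intro σ hσ
      have : ¬ σ ≤ t := not_le.2 hσ
      simp [hf, this]
  have h4 : ∫ σ in (0 : ℝ)..t, f σ = Real.exp (-(n * t)) *
      ∫ r in (0 : ℝ)..t, Real.exp (n * r) * g r := by
    have : ∫ σ in (0 : ℝ)..t, f σ = ∫ σ in (0 : ℝ)..t,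
        (fun r => Real.exp (-(n * t)) * (Real.exp (n * r) * g r)) (t - σ) := by
      refine intervalIntegral.integral_congr fun σ hσ => ?_
      rw [Set.uIcc_of_le ht] at hσ
      simp only [hf, hσ.2, if_true]
      rw [← mul_assoc, ← Real.exp_add]
      congr 2
      ring
    rw [this, intervalIntegral.integral_comp_sub_left
      (fun r => Real.exp (-(n * t)) * (Real.exp (n * r) * g r)) t, sub_self, sub_zero,
      intervalIntegral.integral_const_mul]
  rw [h1, h2, h3, h4]
  ring

theorem continuousOn_transProb [NeZero n] : ContinuousOn (transProb G B I J) (Set.Ici 0) := by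
  classical
  have hintegrand : ∀ a b, IntervalIntegrable (fun r => Real.exp (n * r) *
      jumpSum G B I (fun K => transProb G B K J r)) volume a b := fun a b =>
    (integrableOn_of_bounded (measurable_jumpSum_transProb G B I J) (C := n) (fun r => by
      rw [abs_of_nonneg (jumpSum_nonneg _ _ _ fun K => transProb_nonneg _ _ _ _ _)]
      simpa using jumpSum_le G B I (fun K => transProb_le_one G B K J r)) a b).continuousOn_mul
      (by fun_prop)
  have hcont := intervalIntegral.continuous_primitive hintegrand 0
  have : Continuous fun t : ℝ => Real.exp (-(n * t)) * ((if I = J then 1 else 0) +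
      ∫ r in (0 : ℝ)..t, Real.exp (n * r) * jumpSum G B I (fun K => transProb G B K J r)) := by
    fun_prop
  exact this.continuousOn.congr fun t ht => transProb_renewal G B I J ht

theorem transProb_zero [NeZero n] [DecidableEq (Finset (Fin n))] :
    transProb G B I J 0 = if I = J then 1 else 0 := by
  rw [transProb_renewal G B I J le_rfl]
  split_ifs <;> simp

/-- Kolmogorov's backward equation, from the fundamental theorem of calculus applied to the renewal
equation. -/
theorem hasDerivWithinAt_transProb [NeZero n] {t : ℝ} (ht : 0 ≤ t) :
    HasDerivWithinAt (transProb G B I J)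
      (jumpSum G B I (fun K => transProb G B K J t) - n * transProb G B I J t) (Set.Ici 0) t := by
  classical
  -- Freezing the integrand at negative times makes it continuous on the whole line, so the
  -- primitive is differentiable at `0` as well.
  set g : ℝ → ℝ := fun r => jumpSum G B I (fun K => transProb G B K J (max r 0)) with hg
  have hgc : Continuous g := by
    simp only [hg, jumpSum]
    refine continuous_finsetSum _ fun v _ => continuous_finsetSum _ fun x _ =>
      continuous_const.mul ?_
    exact (continuousOn_transProb G B _ J).comp_continuous (by fun_prop) fun r =>
      Set.mem_Ici.2 (le_max_right _ _)
  set u : ℝ → ℝ := fun t => Real.exp (-(n * t)) * ((if I = J then 1 else 0) +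
      ∫ r in (0 : ℝ)..t, Real.exp (n * r) * g r) with hu
  have hEq : ∀ s, 0 ≤ s → transProb G B I J s = u s := by
    intro s hs
    rw [transProb_renewal G B I J hs]
    simp only [hu]
    congr 2
    refine intervalIntegral.integral_congr fun r hr => ?_
    rw [Set.uIcc_of_le hs] at hr
    simp only [hg, max_eq_left hr.1]
  have hder : HasDerivAt u (g t - n * u t) t := by
    have h1 : HasDerivAt (fun t => ∫ r in (0 : ℝ)..t, Real.exp (n * r) * g r)
        (Real.exp (n * t) * g t) t :=
      (by fun_prop : Continuous fun r => Real.exp (n * r) * g r).integral_hasStrictDerivAt 0 t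
        |>.hasDerivAt
    have h2 : HasDerivAt (fun t : ℝ => Real.exp (-(n * t))) (Real.exp (-(n * t)) * -n) t := by
      have := (((hasDerivAt_id t).const_mul (n : ℝ)).neg).exp
      simpa using this
    have h3 := h2.mul (h1.const_add (if I = J then (1 : ℝ) else 0))
    refine h3.congr_deriv ?_
    have : Real.exp (-(n * t)) * (Real.exp (n * t) * g t) = g t := by
      rw [← mul_assoc, ← Real.exp_add]; simp
    rw [this]
    simp only [hu]
    ring
  have hgt : g t = jumpSum G B I (fun K => transProb G B K J t) := by
    simp only [hg, max_eq_left ht]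
  rw [← hgt, hEq t ht]
  exact hder.hasDerivWithinAt.congr (fun s hs => hEq s hs) (hEq t ht)

/-- The generator of the Markov chain of informed sets. -/
noncomputable def generator : (Finset (Fin n) → ℝ) →ₗ[ℝ] (Finset (Fin n) → ℝ) where
  toFun Φ I := ∑ v, ∑ x, contactProb G v x * (Φ (contactStep B I v x) - Φ I)
  map_add' Φ Ψ := by
    funext I
    simp only [Pi.add_apply, ← Finset.sum_add_distrib]
    exact Finset.sum_congr rfl fun v _ => Finset.sum_congr rfl fun x _ => by ring
  map_smul' a Φ := by
    funext I
    simp only [Pi.smul_apply, smul_eq_mul, RingHom.id_apply, Finset.mul_sum]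
    exact Finset.sum_congr rfl fun v _ => Finset.sum_congr rfl fun x _ => by ring

theorem generator_apply (Φ : Finset (Fin n) → ℝ) : generator G B Φ I =
    ∑ v, ∑ x, contactProb G v x * (Φ (contactStep B I v x) - Φ I) := rfl

theorem generator_eq_jumpSum_sub (Φ : Finset (Fin n) → ℝ) :
    generator G B Φ I = jumpSum G B I Φ - n * Φ I := by
  simp [generator_apply, jumpSum, mul_sub, Finset.sum_sub_distrib, ← Finset.sum_mul,
    sum_contactProb]

/-- `evolve G B t Φ I` is the expectation of `Φ` at the informed set at time `t`, started from
`I`. -/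
noncomputable def evolve (t : ℝ) : (Finset (Fin n) → ℝ) →ₗ[ℝ] (Finset (Fin n) → ℝ) where
  toFun Φ I := ∑ J, transProb G B I J t * Φ J
  map_add' Φ Ψ := by
    funext I
    simp [mul_add, Finset.sum_add_distrib]
  map_smul' a Φ := by
    funext I
    simp only [Pi.smul_apply, smul_eq_mul, RingHom.id_apply, Finset.mul_sum]
    exact Finset.sum_congr rfl fun x _ => by ring

theorem evolve_apply (t : ℝ) (Φ : Finset (Fin n) → ℝ) :
    evolve G B t Φ I = ∑ J, transProb G B I J t * Φ J := rfl

variable {G B I}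

theorem evolve_mono {t : ℝ} (ht : 0 ≤ t) {Φ Ψ : Finset (Fin n) → ℝ}
    (h : ∀ J, I ⊆ J → Φ J ≤ Ψ J) : evolve G B t Φ I ≤ evolve G B t Ψ I := by
  rw [evolve_apply, evolve_apply]
  refine Finset.sum_le_sum fun J _ => ?_
  by_cases hJ : I ⊆ J
  · exact mul_le_mul_of_nonneg_left (h J hJ) (transProb_nonneg _ _ _ _ _)
  · simp [transProb_eq_zero G B I J ht hJ]

theorem evolve_const (t a : ℝ) : evolve G B t (fun _ => a) I = a := by
  rw [evolve_apply, ← Finset.sum_mul, sum_transProb, one_mul]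

theorem evolve_nonneg {t : ℝ} (ht : 0 ≤ t) {Φ : Finset (Fin n) → ℝ}
    (h : ∀ J, I ⊆ J → 0 ≤ Φ J) : 0 ≤ evolve G B t Φ I := by
  have := evolve_mono (G := G) (B := B) ht (Φ := fun _ => 0) h
  rwa [evolve_const] at this

variable (G B)

theorem evolve_zero [NeZero n] (Φ : Finset (Fin n) → ℝ) : evolve G B 0 Φ = Φ := by
  classical
  funext I
  simp [evolve_apply, transProb_zero]

theorem hasDerivWithinAt_evolve [NeZero n] (Φ : Finset (Fin n) → ℝ) {t : ℝ} (ht : 0 ≤ t) :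
    HasDerivWithinAt (fun t => evolve G B t Φ) (generator G B (evolve G B t Φ)) (Set.Ici 0) t := by
  rw [hasDerivWithinAt_pi]
  intro I
  simp only [evolve_apply]
  have := HasDerivWithinAt.fun_sum (u := Finset.univ)
    (fun J _ => (hasDerivWithinAt_transProb G B I J ht).mul_const (Φ J))
  refine this.congr_deriv ?_
  rw [generator_eq_jumpSum_sub, evolve_apply]
  simp only [sub_mul, Finset.sum_sub_distrib, jumpSum, evolve_apply, Finset.mul_sum,
    Finset.sum_mul]
  congr 1
  · rw [Finset.sum_comm]
    refine Finset.sum_congr rfl fun v _ => ?_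
    rw [Finset.sum_comm]
    exact Finset.sum_congr rfl fun x _ => Finset.sum_congr rfl fun J _ => by ring
  · exact Finset.sum_congr rfl fun J _ => by ring

/-- The backward equation is a linear ODE on a finite-dimensional space, so its solutions are
unique. The Markov property, the commutation with the generator and the invariance under relabelling
all follow by exhibiting a solution. -/
theorem eq_evolve [NeZero n] {u : ℝ → Finset (Fin n) → ℝ}
    (hu : ∀ t, 0 ≤ t → HasDerivWithinAt u (generator G B (u t)) (Set.Ici 0) t)
    {t : ℝ} (ht : 0 ≤ t) : u t = evolve G B t (u 0) := by
  set L := LinearMap.toContinuousLinearMap (generator G B) with hL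
  have hLip : ∀ _ : ℝ, LipschitzWith ‖L‖₊ (fun Φ : Finset (Fin n) → ℝ => generator G B Φ) :=
    fun _ => L.lipschitz
  refine ODE_solution_unique (v := fun _ Φ => generator G B Φ) hLip (a := 0) (b := t)
    (f := u) (g := fun t => evolve G B t (u 0)) ?_ ?_ ?_ ?_ ?_ ⟨ht, le_rfl⟩
  · exact fun s hs => ((hu s hs.1).continuousWithinAt).mono fun x hx => hx.1
  · exact fun s hs => (hu s hs.1).mono fun x hx => hs.1.trans hx
  · exact fun s hs => ((hasDerivWithinAt_evolve G B (u 0) hs.1).continuousWithinAt).mono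
      fun x hx => hx.1
  · exact fun s hs => (hasDerivWithinAt_evolve G B (u 0) hs.1).mono fun x hx => hs.1.trans hx
  · rw [evolve_zero]

/-- The Markov property at a fixed time, obtained from ODE uniqueness instead of an argument on the
clocks. -/
theorem evolve_add [NeZero n] (Φ : Finset (Fin n) → ℝ) {s t : ℝ} (hs : 0 ≤ s) (ht : 0 ≤ t) :
    evolve G B (s + t) Φ = evolve G B s (evolve G B t Φ) := by
  have := eq_evolve G B (u := fun s => evolve G B (s + t) Φ) (fun r hr => ?_) hs
  · simpa using this
  · have h1 := hasDerivWithinAt_evolve G B Φ (add_nonneg hr ht)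
    have h2 : HasDerivWithinAt (fun s : ℝ => s + t) 1 (Set.Ici 0) r :=
      ((hasDerivAt_id r).add_const t).hasDerivWithinAt
    have h3 := h1.scomp r h2 (fun x hx => add_nonneg (Set.mem_Ici.1 hx) ht)
    simpa [Function.comp_def] using h3

/-- This converts the backward into the forward equation, which is what the evolution of an
expectation along the chain requires. -/
theorem generator_evolve [NeZero n] (Φ : Finset (Fin n) → ℝ) {t : ℝ} (ht : 0 ≤ t) :
    generator G B (evolve G B t Φ) = evolve G B t (generator G B Φ) := by
  have := eq_evolve G B (u := fun s => generator G B (evolve G B s Φ)) (fun r hr => ?_) ht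
  · simpa [evolve_zero] using this
  · exact (LinearMap.toContinuousLinearMap (generator G B)).hasFDerivAt.comp_hasDerivWithinAt r
      (hasDerivWithinAt_evolve G B Φ hr)

variable {G B}

/-- A time-dependent function that decreases along the chain decreases in expectation. -/
theorem evolve_le_of_supersolution [NeZero n] {Φ Φ' : ℝ → Finset (Fin n) → ℝ} {T : ℝ} (hT : 0 ≤ T)
    (hΦ : ∀ t ∈ Set.Icc 0 T, ∀ J, HasDerivAt (fun t => Φ t J) (Φ' t J) t)
    (hsup : ∀ t ∈ Set.Icc 0 T, ∀ J, I ⊆ J → Φ' t J + generator G B (Φ t) J ≤ 0) :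
    evolve G B T (Φ T) I ≤ Φ 0 I := by
  have hder : ∀ t ∈ Set.Icc 0 T, HasDerivWithinAt (fun t => evolve G B t (Φ t) I)
      (evolve G B t (fun J => Φ' t J + generator G B (Φ t) J) I) (Set.Ici 0) t := by
    intro t ht
    have h1 : ∀ J, HasDerivWithinAt (fun t => transProb G B I J t * Φ t J)
        ((jumpSum G B I (fun K => transProb G B K J t) - n * transProb G B I J t) * Φ t J +
          transProb G B I J t * Φ' t J) (Set.Ici 0) t := fun J =>
      (hasDerivWithinAt_transProb G B I J ht.1).mul (hΦ t ht J).hasDerivWithinAt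
    have h2 := HasDerivWithinAt.fun_sum (u := Finset.univ) (fun J _ => h1 J)
    simp only [evolve_apply]
    refine h2.congr_deriv ?_
    have h3 : evolve G B t (generator G B (Φ t)) I = generator G B (evolve G B t (Φ t)) I := by
      rw [generator_evolve G B _ ht.1]
    rw [evolve_apply] at h3
    simp only [mul_add, Finset.sum_add_distrib]
    rw [h3, add_comm]
    congr 1
    -- The derivative with the observable frozen at `Φ t` is computed abstractly and as a sum over
    -- `J`; one-sided derivatives on a half-line are unique, so the two agree.
    have h4 := (hasDerivWithinAt_pi.1 (hasDerivWithinAt_evolve G B (Φ t) ht.1) I)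
    have h5 := HasDerivWithinAt.fun_sum (u := Finset.univ)
      (fun J _ => (hasDerivWithinAt_transProb G B I J ht.1).mul_const (Φ t J))
    exact (uniqueDiffOn_Ici 0 t ht.1).eq_deriv _ h5 h4
  have hanti : AntitoneOn (fun t => evolve G B t (Φ t) I) (Set.Icc 0 T) := by
    refine antitoneOn_of_hasDerivWithinAt_nonpos (convex_Icc 0 T)
      (f' := fun t => evolve G B t (fun J => Φ' t J + generator G B (Φ t) J) I)
      (fun t ht => ((hder t ht).continuousWithinAt).mono fun x hx => hx.1)
      (fun t ht => (hder t (interior_subset ht)).mono fun x hx => (interior_subset hx).1)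
      (fun t ht => ?_)
    have ht' := interior_subset ht
    have := evolve_mono (G := G) (B := B) (I := I) ht'.1
      (Ψ := fun _ => 0) (fun J hJ => hsup t ht' J hJ)
    rwa [evolve_const] at this
  have := hanti ⟨le_rfl, hT⟩ ⟨hT, le_rfl⟩ hT
  simpa [evolve_zero] using this

/-- Exponential decay of Lyapunov functions. -/
theorem evolve_le_exp_mul [NeZero n] {Φ : Finset (Fin n) → ℝ} {a t : ℝ} (ht : 0 ≤ t)
    (h : ∀ J, I ⊆ J → generator G B Φ J ≤ -a * Φ J) :
    evolve G B t Φ I ≤ Real.exp (-(a * t)) * Φ I := by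
  have hd : ∀ s : ℝ, HasDerivAt (fun s : ℝ => Real.exp (a * s)) (Real.exp (a * s) * a) s :=
    fun s => by simpa using ((hasDerivAt_id s).const_mul a).exp
  have := evolve_le_of_supersolution (G := G) (B := B) (I := I) ht
    (Φ := fun s => Real.exp (a * s) • Φ) (Φ' := fun s J => Real.exp (a * s) * a * Φ J)
    (fun s _ J => by simpa using (hd s).mul_const (Φ J)) (fun s _ J hJ => by
      simp only [map_smul, Pi.smul_apply, smul_eq_mul]
      have := mul_le_mul_of_nonneg_left (h J hJ) (Real.exp_nonneg (a * s))
      linarith)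
  simp only [map_smul, Pi.smul_apply, smul_eq_mul, mul_zero, Real.exp_zero, one_mul] at this
  rw [Real.exp_neg, ← div_eq_inv_mul, le_div_iff₀ (Real.exp_pos _)]
  linarith

end Generator

/-! ### Transition rates -/

open Classical in
/-- The neighbours of `v`. -/
noncomputable def nbr {n : ℕ} (G : SimpleGraph (Fin n)) (v : Fin n) : Finset (Fin n) :=
  Finset.univ.filter (G.Adj v)

/-- The degree of `v`, as a real number. -/
noncomputable def deg {n : ℕ} (G : SimpleGraph (Fin n)) (v : Fin n) : ℝ := (nbr G v).card

open Classical in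
/-- The rate of the contacts along the edge `uv`. -/
noncomputable def edgeRate {n : ℕ} (G : SimpleGraph (Fin n)) (u v : Fin n) : ℝ :=
  if G.Adj u v then (deg G u)⁻¹ + (deg G v)⁻¹ else 0

/-- The rate at which `x` receives the rumor when the informed set is `I`. -/
noncomputable def rate {n : ℕ} (G : SimpleGraph (Fin n)) (B I : Finset (Fin n)) (x : Fin n) : ℝ :=
  ∑ u ∈ I \ B, edgeRate G u x

/-- The total rate of the contacts that involve `x`. -/
noncomputable def totalRate {n : ℕ} (G : SimpleGraph (Fin n)) (x : Fin n) : ℝ :=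
  ∑ u, edgeRate G u x

section Rates

variable {n : ℕ} {G : SimpleGraph (Fin n)} {B I J : Finset (Fin n)}

@[simp] theorem mem_nbr {u v : Fin n} : v ∈ nbr G u ↔ G.Adj u v := by simp [nbr]

theorem deg_nonneg (v : Fin n) : 0 ≤ deg G v := Nat.cast_nonneg _

theorem edgeRate_nonneg (u v : Fin n) : 0 ≤ edgeRate G u v := by
  unfold edgeRate
  split_ifs
  · exact add_nonneg (inv_nonneg.2 (deg_nonneg _)) (inv_nonneg.2 (deg_nonneg _))
  · exact le_rfl

theorem edgeRate_comm (u v : Fin n) : edgeRate G u v = edgeRate G v u := by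
  by_cases h : G.Adj u v
  · rw [edgeRate, edgeRate, if_pos h, if_pos h.symm, add_comm]
  · rw [edgeRate, edgeRate, if_neg h, if_neg fun h' => h h'.symm]

theorem edgeRate_of_adj {u v : Fin n} (h : G.Adj u v) :
    edgeRate G u v = (deg G u)⁻¹ + (deg G v)⁻¹ := by simp [edgeRate, h]

theorem edgeRate_of_not_adj {u v : Fin n} (h : ¬ G.Adj u v) : edgeRate G u v = 0 := by
  simp [edgeRate, h]

theorem sum_edgeRate (S : Finset (Fin n)) (x : Fin n) :
    ∑ u ∈ S, edgeRate G u x = ∑ u ∈ S ∩ nbr G x, ((deg G u)⁻¹ + (deg G x)⁻¹) := by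
  rw [← Finset.sum_subset Finset.inter_subset_left (s₁ := S ∩ nbr G x)]
  · refine Finset.sum_congr rfl fun u hu => edgeRate_of_adj ?_
    exact (mem_nbr.1 (Finset.mem_inter.1 hu).2).symm
  · intro u hu hu'
    refine edgeRate_of_not_adj fun h => hu' (Finset.mem_inter.2 ⟨hu, mem_nbr.2 h.symm⟩)

theorem rate_nonneg (x : Fin n) : 0 ≤ rate G B I x :=
  Finset.sum_nonneg fun _ _ => edgeRate_nonneg _ _

theorem rate_le_totalRate (x : Fin n) : rate G B I x ≤ totalRate G x :=
  Finset.sum_le_sum_of_subset_of_nonneg (Finset.subset_univ _) fun _ _ _ => edgeRate_nonneg _ _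

theorem totalRate_nonneg (x : Fin n) : 0 ≤ totalRate G x :=
  Finset.sum_nonneg fun _ _ => edgeRate_nonneg _ _

theorem contactProb_of_ne {u x : Fin n} (h : u ≠ x) :
    contactProb G u x = if x ∈ nbr G u then (deg G u)⁻¹ else 0 := by
  classical
  unfold contactProb contactLaw
  have hcard : ((G.neighborFinset u).card : ℝ) = deg G u := by
    unfold deg nbr
    congr 2
    ext
    simp
  split_ifs with h1 h2 h2
  · rw [PMF.uniformOfFinset_apply_of_mem _ (by simpa using h2), ENNReal.toReal_inv,
      ENNReal.toReal_natCast, ← hcard]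
  · rw [PMF.uniformOfFinset_apply_of_notMem _ (by simpa using h2), ENNReal.toReal_zero]
  · exact absurd ⟨x, by simpa using h2⟩ h1
  · simp [PMF.pure_apply, h.symm]

theorem contactProb_add_contactProb {u x : Fin n} (h : u ≠ x) :
    contactProb G u x + contactProb G x u = edgeRate G u x := by
  rw [contactProb_of_ne h, contactProb_of_ne h.symm]
  by_cases hux : G.Adj u x
  · simp [edgeRate, hux, hux.symm]
  · have hxu : ¬ G.Adj x u := fun h => hux h.symm
    simp [edgeRate, hux, hxu]

/-- A contact informs at most one new node: the two cases exclude each other, because one requires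
`x` to be uninformed and the other requires it to be informed. -/
theorem contactStep_sub (Φ : Finset (Fin n) → ℝ) (v x : Fin n) :
    Φ (contactStep B I v x) - Φ I =
      (if v ∈ I \ B ∧ x ∉ I then Φ (insert x I) - Φ I else 0) +
      (if x ∈ I \ B ∧ v ∉ I then Φ (insert v I) - Φ I else 0) := by
  have h1 : v ∈ I \ B ∧ x ∉ I → contactStep B I v x = insert x I := by
    intro h
    ext u
    rw [mem_contactStep, Finset.mem_insert]
    simp only [Finset.mem_sdiff] at h
    tauto
  have h2 : x ∈ I \ B ∧ v ∉ I → contactStep B I v x = insert v I := by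
    intro h
    ext u
    rw [mem_contactStep, Finset.mem_insert]
    simp only [Finset.mem_sdiff] at h
    tauto
  have h3 : ¬ (v ∈ I \ B ∧ x ∉ I) → ¬ (x ∈ I \ B ∧ v ∉ I) → contactStep B I v x = I := by
    intro h h'
    ext u
    rw [mem_contactStep]
    simp only [Finset.mem_sdiff] at h h'
    constructor
    · rintro (h1 | ⟨h1, h2, rfl⟩ | ⟨h1, h2, rfl⟩) <;> tauto
    · tauto
  split_ifs with ha hb hb
  · exact absurd (Finset.mem_sdiff.1 ha.1).1 hb.2
  · rw [h1 ha, add_zero]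
  · rw [h2 hb, zero_add]
  · rw [h3 ha hb]; simp

/-- A contact along an edge has the same effect whichever end initiates it, so the two contact
probabilities merge into `edgeRate` and only growth by one node remains. -/
theorem generator_eq (Φ : Finset (Fin n) → ℝ) :
    generator G B Φ I = ∑ x ∈ Iᶜ, rate G B I x * (Φ (insert x I) - Φ I) := by
  have key : ∀ f : Fin n → Fin n → ℝ,
      ∑ v, ∑ x, f v x * (if v ∈ I \ B ∧ x ∉ I then Φ (insert x I) - Φ I else 0) =
      ∑ x ∈ Iᶜ, (∑ u ∈ I \ B, f u x) * (Φ (insert x I) - Φ I) := by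
    intro f
    rw [Finset.sum_comm, ← Finset.sum_subset (Finset.subset_univ Iᶜ)]
    · refine Finset.sum_congr rfl fun x hx => ?_
      rw [Finset.mem_compl] at hx
      rw [Finset.sum_mul, ← Finset.sum_subset (Finset.subset_univ (I \ B))]
      · exact Finset.sum_congr rfl fun u hu => by rw [if_pos ⟨hu, hx⟩]
      · intro u _ hu
        simp [hu]
    · intro x _ hx
      rw [Finset.mem_compl, not_not] at hx
      simp [hx]
  rw [generator_apply]
  simp only [contactStep_sub, mul_add, Finset.sum_add_distrib]
  rw [key (fun v x => contactProb G v x)]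
  rw [Finset.sum_comm (f := fun v x => contactProb G v x *
    (if x ∈ I \ B ∧ v ∉ I then Φ (insert v I) - Φ I else 0)), key (fun x v => contactProb G v x),
    ← Finset.sum_add_distrib]
  refine Finset.sum_congr rfl fun x hx => ?_
  rw [← add_mul, ← Finset.sum_add_distrib]
  congr 1
  refine Finset.sum_congr rfl fun u hu => contactProb_add_contactProb ?_
  rintro rfl
  exact (Finset.mem_compl.1 hx) (Finset.mem_sdiff.1 hu).1

/-- The shape used for Lyapunov functions that never increase along a transition: transitions
outside `S` may simply be discarded. -/
theorem generator_le {Φ : Finset (Fin n) → ℝ} {S : Finset (Fin n)} (hS : S ⊆ Iᶜ) {b : ℝ}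
    (hb : ∀ x ∈ S, Φ (insert x I) - Φ I ≤ -b) (h0 : ∀ x ∈ Iᶜ, Φ (insert x I) ≤ Φ I) :
    generator G B Φ I ≤ -b * ∑ x ∈ S, rate G B I x := by
  rw [generator_eq, ← Finset.sum_sdiff hS, Finset.mul_sum]
  have h1 : ∑ x ∈ Iᶜ \ S, rate G B I x * (Φ (insert x I) - Φ I) ≤ 0 :=
    Finset.sum_nonpos fun x hx => mul_nonpos_of_nonneg_of_nonpos (rate_nonneg x)
      (sub_nonpos.2 (h0 x (Finset.mem_sdiff.1 hx).1))
  have h2 : ∑ x ∈ S, rate G B I x * (Φ (insert x I) - Φ I) ≤ ∑ x ∈ S, -b * rate G B I x :=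
    Finset.sum_le_sum fun x hx => by
      have := mul_le_mul_of_nonneg_left (hb x hx) (rate_nonneg (G := G) (B := B) (I := I) x)
      linarith
  linarith

/-! ### Lyapunov estimates for the phases of the process -/

open Classical in
/-- The indicator function of a property of informed sets. -/
noncomputable def ind (A : Finset (Fin n) → Prop) : Finset (Fin n) → ℝ := fun J =>
  if A J then 1 else 0

theorem ind_of {A : Finset (Fin n) → Prop} (h : A J) : ind A J = 1 := by simp [ind, h]

theorem ind_of_not {A : Finset (Fin n) → Prop} (h : ¬ A J) : ind A J = 0 := by simp [ind, h]

theorem ind_nonneg (A : Finset (Fin n) → Prop) (J : Finset (Fin n)) : 0 ≤ ind A J := by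
  unfold ind; split_ifs <;> simp

theorem ind_le_one (A : Finset (Fin n) → Prop) (J : Finset (Fin n)) : ind A J ≤ 1 := by
  unfold ind; split_ifs <;> simp

theorem ind_le {A : Finset (Fin n) → Prop} {x : ℝ} (hx : 0 ≤ x) (h : A J → 1 ≤ x) :
    ind A J ≤ x := by
  unfold ind; split_ifs with hA
  exacts [h hA, hx]

/-- Composition of two phases. -/
theorem evolve_add_le [NeZero n] {Φ : Finset (Fin n) → ℝ} (hΦ : ∀ J, Φ J ≤ 1)
    {A : Finset (Fin n) → Prop} {s t q : ℝ} (hs : 0 ≤ s) (ht : 0 ≤ t) (hq : 0 ≤ q)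
    (h : ∀ J, I ⊆ J → A J → evolve G B t Φ J ≤ q) :
    evolve G B (s + t) Φ I ≤ evolve G B s (ind fun J => ¬ A J) I + q := by
  rw [evolve_add G B Φ hs ht]
  have h1 : ∀ J, I ⊆ J → evolve G B t Φ J ≤ ind (fun J => ¬ A J) J + q := by
    intro J hJ
    by_cases hA : A J
    · rw [ind_of_not (by simpa using hA), zero_add]
      exact h J hJ hA
    · rw [ind_of hA]
      have := evolve_mono (G := G) (B := B) (I := J) ht (Φ := Φ) (Ψ := fun _ => 1) fun K _ => hΦ K
      rw [evolve_const] at this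
      linarith
  refine (evolve_mono hs (Ψ := (ind fun J => ¬ A J) + fun _ => q) h1).trans ?_
  rw [map_add, Pi.add_apply, evolve_const]

theorem evolve_ind_le_one [NeZero n] {A : Finset (Fin n) → Prop} {t : ℝ} (ht : 0 ≤ t) :
    evolve G B t (ind A) I ≤ 1 := by
  have := evolve_mono (G := G) (B := B) (I := I) ht (Φ := ind A) (Ψ := fun _ => 1)
    fun K _ => ind_le_one A K
  rwa [evolve_const] at this

/-- Hitting a set of nodes. -/
theorem evolve_hit_le [NeZero n] {V' : Finset (Fin n)} {a t : ℝ} (ht : 0 ≤ t)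
    (h : ∀ J, I ⊆ J → Disjoint J V' → a ≤ ∑ x ∈ V', rate G B J x) :
    evolve G B t (ind fun J => Disjoint J V') I ≤ Real.exp (-(a * t)) := by
  refine (evolve_le_exp_mul (a := a) ht fun J hJ => ?_).trans
    (mul_le_of_le_one_right (Real.exp_nonneg _) (ind_le_one _ _))
  by_cases hd : Disjoint J V'
  · have hS : V' ⊆ Jᶜ := fun x hx => Finset.mem_compl.2 fun hxJ => Finset.disjoint_left.1 hd hxJ hx
    have := generator_le (G := G) (B := B) (Φ := ind fun J => Disjoint J V') hS (b := 1)
      (fun x hx => by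
        rw [ind_of (A := fun J => Disjoint J V') hd, ind_of_not]
        · norm_num
        · exact fun h => Finset.disjoint_left.1 h (Finset.mem_insert_self _ _) hx)
      (fun x _ => by rw [ind_of (A := fun J => Disjoint J V') hd]; exact ind_le_one _ _)
    rw [ind_of (A := fun J => Disjoint J V') hd]
    linarith [h J hJ hd]
  · have hz : ∀ K, J ⊆ K → ind (fun J => Disjoint J V') K = 0 := fun K hK =>
      ind_of_not fun h => hd (h.mono_left hK)
    rw [generator_eq, hz J le_rfl]
    refine (Finset.sum_nonpos fun x _ => ?_).trans (by simp)
    rw [hz _ (Finset.subset_insert _ _)]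
    simp

/-- `growthFun a (k + 1) = ∏ j ∈ {1, …, k}, j / (j + a)`. -/
noncomputable def growthFun (a : ℝ) (k : ℕ) : ℝ :=
  ∏ j ∈ Finset.range (k - 1), ((j + 1 : ℝ) / (j + 1 + a))

theorem growthFun_pos {a : ℝ} (ha : 0 < a) (k : ℕ) : 0 < growthFun a k :=
  Finset.prod_pos fun j _ => by positivity

theorem growthFun_le_one {a : ℝ} (ha : 0 < a) (k : ℕ) : growthFun a k ≤ 1 :=
  Finset.prod_le_one (fun j _ => by positivity) fun j _ =>
    (div_le_one (by positivity)).2 (by linarith)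

/-- The reason for `growthFun`: its relative drop `a / (k + a)`, met with jump rate at least `μ k`,
gives exponential decay at rate `μ a / (1 + a)` for every `k ≥ 1`. -/
theorem growthFun_succ {a : ℝ} (ha : 0 < a) {k : ℕ} (hk : 1 ≤ k) :
    growthFun a (k + 1) = growthFun a k - a / (k + a) * growthFun a k := by
  obtain ⟨m, rfl⟩ := Nat.exists_eq_add_of_le' hk
  unfold growthFun
  simp only [Nat.add_sub_cancel, Finset.prod_range_succ]
  push_cast
  field_simp
  ring

/-- Each factor `j / (j + a)` is at least `exp (-a / j)`, and the harmonic sum is at most `1 + log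
m`. So growth to size `m` costs about `m ^ a`, which balances the decay near time `(1 + a) log m /
μ`. -/
theorem exp_le_growthFun {a : ℝ} (ha : 0 < a) {k m : ℕ} (hk : k ≤ m) :
    Real.exp (-(a * (1 + Real.log m))) ≤ growthFun a k := by
  have h1 : ∀ k : ℕ, Real.exp (-(a * ∑ j ∈ Finset.range (k - 1), ((j + 1 : ℝ))⁻¹)) ≤
      growthFun a k := by
    intro k
    unfold growthFun
    rw [Finset.mul_sum, ← Finset.sum_neg_distrib, Real.exp_sum]
    refine Finset.prod_le_prod (fun j _ => (Real.exp_pos _).le) fun j _ => ?_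
    rw [Real.exp_neg, inv_le_comm₀ (Real.exp_pos _) (by positivity), inv_div]
    have := Real.add_one_le_exp (a * ((j + 1 : ℝ))⁻¹)
    refine le_trans (le_of_eq ?_) this
    field_simp
    ring
  refine le_trans (Real.exp_le_exp.2 (neg_le_neg (mul_le_mul_of_nonneg_left ?_ ha.le))) (h1 k)
  have h2 : ∑ j ∈ Finset.range (k - 1), ((j + 1 : ℝ))⁻¹ ≤
      ∑ j ∈ Finset.range m, ((j + 1 : ℝ))⁻¹ :=
    Finset.sum_le_sum_of_subset_of_nonneg (Finset.range_subset_range.2 (by omega))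
      fun j _ _ => by positivity
  have h3 := harmonic_le_one_add_log m
  unfold harmonic at h3
  push_cast at h3
  linarith

/-- Exponential growth inside a set of nodes. -/
theorem evolve_growth_le [NeZero n] {V' : Finset (Fin n)} {M : ℕ} {a μ t : ℝ} (ha : 0 < a)
    (hμ : 0 ≤ μ) (ht : 0 ≤ t) (hI : (I ∩ V').Nonempty)
    (h : ∀ J, I ⊆ J → (J ∩ V').card ≤ M →
      μ * (J ∩ V').card ≤ ∑ x ∈ V' \ J, rate G B J x) :
    evolve G B t (ind fun J => (J ∩ V').card ≤ M) I ≤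
      Real.exp (a * (1 + Real.log M) - μ * a / (1 + a) * t) := by
  classical
  -- Truncated at `M`, since the lower bound on the growth rate is only assumed below that size.
  set Φ : Finset (Fin n) → ℝ := fun J =>
    if (J ∩ V').card ≤ M then growthFun a (J ∩ V').card else 0 with hΦ
  have hΦ0 : ∀ J, 0 ≤ Φ J := fun J => by
    simp only [hΦ]; split_ifs
    exacts [(growthFun_pos ha _).le, le_rfl]
  have hΦ1 : Φ I ≤ 1 := by
    simp only [hΦ]; split_ifs
    exacts [growthFun_le_one ha _, zero_le_one]
  have hdec : evolve G B t Φ I ≤ Real.exp (-(μ * a / (1 + a) * t)) * Φ I := by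
    refine evolve_le_exp_mul ht fun J hJ => ?_
    have hcard1 : 1 ≤ (J ∩ V').card :=
      Finset.card_pos.2 (hI.mono (Finset.inter_subset_inter_right hJ))
    have hins : ∀ x ∈ V' \ J, (insert x J ∩ V').card = (J ∩ V').card + 1 := by
      intro x hx
      rw [Finset.mem_sdiff] at hx
      rw [Finset.insert_inter_of_mem hx.1, Finset.card_insert_of_notMem]
      simp [hx.2]
    have hins' : ∀ x ∉ V', insert x J ∩ V' = J ∩ V' := fun x hx =>
      Finset.insert_inter_of_notMem hx
    by_cases hle : (J ∩ V').card ≤ M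
    · have hΦJ : Φ J = growthFun a (J ∩ V').card := if_pos hle
      set k := (J ∩ V').card with hk
      have hk0 : (1 : ℝ) ≤ k := by exact_mod_cast hcard1
      have hdrop : ∀ x ∈ V' \ J, Φ (insert x J) - Φ J ≤ -(a / (k + a) * growthFun a k) := by
        intro x hx
        have : Φ (insert x J) ≤ growthFun a (k + 1) := by
          simp only [hΦ, hins x hx]
          split_ifs
          exacts [le_rfl, (growthFun_pos ha _).le]
        rw [growthFun_succ ha hcard1] at this
        rw [hΦJ]
        linarith
      have hpos : 0 ≤ a / (k + a) * growthFun a k :=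
        mul_nonneg (by positivity) (growthFun_pos ha _).le
      have := generator_le (G := G) (B := B) (I := J) (Φ := Φ) (S := V' \ J)
        (fun x hx => Finset.mem_compl.2 (Finset.mem_sdiff.1 hx).2) hdrop (fun x hx => by
          by_cases hxV : x ∈ V'
          · have := hdrop x (Finset.mem_sdiff.2 ⟨hxV, Finset.mem_compl.1 hx⟩)
            linarith
          · simp only [hΦ, hins' x hxV]; exact le_rfl)
      refine this.trans ?_
      rw [hΦJ, neg_mul, neg_mul, neg_le_neg_iff]
      have h1 := mul_le_mul_of_nonneg_left (h J hJ hle) hpos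
      refine le_trans ?_ h1
      -- The product of rate and relative drop is smallest at `k = 1`.
      have h2 : a / (1 + a) ≤ a / (k + a) * k := by
        rw [div_mul_eq_mul_div, div_le_div_iff₀ (by positivity) (by positivity)]
        nlinarith [mul_nonneg ha.le ha.le, mul_le_mul_of_nonneg_left hk0 (mul_nonneg ha.le ha.le)]
      have h3 := mul_le_mul_of_nonneg_left h2 (mul_nonneg hμ (growthFun_pos ha k).le)
      calc μ * a / (1 + a) * growthFun a k = μ * growthFun a k * (a / (1 + a)) := by ring
        _ ≤ μ * growthFun a k * (a / (k + a) * k) := h3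
        _ = _ := by rw [← hk]; ring
    · have hz : ∀ K, J ⊆ K → Φ K = 0 := fun K hK => if_neg fun h =>
        hle ((Finset.card_le_card (Finset.inter_subset_inter_right hK)).trans h)
      rw [generator_eq, hz J le_rfl]
      refine (Finset.sum_nonpos fun x _ => ?_).trans (by simp)
      rw [hz _ (Finset.subset_insert _ _)]
      simp
  have hcmp : ∀ J, I ⊆ J → ind (fun J => (J ∩ V').card ≤ M) J ≤
      (Real.exp (a * (1 + Real.log M)) • Φ) J := by
    intro J _
    refine ind_le (mul_nonneg (Real.exp_nonneg _) (hΦ0 J)) fun hle => ?_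
    have hΦJ : Φ J = growthFun a (J ∩ V').card := if_pos hle
    have h1 := exp_le_growthFun ha hle
    rw [Pi.smul_apply, smul_eq_mul, hΦJ]
    rw [Real.exp_neg, inv_le_iff_one_le_mul₀ (Real.exp_pos _)] at h1
    linarith
  refine (evolve_mono ht hcmp).trans ?_
  rw [map_smul, Pi.smul_apply, smul_eq_mul, sub_eq_add_neg, Real.exp_add]
  refine mul_le_mul_of_nonneg_left (hdec.trans ?_) (Real.exp_nonneg _)
  exact mul_le_of_le_one_right (Real.exp_nonneg _) hΦ1

/-- Exponential decay of the number of uninformed nodes above a threshold. -/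
theorem evolve_shrink_le [NeZero n] {m μ t : ℝ} (hm : 0 < m) (ht : 0 ≤ t)
    (h : ∀ J, I ⊆ J → m < (Jᶜ).card → μ * (Jᶜ).card ≤ ∑ x ∈ Jᶜ, rate G B J x) :
    evolve G B t (ind fun J => m < (Jᶜ).card) I ≤ n / m * Real.exp (-(μ * t)) := by
  classical
  set Φ : Finset (Fin n) → ℝ := fun J => if m < (Jᶜ).card then ((Jᶜ).card : ℝ) else 0 with hΦ
  have hΦn : ∀ J, Φ J ≤ n := fun J => by
    simp only [hΦ]; split_ifs
    · exact_mod_cast (Finset.card_le_univ _).trans (by simp)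
    · positivity
  have hsub : ∀ {J K : Finset (Fin n)}, J ⊆ K → ((Kᶜ).card : ℝ) ≤ (Jᶜ).card := fun hJK => by
    exact_mod_cast Finset.card_le_card (Finset.compl_subset_compl.2 hJK)
  have hdec : evolve G B t Φ I ≤ Real.exp (-(μ * t)) * Φ I := by
    refine evolve_le_exp_mul ht fun J hJ => ?_
    by_cases hle : m < (Jᶜ).card
    · have hΦJ : Φ J = (Jᶜ).card := if_pos hle
      have hdrop : ∀ x ∈ Jᶜ, Φ (insert x J) - Φ J ≤ -1 := by
        intro x hx
        have hc : ((insert x J)ᶜ).card + 1 = (Jᶜ).card := by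
          rw [Finset.compl_insert]
          exact Finset.card_erase_add_one hx
        have hc' : (((insert x J)ᶜ).card : ℝ) + 1 = (Jᶜ).card := by exact_mod_cast hc
        rw [hΦJ]
        simp only [hΦ]
        split_ifs
        · linarith
        · have : (0 : ℝ) ≤ ((insert x J)ᶜ).card := Nat.cast_nonneg _
          linarith
      have := generator_le (G := G) (B := B) (I := J) (Φ := Φ) (S := Jᶜ) (fun x hx => hx) hdrop
        (fun x hx => by linarith [hdrop x hx])
      rw [hΦJ]
      linarith [h J hJ hle]
    · have hz : ∀ K, J ⊆ K → Φ K = 0 := fun K hK => if_neg fun h => hle (h.trans_le (hsub hK))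
      rw [generator_eq, hz J le_rfl]
      refine (Finset.sum_nonpos fun x _ => ?_).trans (by simp)
      rw [hz _ (Finset.subset_insert _ _)]
      simp
  have hcmp : ∀ J, I ⊆ J → ind (fun J => m < (Jᶜ).card) J ≤ (m⁻¹ • Φ) J := by
    intro J _
    refine ind_le ?_ fun hle => ?_
    · rw [Pi.smul_apply, smul_eq_mul]
      simp only [hΦ]
      split_ifs <;> positivity
    · have hΦJ : Φ J = (Jᶜ).card := if_pos hle
      rw [Pi.smul_apply, smul_eq_mul, hΦJ, ← div_eq_inv_mul, le_div_iff₀ hm]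
      linarith
  refine (evolve_mono ht hcmp).trans ?_
  rw [map_smul, Pi.smul_apply, smul_eq_mul]
  calc m⁻¹ * evolve G B t Φ I ≤ m⁻¹ * (Real.exp (-(μ * t)) * n) :=
        mul_le_mul_of_nonneg_left (hdec.trans
          (mul_le_mul_of_nonneg_left (hΦn I) (Real.exp_nonneg _))) (by positivity)
    _ = _ := by rw [div_eq_mul_inv]; ring

/-- A set of nodes which all have rate at least `1 / 2` is mostly informed. -/
theorem evolve_uninformed_le [NeZero n] {W : Finset (Fin n)} {ℓ t : ℝ} (ht : 0 ≤ t)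
    (h : ∀ J, I ⊆ J → ∀ x ∈ W \ J, 1 / 2 ≤ rate G B J x) :
    evolve G B t (ind fun J => ℓ ≤ ((W \ J).card : ℝ)) I ≤
      2 ^ W.card * Real.exp (-(t / 2 * ℓ)) := by
  -- Each uninformed node of `W` carries the factor `1 + exp (s / 2)`, each informed one the factor
  -- `1`. The factor grows with derivative `exp (s / 2) / 2`, and a jump of rate at least `1 / 2`
  -- loses `exp (s / 2)`, so the product decreases in mean. Its initial value is at most `2 ^
  -- W.card`.
  set Φ : ℝ → Finset (Fin n) → ℝ := fun s J => (1 + Real.exp (s / 2)) ^ (W \ J).card with hΦ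
  have hd : ∀ s, HasDerivAt (fun s : ℝ => 1 + Real.exp (s / 2)) (Real.exp (s / 2) / 2) s :=
    fun s => by
      have := (((hasDerivAt_id s).div_const 2).exp).const_add 1
      simpa [div_eq_mul_inv] using this
  have hsup := evolve_le_of_supersolution (G := G) (B := B) (I := I) ht (Φ := Φ)
    (Φ' := fun s J => (W \ J).card * (1 + Real.exp (s / 2)) ^ ((W \ J).card - 1) *
      (Real.exp (s / 2) / 2)) (fun s _ J => (hd s).fun_pow _) (fun s hs J hJ => by
      have hge : 0 ≤ (1 + Real.exp (s / 2)) ^ ((W \ J).card - 1) * Real.exp (s / 2) := by positivity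
      have hdrop : ∀ x ∈ W \ J, Φ s (insert x J) - Φ s J ≤
          -((1 + Real.exp (s / 2)) ^ ((W \ J).card - 1) * Real.exp (s / 2)) := by
        intro x hx
        have hc : (W \ insert x J).card + 1 = (W \ J).card := by
          rw [Finset.sdiff_insert]
          exact Finset.card_erase_add_one hx
        simp only [hΦ]
        rw [← hc, Nat.add_sub_cancel, pow_succ]
        linarith
      have := generator_le (G := G) (B := B) (I := J) (Φ := Φ s) (S := W \ J)
        (fun x hx => Finset.mem_compl.2 (Finset.mem_sdiff.1 hx).2) hdrop (fun x hx => by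
          simp only [hΦ]
          refine pow_le_pow_right₀ (by linarith [Real.exp_pos (s / 2)]) (Finset.card_le_card ?_)
          exact Finset.sdiff_subset_sdiff le_rfl (Finset.subset_insert _ _))
      have hsum : ((W \ J).card : ℝ) * (1 / 2) ≤ ∑ x ∈ W \ J, rate G B J x := by
        have := Finset.card_nsmul_le_sum (W \ J) (rate G B J) (1 / 2) (h J hJ)
        simpa using this
      have h2 := mul_le_mul_of_nonneg_left hsum hge
      linarith)
  have hcmp : ∀ J, I ⊆ J → ind (fun J => ℓ ≤ ((W \ J).card : ℝ)) J ≤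
      (Real.exp (-(t / 2 * ℓ)) • Φ t) J := by
    intro J _
    refine ind_le (mul_nonneg (Real.exp_nonneg _) (by simp only [hΦ]; positivity)) fun hle => ?_
    rw [Pi.smul_apply, smul_eq_mul, Real.exp_neg, ← div_eq_inv_mul, le_div_iff₀ (Real.exp_pos _),
      one_mul]
    calc Real.exp (t / 2 * ℓ) ≤ Real.exp (t / 2 * (W \ J).card) :=
          Real.exp_le_exp.2 (mul_le_mul_of_nonneg_left hle (by linarith))
      _ = Real.exp (t / 2) ^ (W \ J).card := by rw [mul_comm, Real.exp_nat_mul]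
      _ ≤ _ := pow_le_pow_left₀ (Real.exp_nonneg _) (by linarith) _
  refine (evolve_mono ht hcmp).trans ?_
  rw [map_smul, Pi.smul_apply, smul_eq_mul, mul_comm]
  refine mul_le_mul_of_nonneg_right (hsup.trans ?_) (Real.exp_nonneg _)
  simp only [hΦ, zero_div, Real.exp_zero]
  norm_num
  exact pow_le_pow_right₀ (by norm_num) (Finset.card_le_card Finset.sdiff_subset)

/-- The probability that a single node stays uninformed. -/
theorem evolve_notMem_le [NeZero n] {v : Fin n} {a t : ℝ} (ht : 0 ≤ t)
    (h : ∀ J, I ⊆ J → v ∉ J → a ≤ rate G B J v) :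
    evolve G B t (ind fun J => v ∉ J) I ≤ Real.exp (-(a * t)) := by
  have h1 := evolve_hit_le (G := G) (B := B) (I := I) (V' := {v}) (a := a) ht
    (fun J hJ hd => by simpa using h J hJ (by simpa using hd))
  simpa using h1

/-- The probability that all nodes are informed, compared with independent clocks. -/
theorem evolve_univ_le [NeZero n] {t : ℝ} (ht : 0 ≤ t) :
    evolve G B t (ind fun J => J = Finset.univ) I ≤
      Real.exp (-∑ v ∈ Iᶜ, Real.exp (-(totalRate G v * t))) := by
  -- `q s v` is the probability that an independent clock of rate `totalRate G v` rings in the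
  -- remaining time. The product is a supersolution because a node never joins faster than at its
  -- total rate, whatever the informed set is.
  set q : ℝ → Fin n → ℝ := fun s v => 1 - Real.exp (-(totalRate G v * (t - s))) with hq
  set Φ : ℝ → Finset (Fin n) → ℝ := fun s J => ∏ v ∈ Jᶜ, q s v with hΦ
  have hqd : ∀ s v, HasDerivAt (fun s => q s v) (-(totalRate G v * (1 - q s v))) s := by
    intro s v
    have h1 : HasDerivAt (fun s => -(totalRate G v * (t - s))) (totalRate G v) s := by
      simpa using (((hasDerivAt_id s).const_sub t).const_mul (totalRate G v)).fun_neg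
    have := h1.exp.const_sub 1
    refine this.congr_deriv ?_
    simp only [hq]
    ring
  have hq0 : ∀ s ∈ Set.Icc 0 t, ∀ v, 0 ≤ q s v := fun s hs v => by
    simp only [hq, sub_nonneg, Real.exp_le_one_iff, neg_nonpos]
    exact mul_nonneg (totalRate_nonneg _) (by linarith [hs.2])
  have hq1 : ∀ s v, 0 ≤ 1 - q s v := fun s v => by
    simp only [hq, sub_sub_cancel]
    positivity
  have hsup := evolve_le_of_supersolution (G := G) (B := B) (I := I) ht (Φ := Φ)
    (Φ' := fun s J => ∑ v ∈ Jᶜ, (∏ u ∈ Jᶜ.erase v, q s u) * -(totalRate G v * (1 - q s v)))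
    (fun s _ J => by
      have := HasDerivAt.fun_finsetProd (u := Jᶜ) (f := fun v s => q s v) (fun v _ => hqd s v)
      simpa only [smul_eq_mul] using this)
    (fun s hs J hJ => by
      rw [generator_eq, ← Finset.sum_add_distrib]
      refine Finset.sum_nonpos fun v hv => ?_
      have hp : 0 ≤ ∏ u ∈ Jᶜ.erase v, q s u := Finset.prod_nonneg fun u _ => hq0 s hs u
      simp only [hΦ]
      rw [Finset.compl_insert, ← Finset.mul_prod_erase (Jᶜ) _ hv]
      have h1 := mul_nonneg (mul_nonneg hp (hq1 s v))
        (sub_nonneg.2 (rate_le_totalRate (G := G) (B := B) (I := J) v))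
      linarith)
  have hcmp : ∀ J, I ⊆ J → ind (fun J => J = Finset.univ) J ≤ Φ t J := fun J _ => by
    refine ind_le (Finset.prod_nonneg fun v _ => hq0 t ⟨ht, le_rfl⟩ v) fun h => ?_
    simp [hΦ, h]
  refine (evolve_mono ht hcmp).trans (hsup.trans ?_)
  rw [← Finset.sum_neg_distrib, Real.exp_sum]
  refine Finset.prod_le_prod (fun v _ => hq0 0 ⟨le_rfl, ht⟩ v) fun v _ => ?_
  simp only [hq, sub_zero]
  linarith [Real.add_one_le_exp (-Real.exp (-(totalRate G v * t)))]

end Rates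

/-! ### First moment of the weight of the informed set -/

section FirstMoment

variable {n : ℕ} {G : SimpleGraph (Fin n)} {B I : Finset (Fin n)}

theorem comp_informedSet_eq_sum (Φ : Finset (Fin n) → ℝ) (t : ℝ) (ω : Waits n × Contacts n) :
    Φ (informedSet I B ω t) =
      ∑ J, {ω | informedSet I B ω t = J}.indicator (fun _ => Φ J) ω := by
  classical
  simp [Set.indicator]

theorem integrable_comp_informedSet (Φ : Finset (Fin n) → ℝ) (t : ℝ) :
    Integrable (fun ω => Φ (informedSet I B ω t)) (protocolLaw G) := by
  simp only [comp_informedSet_eq_sum Φ]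
  exact integrable_finsetSum _ fun J _ =>
    (integrable_const _).indicator (measurableSet_informedSet_eq_at I B J t)

theorem evolve_eq_integral (Φ : Finset (Fin n) → ℝ) (t : ℝ) :
    evolve G B t Φ I = ∫ ω, Φ (informedSet I B ω t) ∂(protocolLaw G) := by
  simp only [comp_informedSet_eq_sum Φ]
  rw [integral_finsetSum]
  · rw [evolve_apply]
    refine Finset.sum_congr rfl fun J _ => ?_
    rw [integral_indicator_const _ (measurableSet_informedSet_eq_at I B J t), smul_eq_mul]
    rfl
  · intro J _
    exact (integrable_const _).indicator (measurableSet_informedSet_eq_at I B J t)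

/-- The bridge from the semigroup back to probabilities of events of the protocol. -/
theorem protocolLaw_real_setOf (A : Finset (Fin n) → Prop) (t : ℝ) :
    (protocolLaw G).real {ω | A (informedSet I B ω t)} = evolve G B t (ind A) I := by
  rw [evolve_eq_integral]
  have hm : MeasurableSet {ω : Waits n × Contacts n | A (informedSet I B ω t)} := by
    have : {ω : Waits n × Contacts n | A (informedSet I B ω t)} =
        ⋃ J : {J // A J}, {ω | informedSet I B ω t = J} := by
      ext ω; simp
    rw [this]
    exact .iUnion fun J => measurableSet_informedSet_eq_at I B J t
  have h1 : ∀ ω, ind A (informedSet I B ω t) =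
      {ω | A (informedSet I B ω t)}.indicator (fun _ => (1 : ℝ)) ω := by
    intro ω
    simp [ind, Set.indicator]
  simp only [h1]
  rw [integral_indicator_const _ hm]
  simp

/-- Expected weight of the informed set is subadditive in the initial set. -/
theorem evolve_sum_weight_insert_le {w : Fin n → ℝ} (hw : ∀ v, 0 ≤ w v) (s x : Fin n) (t : ℝ) :
    evolve G B t (fun J => ∑ v ∈ J, w v) {s, x} ≤
      evolve G B t (fun J => ∑ v ∈ J, w v) {s} + evolve G B t (fun J => ∑ v ∈ J, w v) {x} := by
  classical
  rw [evolve_eq_integral, evolve_eq_integral, evolve_eq_integral, ← integral_add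
    (integrable_comp_informedSet (I := {s}) (fun J => ∑ v ∈ J, w v) t)
    (integrable_comp_informedSet (I := {x}) (fun J => ∑ v ∈ J, w v) t)]
  refine integral_mono (integrable_comp_informedSet (fun J => ∑ v ∈ J, w v) t)
    ((integrable_comp_informedSet (I := {s}) (fun J => ∑ v ∈ J, w v) t).add
    (integrable_comp_informedSet (I := {x}) (fun J => ∑ v ∈ J, w v) t)) fun ω => ?_
  have hsub : informedSet {s, x} B ω t ⊆ informedSet {s} B ω t ∪ informedSet {x} B ω t := by
    intro v hv
    obtain ⟨y, hy, h⟩ := (mem_informedSet.1 hv).exists_source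
    rw [Finset.mem_union, mem_informedSet, mem_informedSet]
    rcases Finset.mem_insert.1 hy with rfl | hy
    · exact Or.inl h
    · rw [Finset.mem_singleton] at hy
      subst hy
      exact Or.inr h
  refine (Finset.sum_le_sum_of_subset_of_nonneg hsub fun v _ _ => hw v).trans ?_
  rw [← Finset.sum_union_inter]
  exact le_add_of_nonneg_right (Finset.sum_nonneg fun v _ => hw v)

/-- Sum over the sources of the expected weight of the informed set. -/
theorem sum_evolve_weight_le [NeZero n] {w h : Fin n → ℝ} (hw : ∀ v, 0 ≤ w v) (hh : ∀ v, 0 ≤ h v)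
    {κ : ℝ} (hκ : ∀ v, ∑ u, edgeRate G v u * h u ≤ κ * h v) {t : ℝ} (ht : 0 ≤ t) :
    ∑ s, h s * evolve G B t (fun J => ∑ v ∈ J, w v) {s} ≤
      Real.exp (κ * t) * ∑ s, h s * w s := by
  set Φ : Finset (Fin n) → ℝ := fun J => ∑ v ∈ J, w v with hΦ
  set y : Fin n → ℝ → ℝ := fun s t => evolve G B t Φ {s} with hy
  have hy0 : ∀ s t, 0 ≤ t → 0 ≤ y s t := fun s t ht =>
    evolve_nonneg ht fun J _ => Finset.sum_nonneg fun v _ => hw v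
  have hyd : ∀ s t, 0 ≤ t → HasDerivWithinAt (y s) (generator G B (evolve G B t Φ) {s})
      (Set.Ici 0) t := fun s t ht =>
    hasDerivWithinAt_pi.1 (hasDerivWithinAt_evolve G B Φ ht) {s}
  -- By additivity in the sources, adding `x` to `{s}` raises the expectation by at most that of the
  -- process from `x`. The backward equation thus becomes a linear differential inequality among
  -- single-source expectations, as for a branching process.
  have hgen : ∀ s t, 0 ≤ t → generator G B (evolve G B t Φ) {s} ≤ ∑ x, edgeRate G s x * y x t := by
    intro s t ht
    rw [generator_eq]
    refine (Finset.sum_le_sum fun x _ => ?_).trans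
      (Finset.sum_le_sum_of_subset_of_nonneg (Finset.subset_univ ({s}ᶜ : Finset (Fin n)))
        fun x _ _ => mul_nonneg (edgeRate_nonneg s x) (hy0 x t ht))
    have h1 : evolve G B t Φ (insert x {s}) - evolve G B t Φ {s} ≤ y x t := by
      have := evolve_sum_weight_insert_le (G := G) (B := B) hw x s t
      simp only [hy, hΦ]
      linarith
    have h2 : rate G B {s} x ≤ edgeRate G s x := by
      unfold rate
      refine (Finset.sum_le_sum_of_subset_of_nonneg Finset.sdiff_subset
        fun u _ _ => edgeRate_nonneg u x).trans ?_
      simp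
    exact (mul_le_mul_of_nonneg_left h1 (rate_nonneg x)).trans
      (mul_le_mul_of_nonneg_right h2 (hy0 x t ht))
  -- Since `edgeRate` is symmetric, the bound `κ` on the action of `edgeRate` on `h` also bounds the
  -- growth of the sum weighted by `h`.
  set H : ℝ → ℝ := fun t => Real.exp (-(κ * t)) * ∑ s, h s * y s t with hH
  have hHd : ∀ t, 0 ≤ t → HasDerivWithinAt H (Real.exp (-(κ * t)) * -κ * ∑ s, h s * y s t +
      Real.exp (-(κ * t)) * ∑ s, h s * generator G B (evolve G B t Φ) {s}) (Set.Ici 0) t := by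
    intro t ht
    have h1 : HasDerivAt (fun t : ℝ => Real.exp (-(κ * t))) (Real.exp (-(κ * t)) * -κ) t := by
      simpa using (((hasDerivAt_id t).const_mul κ).fun_neg).exp
    exact h1.hasDerivWithinAt.mul (HasDerivWithinAt.fun_sum fun s _ => (hyd s t ht).const_mul (h s))
  have hanti : AntitoneOn H (Set.Ici 0) := by
    refine antitoneOn_of_hasDerivWithinAt_nonpos (convex_Ici 0)
      (fun t ht => (hHd t ht).continuousWithinAt)
      (fun t ht => (hHd t (interior_subset ht)).mono interior_subset) (fun t ht => ?_)
    have ht : 0 ≤ t := interior_subset ht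
    have h1 : ∑ s, h s * generator G B (evolve G B t Φ) {s} ≤ κ * ∑ s, h s * y s t := by
      calc ∑ s, h s * generator G B (evolve G B t Φ) {s}
          ≤ ∑ s, h s * ∑ x, edgeRate G s x * y x t :=
            Finset.sum_le_sum fun s _ => mul_le_mul_of_nonneg_left (hgen s t ht) (hh s)
        _ = ∑ x, (∑ s, edgeRate G x s * h s) * y x t := by
            simp only [Finset.mul_sum, Finset.sum_mul]
            rw [Finset.sum_comm]
            refine Finset.sum_congr rfl fun x _ => Finset.sum_congr rfl fun s _ => ?_
            rw [edgeRate_comm s x]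
            ring
        _ ≤ ∑ x, κ * h x * y x t :=
            Finset.sum_le_sum fun x _ => mul_le_mul_of_nonneg_right (hκ x) (hy0 x t ht)
        _ = _ := by
            rw [Finset.mul_sum]
            exact Finset.sum_congr rfl fun x _ => by ring
    have h2 := mul_le_mul_of_nonneg_left h1 (Real.exp_nonneg (-(κ * t)))
    linarith
  have h0 := hanti (Set.mem_Ici.2 le_rfl) (Set.mem_Ici.2 ht) ht
  simp only [hH, hy, evolve_zero, mul_zero, neg_zero, Real.exp_zero, one_mul] at h0
  rw [Real.exp_neg, ← div_eq_inv_mul, div_le_iff₀ (Real.exp_pos _)] at h0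
  simpa [hΦ, mul_comm] using h0

/-- Lower bound for the spreading time through the weight of the nodes that are not informed
early. -/
theorem evolve_univ_le_of_weight [NeZero n] {s : Fin n} {t₁ t₂ F : ℝ} (ht₁ : 0 ≤ t₁) (ht₂ : 0 ≤ t₂)
    (hF : 0 < F) (hFle : F ≤ ∑ v, Real.exp (-(totalRate G v * t₂))) :
    evolve G B (t₁ + t₂) (ind fun J => J = Finset.univ) {s} ≤
      2 / F * evolve G B t₁ (fun J => ∑ v ∈ J, Real.exp (-(totalRate G v * t₂))) {s} +
        Real.exp (-(F / 2)) := by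
  set w : Fin n → ℝ := fun v => Real.exp (-(totalRate G v * t₂)) with hw
  -- If at most half of the weight is informed at `t₁`, the uninformed nodes carry at least `F / 2`
  -- and `evolve_univ_le` applies; Markov's inequality bounds the other case.
  refine (evolve_add_le (A := fun J => ∑ v ∈ J, w v ≤ F / 2) (q := Real.exp (-(F / 2)))
    (fun J => ind_le_one _ J) ht₁ ht₂ (Real.exp_nonneg _) fun J _ hA => ?_).trans ?_
  · refine (evolve_univ_le ht₂).trans (Real.exp_le_exp.2 (neg_le_neg ?_))
    have := Finset.sum_add_sum_compl J w
    linarith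
  · refine add_le_add ?_ le_rfl
    have hcmp : ∀ J, {s} ⊆ J → ind (fun J => ¬ ∑ v ∈ J, w v ≤ F / 2) J ≤
        ((2 / F) • fun J : Finset (Fin n) => ∑ v ∈ J, w v) J := by
      intro J _
      have h0 : 0 ≤ ∑ v ∈ J, w v := Finset.sum_nonneg fun v _ => Real.exp_nonneg _
      refine ind_le (mul_nonneg (by positivity) h0) fun hlt => ?_
      rw [not_le] at hlt
      rw [Pi.smul_apply, smul_eq_mul, div_mul_eq_mul_div, le_div_iff₀ hF]
      linarith
    refine (evolve_mono ht₁ hcmp).trans (le_of_eq ?_)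
    rw [map_smul, Pi.smul_apply, smul_eq_mul]

end FirstMoment

/-! ### Spreading on graphs with good expansion -/

/-- The nodes whose degree is close to `d`. -/
noncomputable def typical {n : ℕ} (G : SimpleGraph (Fin n)) (d ε : ℝ) : Finset (Fin n) :=
  Finset.univ.filter fun v => |deg G v - d| ≤ ε * d

/-- Degree, sparsity and expansion properties of a graph `G` with a set `B` of faulty nodes. -/
structure GoodGraph {n : ℕ} (G : SimpleGraph (Fin n)) (B : Finset (Fin n))
    (d c₁ D ε ν δ γ : ℝ) : Prop where
  deg_lower : ∀ v, c₁ * d ≤ deg G v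
  deg_upper : ∀ v, deg G v ≤ D * d
  sparse : ∀ S : Finset (Fin n), (S.card : ℝ) ≤ δ * n →
    ∑ v ∈ S, ((nbr G v ∩ S).card : ℝ) ≤ ν * d * S.card
  faulty : ∀ v, ((nbr G v ∩ B).card : ℝ) ≤ ν * d
  atypical : ∀ v, ((nbr G v \ typical G d ε).card : ℝ) ≤ ν * d
  cut : ∀ S S' : Finset (Fin n), Disjoint S S' → δ / 4 * n ≤ S.card → δ / 4 * n ≤ S'.card →
    γ * d * n ≤ ∑ x ∈ S', ((nbr G x ∩ S).card : ℝ)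

/-- The nodes with many neighbours in `A`. -/
noncomputable def crowded {n : ℕ} (G : SimpleGraph (Fin n)) (x : ℝ) (A : Finset (Fin n)) :
    Finset (Fin n) :=
  Finset.univ.filter fun v => x ≤ (nbr G v ∩ A).card

namespace GoodGraph

variable {n : ℕ} {G : SimpleGraph (Fin n)} {B I : Finset (Fin n)} {d c₁ D ε ν δ γ : ℝ}

theorem deg_pos (h : GoodGraph G B d c₁ D ε ν δ γ) (hd : 0 < d) (hc₁ : 0 < c₁) (v : Fin n) :
    0 < deg G v := (mul_pos hc₁ hd).trans_le (h.deg_lower v)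

theorem deg_le_card_inter (h : GoodGraph G B d c₁ D ε ν δ γ) (u : Fin n) :
    deg G u - 2 * (ν * d) ≤ ((typical G d ε \ B) ∩ nbr G u).card := by
  have hsub : nbr G u ⊆ ((typical G d ε \ B) ∩ nbr G u) ∪
      ((nbr G u \ typical G d ε) ∪ (nbr G u ∩ B)) := by
    intro x hx
    simp only [Finset.mem_union, Finset.mem_inter, Finset.mem_sdiff]
    tauto
  have h1 : deg G u ≤ ((typical G d ε \ B) ∩ nbr G u).card +
      (((nbr G u \ typical G d ε).card : ℝ) + (nbr G u ∩ B).card) := by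
    unfold deg
    exact_mod_cast (Finset.card_le_card hsub).trans ((Finset.card_union_le _ _).trans
      (Nat.add_le_add_left (Finset.card_union_le _ _) _))
  linarith [h.faulty u, h.atypical u]

/-- The source itself may have atypical degree. Still, at least half of its neighbours are typical
and non-faulty, so its own clock alone reaches one of them at rate at least `1 / 2`. -/
theorem hit_le [NeZero n] (h : GoodGraph G B d c₁ D ε ν δ γ) (hd : 0 < d) (hc₁ : 0 < c₁)
    (hν : ν ≤ c₁ / 4) (hI : (I \ B).Nonempty) {t : ℝ} (ht : 0 ≤ t) :
    evolve G B t (ind fun J => Disjoint J (typical G d ε \ B)) I ≤ Real.exp (-(1 / 2 * t)) := by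
  obtain ⟨u, hu⟩ := hI
  rw [Finset.mem_sdiff] at hu
  refine evolve_hit_le ht fun J hJ _ => ?_
  have hdu := h.deg_pos hd hc₁ u
  calc (1 : ℝ) / 2 ≤ (deg G u - 2 * (ν * d)) * (deg G u)⁻¹ := by
        rw [← div_eq_mul_inv, le_div_iff₀ hdu]
        nlinarith [h.deg_lower u]
    _ ≤ ((typical G d ε \ B) ∩ nbr G u).card * (deg G u)⁻¹ :=
        mul_le_mul_of_nonneg_right (h.deg_le_card_inter u) (inv_nonneg.2 hdu.le)
    _ = ∑ x ∈ (typical G d ε \ B) ∩ nbr G u, (deg G u)⁻¹ := by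
        rw [Finset.sum_const, nsmul_eq_mul]
    _ ≤ ∑ x ∈ (typical G d ε \ B) ∩ nbr G u, ((deg G x)⁻¹ + (deg G u)⁻¹) :=
        Finset.sum_le_sum fun x _ => le_add_of_nonneg_left (inv_nonneg.2 (deg_nonneg x))
    _ = ∑ x ∈ typical G d ε \ B, edgeRate G x u := (sum_edgeRate _ _).symm
    _ ≤ ∑ x ∈ typical G d ε \ B, rate G B J x := by
        refine Finset.sum_le_sum fun x _ => ?_
        rw [edgeRate_comm]
        exact Finset.single_le_sum (f := fun u => edgeRate G u x)
          (fun _ _ => edgeRate_nonneg _ _) (Finset.mem_sdiff.2 ⟨hJ hu.1, hu.2⟩)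

/-- Edges between typical nodes have rate about `2 / d`, each informed typical non-faulty node has
about `d` such neighbours, and by sparsity few edges stay inside a small set. Hence each informed
node creates new ones at rate about `2`. -/
theorem growth_le [NeZero n] (h : GoodGraph G B d c₁ D ε ν δ γ) (hd : 0 < d) (hε : 0 < ε)
    (hc₁ : 0 < c₁) (hεν : ε + 3 * ν ≤ 1) (hδ : 0 < δ) (hδ1 : δ ≤ 1) {a : ℝ} (ha : 0 < a)
    (hI : ¬ Disjoint I (typical G d ε \ B)) {t : ℝ} (ht : 0 ≤ t) :
    evolve G B t (ind fun J => ((J ∩ (typical G d ε \ B)).card : ℝ) ≤ δ * n) I ≤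
      Real.exp (a * (1 + Real.log n) - 2 * (1 - ε - 3 * ν) / (1 + ε) * a / (1 + a) * t) := by
  classical
  set V' := typical G d ε \ B with hV'
  set μ := 2 * (1 - ε - 3 * ν) / (1 + ε) with hμ
  have hn : (0 : ℝ) < n := by exact_mod_cast Nat.pos_of_ne_zero (NeZero.ne n)
  have hμ0 : 0 ≤ μ := div_nonneg (by linarith) (by linarith)
  have hiff : ∀ k : ℕ, (k : ℝ) ≤ δ * n ↔ k ≤ ⌊δ * n⌋₊ := fun k =>
    (Nat.le_floor_iff (by positivity)).symm
  simp only [hiff]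
  refine (evolve_growth_le (μ := μ) (M := ⌊δ * n⌋₊) ha hμ0 ht
    (Finset.not_disjoint_iff_nonempty_inter.1 hI) fun J _ hJM => ?_).trans ?_
  · set S := J ∩ V' with hS
    have hSB : S ⊆ J \ B := fun x hx => by
      rw [hS, Finset.mem_inter, hV', Finset.mem_sdiff] at hx
      exact Finset.mem_sdiff.2 ⟨hx.1, hx.2.2⟩
    have hVJ : V' \ J = V' \ S := by
      ext x
      simp only [hS, Finset.mem_sdiff, Finset.mem_inter]
      tauto
    have htyp : ∀ x ∈ V', deg G x ≤ (1 + ε) * d ∧ (1 - ε) * d ≤ deg G x := by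
      intro x hx
      rw [hV', Finset.mem_sdiff, typical, Finset.mem_filter, abs_le] at hx
      exact ⟨by linarith [hx.1.2.2], by linarith [hx.1.2.1]⟩
    have hinv : ∀ x ∈ V', ((1 + ε) * d)⁻¹ ≤ (deg G x)⁻¹ := fun x hx =>
      inv_anti₀ (h.deg_pos hd hc₁ x) (htyp x hx).1
    have h1 : ∀ u ∈ S, ((1 - ε) * d - 2 * (ν * d) - (nbr G u ∩ S).card) * (2 * ((1 + ε) * d)⁻¹) ≤
        ∑ x ∈ V' \ J, edgeRate G u x := by
      intro u hu
      have huV : u ∈ V' := (Finset.mem_inter.1 hu).2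
      rw [Finset.sum_congr rfl fun x _ => edgeRate_comm u x, sum_edgeRate]
      have hcard : (1 - ε) * d - 2 * (ν * d) - (nbr G u ∩ S).card ≤ ((V' \ J) ∩ nbr G u).card := by
        have hsub : V' ∩ nbr G u ⊆ ((V' \ J) ∩ nbr G u) ∪ (nbr G u ∩ S) := by
          intro x hx
          rw [hVJ]
          simp only [Finset.mem_union, Finset.mem_inter, Finset.mem_sdiff] at hx ⊢
          tauto
        have : ((V' ∩ nbr G u).card : ℝ) ≤ ((V' \ J) ∩ nbr G u).card + (nbr G u ∩ S).card := by
          exact_mod_cast (Finset.card_le_card hsub).trans (Finset.card_union_le _ _)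
        linarith [h.deg_le_card_inter u, (htyp u huV).2]
      calc _ ≤ (((V' \ J) ∩ nbr G u).card : ℝ) * (2 * ((1 + ε) * d)⁻¹) :=
            mul_le_mul_of_nonneg_right hcard (by positivity)
        _ = ∑ x ∈ (V' \ J) ∩ nbr G u, 2 * ((1 + ε) * d)⁻¹ := by
            rw [Finset.sum_const, nsmul_eq_mul]
        _ ≤ _ := Finset.sum_le_sum fun x hx => by
            have := hinv x (Finset.mem_sdiff.1 (Finset.mem_inter.1 hx).1).1
            linarith [hinv u huV]
    calc μ * S.card ≤ ∑ u ∈ S, ((1 - ε) * d - 2 * (ν * d) - (nbr G u ∩ S).card) *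
          (2 * ((1 + ε) * d)⁻¹) := by
          rw [← Finset.sum_mul, Finset.sum_sub_distrib, Finset.sum_const, nsmul_eq_mul]
          have hsp := h.sparse S ((hiff _).2 hJM)
          have : μ * S.card = (S.card * ((1 - ε) * d - 2 * (ν * d)) - ν * d * S.card) *
              (2 * ((1 + ε) * d)⁻¹) := by
            rw [hμ]
            field_simp
            ring
          rw [this]
          exact mul_le_mul_of_nonneg_right (by linarith) (by positivity)
      _ ≤ ∑ u ∈ S, ∑ x ∈ V' \ J, edgeRate G u x := Finset.sum_le_sum h1
      _ = ∑ x ∈ V' \ J, ∑ u ∈ S, edgeRate G u x := Finset.sum_comm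
      _ ≤ ∑ x ∈ V' \ J, rate G B J x := Finset.sum_le_sum fun x _ =>
          Finset.sum_le_sum_of_subset_of_nonneg hSB fun _ _ _ => edgeRate_nonneg _ _
  · refine Real.exp_le_exp.2 ?_
    have hlog : Real.log (⌊δ * n⌋₊ : ℝ) ≤ Real.log n := by
      rcases Nat.eq_zero_or_pos ⌊δ * (n : ℝ)⌋₊ with h0 | h0
      · rw [h0]
        simpa using Real.log_natCast_nonneg n
      · refine Real.log_le_log (by exact_mod_cast h0) ?_
        refine (Nat.floor_le (by positivity)).trans ?_
        nlinarith
    have := mul_le_mul_of_nonneg_left hlog ha.le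
    linarith

/-- Expansion: as long as both the informed non-faulty and the uninformed set are linear in size, at
least `γ d n` edges join them, each of rate at least `2 / (D d)`. -/
theorem shrink_le [NeZero n] (h : GoodGraph G B d c₁ D ε ν δ γ) (hd : 0 < d) (hc₁ : 0 < c₁)
    (hD : 0 < D) (hδ : 0 < δ) (hγ : 0 < γ)
    (hI : δ * n < ((I ∩ (typical G d ε \ B)).card : ℝ)) {t : ℝ} (ht : 0 ≤ t) :
    evolve G B t (ind fun J => δ / 4 * n < ((Jᶜ).card : ℝ)) I ≤
      4 / δ * Real.exp (-(2 * γ / D * t)) := by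
  have hn : (0 : ℝ) < n := by exact_mod_cast Nat.pos_of_ne_zero (NeZero.ne n)
  refine (evolve_shrink_le (μ := 2 * γ / D) (m := δ / 4 * n) (by positivity) ht
    fun J hJ hlt => ?_).trans (le_of_eq ?_)
  · have hSB : I ∩ (typical G d ε \ B) ⊆ J \ B := fun x hx => by
      rw [Finset.mem_inter, Finset.mem_sdiff] at hx
      exact Finset.mem_sdiff.2 ⟨hJ hx.1, hx.2.2⟩
    have hcard : δ * n ≤ ((J \ B).card : ℝ) :=
      hI.le.trans (by exact_mod_cast Finset.card_le_card hSB)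
    have hcut := h.cut (J \ B) Jᶜ (Finset.disjoint_left.2 fun x hx hx' =>
      (Finset.mem_compl.1 hx') (Finset.mem_sdiff.1 hx).1) (by nlinarith [mul_pos hδ hn]) hlt.le
    have hinv : ∀ x, (D * d)⁻¹ ≤ (deg G x)⁻¹ := fun x =>
      inv_anti₀ (h.deg_pos hd hc₁ x) (h.deg_upper x)
    have h1 : ∀ x ∈ Jᶜ, ((nbr G x ∩ (J \ B)).card : ℝ) * (2 * (D * d)⁻¹) ≤ rate G B J x := by
      intro x _
      unfold rate
      rw [sum_edgeRate, ← nsmul_eq_mul, ← Finset.sum_const, Finset.inter_comm]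
      exact Finset.sum_le_sum fun u _ => by linarith [hinv u, hinv x]
    have hcn : ((Jᶜ).card : ℝ) ≤ n := by
      exact_mod_cast (Finset.card_le_univ _).trans (by simp)
    calc 2 * γ / D * (Jᶜ).card ≤ 2 * γ / D * n :=
          mul_le_mul_of_nonneg_left hcn (by positivity)
      _ = γ * d * n * (2 * (D * d)⁻¹) := by field_simp
      _ ≤ (∑ x ∈ Jᶜ, ((nbr G x ∩ (J \ B)).card : ℝ)) * (2 * (D * d)⁻¹) :=
          mul_le_mul_of_nonneg_right hcut (by positivity)
      _ ≤ _ := by rw [Finset.sum_mul]; exact Finset.sum_le_sum h1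
  · congr 1
    field_simp

/-- Too many nodes crowded by `A` would form, together with `A`, a small set with too many inner
edges, against sparsity. -/
theorem mul_card_crowded_le [NeZero n] (h : GoodGraph G B d c₁ D ε ν δ γ) (hd : 0 < d) {K x : ℝ}
    (hK : 1 ≤ K) (hx : 3 * K * ν * d < x) {A : Finset (Fin n)} (hA : (A.card : ℝ) ≤ δ / 4 * n)
    (hν : 0 ≤ ν) : K * (crowded G x A).card ≤ A.card := by
  classical
  by_contra hlt
  rw [not_le] at hlt
  have hK0 : 0 < K := by linarith
  have hAne : A.Nonempty := by
    rw [Finset.nonempty_iff_ne_empty]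
    rintro rfl
    have h0 : crowded G x ∅ = ∅ := by
      ext v
      simp only [crowded, Finset.inter_empty, Finset.card_empty, Finset.mem_filter,
        Finset.mem_univ, true_and, Finset.notMem_empty, iff_false, not_le, Nat.cast_zero]
      refine lt_of_le_of_lt ?_ hx
      positivity
    rw [h0] at hlt
    simp at hlt
  -- Only just over `A.card / K` crowded nodes are kept, so the union has at most `3 * A.card ≤ δ n`
  -- elements, where sparsity is available.
  set k := ⌊(A.card : ℝ) / K⌋₊ + 1 with hk
  have hk1 : (A.card : ℝ) / K < k := by
    rw [hk]; push_cast; exact Nat.lt_floor_add_one _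
  have hkle : k ≤ (crowded G x A).card := by
    rw [hk, Nat.succ_le_iff, Nat.floor_lt (by positivity), div_lt_iff₀ hK0]
    linarith
  obtain ⟨X, hX, hXk⟩ := Finset.exists_subset_card_eq hkle
  have hA1 : (1 : ℝ) ≤ A.card := by exact_mod_cast hAne.card_pos
  have hk2 : (k : ℝ) ≤ A.card + 1 := by
    rw [hk]; push_cast
    have := Nat.floor_le (a := (A.card : ℝ) / K) (by positivity)
    have h2 : (A.card : ℝ) / K ≤ A.card := div_le_self (by positivity) hK
    linarith
  have hcard : ((A ∪ X).card : ℝ) ≤ 3 * A.card := by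
    have : ((A ∪ X).card : ℝ) ≤ A.card + X.card := by exact_mod_cast Finset.card_union_le _ _
    rw [hXk] at this
    linarith
  have hsp := h.sparse (A ∪ X) (by
    have : (0 : ℝ) ≤ A.card := by positivity
    linarith)
  have hlow : (k : ℝ) * x ≤ ∑ v ∈ A ∪ X, ((nbr G v ∩ (A ∪ X)).card : ℝ) := by
    calc (k : ℝ) * x = ∑ v ∈ X, x := by rw [Finset.sum_const, nsmul_eq_mul, hXk]
      _ ≤ ∑ v ∈ X, ((nbr G v ∩ (A ∪ X)).card : ℝ) := Finset.sum_le_sum fun v hv => by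
          have h1 := (Finset.mem_filter.1 (hX hv)).2
          refine h1.trans ?_
          exact_mod_cast Finset.card_le_card
            (Finset.inter_subset_inter_left Finset.subset_union_left)
      _ ≤ _ := Finset.sum_le_sum_of_subset_of_nonneg Finset.subset_union_right
          fun _ _ _ => Nat.cast_nonneg _
  have h3 : ν * d * ((A ∪ X).card : ℝ) ≤ ν * d * (3 * A.card) :=
    mul_le_mul_of_nonneg_left hcard (by positivity)
  have h4 : (A.card : ℝ) < k * K := (div_lt_iff₀ hK0).1 hk1
  have hk0 : (0 : ℝ) < k := by rw [hk]; positivity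
  have h5 : ν * d * 3 * A.card ≤ ν * d * 3 * (k * K) :=
    mul_le_mul_of_nonneg_left h4.le (by positivity)
  have h6 : k * (3 * K * ν * d) < k * x := mul_lt_mul_of_pos_left hx hk0
  nlinarith

/-- At least half of the neighbours of `x` are informed and non-faulty, so the pulls of `x` alone
suffice. -/
theorem one_half_le_rate (h : GoodGraph G B d c₁ D ε ν δ γ) (hd : 0 < d) (hc₁ : 0 < c₁)
    {ν₂ : ℝ} (hν₂ : ν₂ + ν ≤ c₁ / 2) {J : Finset (Fin n)} {x : Fin n}
    (hx : ((nbr G x ∩ Jᶜ).card : ℝ) ≤ ν₂ * d) : 1 / 2 ≤ rate G B J x := by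
  have hdx := h.deg_pos hd hc₁ x
  have hcard : deg G x - (ν₂ + ν) * d ≤ ((J \ B) ∩ nbr G x).card := by
    have hsub : nbr G x ⊆ ((J \ B) ∩ nbr G x) ∪ ((nbr G x ∩ Jᶜ) ∪ (nbr G x ∩ B)) := by
      intro y hy
      simp only [Finset.mem_union, Finset.mem_inter, Finset.mem_sdiff, Finset.mem_compl]
      tauto
    have h1 : deg G x ≤ ((J \ B) ∩ nbr G x).card +
        (((nbr G x ∩ Jᶜ).card : ℝ) + (nbr G x ∩ B).card) := by
      unfold deg
      exact_mod_cast (Finset.card_le_card hsub).trans ((Finset.card_union_le _ _).trans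
        (Nat.add_le_add_left (Finset.card_union_le _ _) _))
    linarith [h.faulty x]
  unfold rate
  rw [sum_edgeRate]
  calc (1 : ℝ) / 2 ≤ (deg G x - (ν₂ + ν) * d) * (deg G x)⁻¹ := by
        rw [← div_eq_mul_inv, le_div_iff₀ hdx]
        nlinarith [h.deg_lower x]
    _ ≤ ((J \ B) ∩ nbr G x).card * (deg G x)⁻¹ :=
        mul_le_mul_of_nonneg_right hcard (inv_nonneg.2 hdx.le)
    _ = ∑ u ∈ (J \ B) ∩ nbr G x, (deg G x)⁻¹ := by rw [Finset.sum_const, nsmul_eq_mul]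
    _ ≤ _ := Finset.sum_le_sum fun u _ => le_add_of_nonneg_left (inv_nonneg.2 (deg_nonneg u))

/-- One round reduces the number of nodes with many uninformed neighbours by a factor `K`. -/
theorem round_le [NeZero n] (h : GoodGraph G B d c₁ D ε ν δ γ) (hd : 0 < d) (hc₁ : 0 < c₁)
    (hν : 0 ≤ ν) {ν₂ K b : ℝ} (hν₂ : 0 < ν₂) (hνc : ν₂ + ν ≤ c₁ / 2) (hK : 1 ≤ K)
    (hKν : 6 * K * ν < ν₂) (hb : b ≤ δ / 4 * n)
    (hI : ((crowded G (ν₂ * d) Iᶜ).card : ℝ) ≤ b) :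
    evolve G B (4 * (D + 3) / ν₂) (ind fun J => ¬ ((crowded G (ν₂ * d) Jᶜ).card : ℝ) ≤ b / K) I ≤
      n * Real.exp (-(3 * d)) := by
  classical
  have hK0 : 0 < K := by linarith
  -- Chosen so that `exp (D d)`, which dominates the number of subsets of a neighbourhood, times
  -- `exp (-(τ / 2) (ν₂ / 2) d)` is exactly `exp (-3 d)`; this survives the union over nodes and
  -- rounds.
  set τ := 4 * (D + 3) / ν₂ with hτ
  have hDpos : 0 < D + 3 := by
    have h1 := h.deg_upper ⟨0, Nat.pos_of_ne_zero (NeZero.ne n)⟩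
    have h2 := h.deg_pos hd hc₁ ⟨0, Nat.pos_of_ne_zero (NeZero.ne n)⟩
    have : 0 < D := by
      by_contra hD
      rw [not_lt] at hD
      nlinarith
    linarith
  have hτ0 : 0 ≤ τ := by positivity
  set X := crowded G (ν₂ * d) Iᶜ with hX
  -- The uninformed neighbours of `v` that are not crowded themselves: they have rate at least `1 /
  -- 2` during the whole round.
  set W : Fin n → Finset (Fin n) := fun v => (nbr G v ∩ Iᶜ) \ X with hW
  have hcmp : ∀ J, I ⊆ J → ind (fun J => ¬ ((crowded G (ν₂ * d) Jᶜ).card : ℝ) ≤ b / K) J ≤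
      (∑ v, ind fun J => ν₂ / 2 * d ≤ ((W v \ J).card : ℝ)) J := by
    intro J hJ
    rw [Finset.sum_apply]
    refine ind_le (Finset.sum_nonneg fun v _ => ind_nonneg _ _) fun hbad => ?_
    -- Otherwise a node still crowded at the end has at least `ν₂ / 2 * d` neighbours in the old
    -- crowded set `X`, and `mul_card_crowded_le` for `X` leaves at most `X.card / K` such nodes.
    have hex : ∃ v, ν₂ / 2 * d ≤ ((W v \ J).card : ℝ) := by
      by_contra hno
      push Not at hno
      refine hbad ?_
      have hsub : crowded G (ν₂ * d) Jᶜ ⊆ crowded G (ν₂ / 2 * d) X := by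
        intro v hv
        have hv := (Finset.mem_filter.1 hv).2
        refine Finset.mem_filter.2 ⟨Finset.mem_univ _, ?_⟩
        have hs : nbr G v ∩ Jᶜ ⊆ (nbr G v ∩ X) ∪ (W v \ J) := by
          intro y hy
          simp only [hW, Finset.mem_union, Finset.mem_inter, Finset.mem_sdiff,
            Finset.mem_compl] at hy ⊢
          have := fun h => hy.2 (hJ h)
          tauto
        have : ((nbr G v ∩ Jᶜ).card : ℝ) ≤ (nbr G v ∩ X).card + (W v \ J).card := by
          exact_mod_cast (Finset.card_le_card hs).trans (Finset.card_union_le _ _)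
        linarith [hno v]
      have h1 := h.mul_card_crowded_le hd hK (x := ν₂ / 2 * d) (A := X)
        (by nlinarith) (hI.trans hb) hν
      have h2 : ((crowded G (ν₂ * d) Jᶜ).card : ℝ) ≤ (crowded G (ν₂ / 2 * d) X).card := by
        exact_mod_cast Finset.card_le_card hsub
      rw [le_div_iff₀ hK0]
      nlinarith
    obtain ⟨v, hv⟩ := hex
    have := Finset.single_le_sum (f := fun v => ind (fun J => ν₂ / 2 * d ≤ ((W v \ J).card : ℝ)) J)
      (fun v _ => ind_nonneg _ _) (Finset.mem_univ v)
    rwa [ind_of hv] at this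
  refine (evolve_mono hτ0 hcmp).trans ?_
  rw [map_sum, Finset.sum_apply]
  have hone : ∀ v ∈ Finset.univ, evolve G B τ (ind fun J => ν₂ / 2 * d ≤ ((W v \ J).card : ℝ)) I ≤
      Real.exp (-(3 * d)) := by
    intro v _
    refine (evolve_uninformed_le hτ0 fun J hJ x hx => ?_).trans ?_
    · refine h.one_half_le_rate hd hc₁ hνc ?_
      simp only [hW, Finset.mem_sdiff, Finset.mem_inter] at hx
      have hx2 : ¬ ν₂ * d ≤ ((nbr G x ∩ Iᶜ).card : ℝ) := fun hge =>
        hx.1.2 (Finset.mem_filter.2 ⟨Finset.mem_univ _, hge⟩)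
      have hx3 : ((nbr G x ∩ Jᶜ).card : ℝ) ≤ (nbr G x ∩ Iᶜ).card := by
        exact_mod_cast Finset.card_le_card
          (Finset.inter_subset_inter_left (Finset.compl_subset_compl.2 hJ))
      linarith
    · have hWD : ((W v).card : ℝ) ≤ D * d := by
        refine le_trans ?_ (h.deg_upper v)
        unfold deg
        exact_mod_cast Finset.card_le_card (Finset.sdiff_subset.trans Finset.inter_subset_left)
      have h2 : (2 : ℝ) ^ (W v).card ≤ Real.exp (D * d) := by
        calc (2 : ℝ) ^ (W v).card ≤ Real.exp 1 ^ (W v).card :=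
              pow_le_pow_left₀ (by norm_num) (by linarith [Real.add_one_le_exp 1]) _
          _ = Real.exp (W v).card := by rw [← Real.exp_nat_mul, mul_one]
          _ ≤ _ := Real.exp_le_exp.2 hWD
      calc _ ≤ Real.exp (D * d) * Real.exp (-(τ / 2 * (ν₂ / 2 * d))) :=
            mul_le_mul_of_nonneg_right h2 (Real.exp_nonneg _)
        _ = Real.exp (-(3 * d)) := by
            rw [← Real.exp_add, hτ]
            congr 1
            field_simp
            ring
  have := Finset.sum_le_card_nsmul _ _ _ hone
  simpa using this

theorem rounds_le [NeZero n] (h : GoodGraph G B d c₁ D ε ν δ γ) (hd : 0 < d) (hc₁ : 0 < c₁)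
    (hD : 0 < D) (hν : 0 ≤ ν) {ν₂ K : ℝ} (hν₂ : 0 < ν₂) (hνc : ν₂ + ν ≤ c₁ / 2) (hK : 1 ≤ K)
    (hKν : 6 * K * ν < ν₂) (k : ℕ) :
    ∀ {I : Finset (Fin n)} {b : ℝ}, 0 ≤ b → b ≤ δ / 4 * n →
      ((crowded G (ν₂ * d) Iᶜ).card : ℝ) ≤ b →
    evolve G B (k * (4 * (D + 3) / ν₂))
      (ind fun J => ¬ ((crowded G (ν₂ * d) Jᶜ).card : ℝ) ≤ b / K ^ k) I ≤
      k * (n * Real.exp (-(3 * d))) := by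
  have hτ : 0 ≤ 4 * (D + 3) / ν₂ := by positivity
  induction k with
  | zero =>
    intro I b _ _ hI
    simp only [Nat.cast_zero, zero_mul, evolve_zero]
    rw [ind_of_not]
    simpa using hI
  | succ k ih =>
    intro I b hb0 hb hI
    have hbK : b / K ≤ b := div_le_self hb0 hK
    have := evolve_add_le (G := G) (B := B) (I := I)
      (Φ := ind fun J => ¬ ((crowded G (ν₂ * d) Jᶜ).card : ℝ) ≤ b / K ^ (k + 1))
      (A := fun J => ((crowded G (ν₂ * d) Jᶜ).card : ℝ) ≤ b / K)
      (q := k * (n * Real.exp (-(3 * d)))) (fun J => ind_le_one _ J) hτ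
      (t := k * (4 * (D + 3) / ν₂)) (by positivity) (by positivity) (fun J _ hJ => by
        have := ih (I := J) (b := b / K) (by positivity) (hbK.trans hb) hJ
        rwa [div_div, ← pow_succ'] at this)
    have h1 := h.round_le hd hc₁ hν hν₂ hνc hK hKν hb hI
    have e : ((k + 1 : ℕ) : ℝ) * (4 * (D + 3) / ν₂) =
        4 * (D + 3) / ν₂ + k * (4 * (D + 3) / ν₂) := by push_cast; ring
    rw [e]
    push_cast
    linarith

/-- Uninformed or faulty neighbours number at most `(ν₂ + ν) d`, and each edge has rate at most `2 /
(c₁ d)`. So every node is served at nearly its full rate. -/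
theorem totalRate_sub_le_rate (h : GoodGraph G B d c₁ D ε ν δ γ) (hd : 0 < d) (hc₁ : 0 < c₁)
    {ν₂ : ℝ} {J : Finset (Fin n)} {x : Fin n} (hx : ((nbr G x ∩ Jᶜ).card : ℝ) ≤ ν₂ * d) :
    totalRate G x - 2 * (ν₂ + ν) / c₁ ≤ rate G B J x := by
  classical
  have hsplit : totalRate G x = rate G B J x + ∑ u ∈ (J \ B)ᶜ, edgeRate G u x := by
    unfold totalRate rate
    rw [Finset.sum_add_sum_compl]
  have hcard : (((J \ B)ᶜ ∩ nbr G x).card : ℝ) ≤ (ν₂ + ν) * d := by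
    have hsub : (J \ B)ᶜ ∩ nbr G x ⊆ (nbr G x ∩ Jᶜ) ∪ (nbr G x ∩ B) := by
      intro y hy
      simp only [Finset.mem_union, Finset.mem_inter, Finset.mem_sdiff, Finset.mem_compl] at hy ⊢
      tauto
    have : (((J \ B)ᶜ ∩ nbr G x).card : ℝ) ≤ (nbr G x ∩ Jᶜ).card + (nbr G x ∩ B).card := by
      exact_mod_cast (Finset.card_le_card hsub).trans (Finset.card_union_le _ _)
    linarith [h.faulty x]
  have hinv : ∀ y, (deg G y)⁻¹ ≤ (c₁ * d)⁻¹ := fun y =>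
    inv_anti₀ (mul_pos hc₁ hd) (h.deg_lower y)
  have hle : ∑ u ∈ (J \ B)ᶜ, edgeRate G u x ≤ 2 * (ν₂ + ν) / c₁ := by
    rw [sum_edgeRate]
    calc _ ≤ ∑ u ∈ (J \ B)ᶜ ∩ nbr G x, 2 * (c₁ * d)⁻¹ :=
          Finset.sum_le_sum fun u _ => by linarith [hinv u, hinv x]
      _ = (((J \ B)ᶜ ∩ nbr G x).card : ℝ) * (2 * (c₁ * d)⁻¹) := by
          rw [Finset.sum_const, nsmul_eq_mul]
      _ ≤ (ν₂ + ν) * d * (2 * (c₁ * d)⁻¹) := mul_le_mul_of_nonneg_right hcard (by positivity)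
      _ = _ := by field_simp
  linarith

/-- Union bound over the last nodes. It is sharp enough because each rate is within a small constant
of `totalRate`, the same quantity that enters the lower bound. -/
theorem finish_le [NeZero n] (h : GoodGraph G B d c₁ D ε ν δ γ) (hd : 0 < d) (hc₁ : 0 < c₁)
    {ν₂ : ℝ} (hI : crowded G (ν₂ * d) Iᶜ = ∅) {t : ℝ} (ht : 0 ≤ t) :
    evolve G B t (ind fun J => J ≠ Finset.univ) I ≤
      ∑ v, Real.exp (-((totalRate G v - 2 * (ν₂ + ν) / c₁) * t)) := by
  have hcmp : ∀ J, I ⊆ J → ind (fun J => J ≠ Finset.univ) J ≤ (∑ v, ind fun J => v ∉ J) J := by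
    intro J _
    rw [Finset.sum_apply]
    refine ind_le (Finset.sum_nonneg fun v _ => ind_nonneg _ _) fun hne => ?_
    obtain ⟨v, hv⟩ : ∃ v, v ∉ J := by
      by_contra hno
      push Not at hno
      exact hne (Finset.eq_univ_iff_forall.2 hno)
    have := Finset.single_le_sum (f := fun v => ind (fun J => v ∉ J) J)
      (fun v _ => ind_nonneg _ _) (Finset.mem_univ v)
    rwa [ind_of (A := fun J => v ∉ J) hv] at this
  refine (evolve_mono ht hcmp).trans ?_
  rw [map_sum, Finset.sum_apply]
  refine Finset.sum_le_sum fun v _ => evolve_notMem_le ht fun J hJ _ => ?_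
  refine h.totalRate_sub_le_rate hd hc₁ ?_
  have hx2 : ¬ ν₂ * d ≤ ((nbr G v ∩ Iᶜ).card : ℝ) := fun hge => by
    have : v ∈ crowded G (ν₂ * d) Iᶜ := Finset.mem_filter.2 ⟨Finset.mem_univ _, hge⟩
    simp [hI] at this
  have hx3 : ((nbr G v ∩ Jᶜ).card : ℝ) ≤ (nbr G v ∩ Iᶜ).card := by
    exact_mod_cast Finset.card_le_card
      (Finset.inter_subset_inter_left (Finset.compl_subset_compl.2 hJ))
  linarith

/-- The probability that the rumor has not reached all nodes after all phases. -/
theorem not_univ_le [NeZero n] (h : GoodGraph G B d c₁ D ε ν δ γ) (hd : 0 < d) (hc₁ : 0 < c₁)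
    (hD : 0 < D) (hε : 0 < ε) (hν : 0 < ν) (hδ : 0 < δ) (hδ1 : δ ≤ 1) (hγ : 0 < γ)
    (hεν : ε + 3 * ν ≤ 1) {ν₂ K a : ℝ} (hν₂ : 0 < ν₂) (hνc : ν₂ + ν ≤ c₁ / 2)
    (hνc' : ν ≤ c₁ / 4) (hK : 1 ≤ K) (hKν : 6 * K * ν < ν₂) (ha : 0 < a) {k : ℕ}
    (hk : (n : ℝ) < K ^ k) (hI : (I \ B).Nonempty) {s₀ s₁ s₂ s₃ : ℝ} (hs₀ : 0 ≤ s₀)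
    (hs₁ : 0 ≤ s₁) (hs₂ : 0 ≤ s₂) (hs₃ : 0 ≤ s₃) :
    evolve G B (s₀ + (s₁ + (s₂ + (k * (4 * (D + 3) / ν₂) + s₃)))) (ind fun J => J ≠ Finset.univ) I ≤
      Real.exp (-(1 / 2 * s₀)) + (
      Real.exp (a * (1 + Real.log n) - 2 * (1 - ε - 3 * ν) / (1 + ε) * a / (1 + a) * s₁) + (
      4 / δ * Real.exp (-(2 * γ / D * s₂)) + (
      k * (n * Real.exp (-(3 * d))) +
      ∑ v, Real.exp (-((totalRate G v - 2 * (ν₂ + ν) / c₁) * s₃))))) := by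
  have hn : (0 : ℝ) < n := by exact_mod_cast Nat.pos_of_ne_zero (NeZero.ne n)
  have hτ : 0 ≤ 4 * (D + 3) / ν₂ := by positivity
  have hkτ : 0 ≤ k * (4 * (D + 3) / ν₂) := by positivity
  have hfin : 0 ≤ ∑ v, Real.exp (-((totalRate G v - 2 * (ν₂ + ν) / c₁) * s₃)) :=
    Finset.sum_nonneg fun v _ => Real.exp_nonneg _
  refine (evolve_add_le (A := fun J => ¬ Disjoint J (typical G d ε \ B))
    (q := Real.exp (a * (1 + Real.log n) - 2 * (1 - ε - 3 * ν) / (1 + ε) * a / (1 + a) * s₁) + (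
      4 / δ * Real.exp (-(2 * γ / D * s₂)) + (
      k * (n * Real.exp (-(3 * d))) +
      ∑ v, Real.exp (-((totalRate G v - 2 * (ν₂ + ν) / c₁) * s₃)))))
    (fun J => ind_le_one _ J) hs₀ (by positivity) (by positivity) fun J₀ _ hJ₀ => ?_).trans ?_
  · refine (evolve_add_le
      (A := fun J => ¬ ((J ∩ (typical G d ε \ B)).card : ℝ) ≤ δ * n)
      (q := 4 / δ * Real.exp (-(2 * γ / D * s₂)) + (
        k * (n * Real.exp (-(3 * d))) +
        ∑ v, Real.exp (-((totalRate G v - 2 * (ν₂ + ν) / c₁) * s₃))))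
      (fun J => ind_le_one _ J) hs₁ (by positivity) (by positivity) fun J₁ _ hJ₁ => ?_).trans ?_
    · refine (evolve_add_le (A := fun J => ¬ δ / 4 * n < ((Jᶜ).card : ℝ))
        (q := k * (n * Real.exp (-(3 * d))) +
          ∑ v, Real.exp (-((totalRate G v - 2 * (ν₂ + ν) / c₁) * s₃)))
        (fun J => ind_le_one _ J) hs₂ (by positivity) (by positivity) fun J₂ _ hJ₂ => ?_).trans ?_
      · refine (evolve_add_le (A := fun J => ((crowded G (ν₂ * d) Jᶜ).card : ℝ) ≤ δ / 4 * n / K ^ k)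
          (q := ∑ v, Real.exp (-((totalRate G v - 2 * (ν₂ + ν) / c₁) * s₃)))
          (fun J => ind_le_one _ J) hkτ hs₃ hfin fun J₃ _ hJ₃ => ?_).trans ?_
        · refine h.finish_le hd hc₁ ?_ hs₃
          -- After `k` rounds the bound is `δ / 4 * n / K ^ k < 1`, so no crowded node is left.
          have hlt : ((crowded G (ν₂ * d) J₃ᶜ).card : ℝ) < 1 := by
            refine hJ₃.trans_lt ?_
            rw [div_lt_one (by positivity)]
            nlinarith
          have : (crowded G (ν₂ * d) J₃ᶜ).card < 1 := by exact_mod_cast hlt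
          exact Finset.card_eq_zero.1 (by omega)
        · refine add_le_add ?_ le_rfl
          refine h.rounds_le hd hc₁ hD hν.le hν₂ hνc hK hKν k (by positivity) le_rfl ?_
          have h1 := h.mul_card_crowded_le hd hK (x := ν₂ * d) (A := J₂ᶜ)
            (by nlinarith [mul_pos hν₂ hd]) (not_lt.1 hJ₂) hν.le
          have h2 : ((crowded G (ν₂ * d) J₂ᶜ).card : ℝ) ≤ K * (crowded G (ν₂ * d) J₂ᶜ).card :=
            le_mul_of_one_le_left (by positivity) hK
          linarith [not_lt.1 hJ₂]
      · refine add_le_add ?_ le_rfl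
        simp only [not_not]
        exact h.shrink_le hd hc₁ hD hδ hγ (not_le.1 hJ₁) hs₂
    · refine add_le_add ?_ le_rfl
      simp only [not_not]
      exact h.growth_le hd hε hc₁ hεν hδ hδ1 ha hJ₀ hs₁
  · refine add_le_add ?_ le_rfl
    simp only [not_not]
    exact h.hit_le hd hc₁ hνc' hI hs₀

end GoodGraph

/-! ### The time scale of the spread -/

/-- The expected number of nodes without any contact up to time `t`. -/
noncomputable def lonelySum {n : ℕ} (G : SimpleGraph (Fin n)) (t : ℝ) : ℝ :=
  ∑ v, Real.exp (-(totalRate G v * t))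

open Classical in
/-- A time at which `f` takes the value `1`. -/
noncomputable def timeOfOne (f : ℝ → ℝ) : ℝ := if h : ∃ t, f t = 1 then h.choose else 0

/-- The time at which the expected number of nodes without any contact is `1`. -/
noncomputable def finishTime {n : ℕ} (G : SimpleGraph (Fin n)) : ℝ := timeOfOne (lonelySum G)

/-- The asymptotic spreading time. -/
noncomputable def spreadScale {n : ℕ} (G : SimpleGraph (Fin n)) : ℝ :=
  Real.log n / 2 + finishTime G

theorem timeOfOne_spec {f : ℝ → ℝ} (h : ∃ t, f t = 1) : f (timeOfOne f) = 1 := by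
  unfold timeOfOne
  rw [dif_pos h]
  exact h.choose_spec

namespace GoodGraph

variable {n : ℕ} {G : SimpleGraph (Fin n)} {B I : Finset (Fin n)} {d c₁ D ε ν δ γ : ℝ}

theorem totalRate_eq (h : GoodGraph G B d c₁ D ε ν δ γ) (hd : 0 < d) (hc₁ : 0 < c₁) (v : Fin n) :
    totalRate G v = 1 + ∑ u ∈ nbr G v, (deg G u)⁻¹ := by
  unfold totalRate
  rw [sum_edgeRate, Finset.univ_inter, Finset.sum_add_distrib, Finset.sum_const, nsmul_eq_mul,
    add_comm]
  congr 1
  exact mul_inv_cancel₀ (h.deg_pos hd hc₁ v).ne'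

theorem one_le_totalRate (h : GoodGraph G B d c₁ D ε ν δ γ) (hd : 0 < d) (hc₁ : 0 < c₁)
    (v : Fin n) : 1 ≤ totalRate G v := by
  rw [h.totalRate_eq hd hc₁]
  exact le_add_of_nonneg_right (Finset.sum_nonneg fun u _ => inv_nonneg.2 (deg_nonneg u))

theorem totalRate_le (h : GoodGraph G B d c₁ D ε ν δ γ) (hd : 0 < d) (hc₁ : 0 < c₁)
    (v : Fin n) : totalRate G v ≤ 1 + D / c₁ := by
  rw [h.totalRate_eq hd hc₁]
  refine add_le_add le_rfl ?_
  calc ∑ u ∈ nbr G v, (deg G u)⁻¹ ≤ ∑ u ∈ nbr G v, (c₁ * d)⁻¹ :=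
        Finset.sum_le_sum fun u _ => inv_anti₀ (mul_pos hc₁ hd) (h.deg_lower u)
    _ = deg G v * (c₁ * d)⁻¹ := by rw [Finset.sum_const, nsmul_eq_mul]; rfl
    _ ≤ D * d * (c₁ * d)⁻¹ := mul_le_mul_of_nonneg_right (h.deg_upper v) (by positivity)
    _ = D / c₁ := by field_simp

/-- All total rates lie between `1` and `1 + D / c₁`, so `lonelySum` passes through `1` between `log
n / (1 + D / c₁)` and `log n`; hence the choice in `timeOfOne` is not its default value. -/
theorem lonelySum_finishTime [NeZero n] (h : GoodGraph G B d c₁ D ε ν δ γ) (hd : 0 < d)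
    (hc₁ : 0 < c₁) (hD : 0 < D) : lonelySum G (finishTime G) = 1 := by
  have hn : (0 : ℝ) < n := by exact_mod_cast Nat.pos_of_ne_zero (NeZero.ne n)
  have hlog : 0 ≤ Real.log n := Real.log_natCast_nonneg n
  have hR : 0 < 1 + D / c₁ := by positivity
  have hexp : ∑ _v : Fin n, Real.exp (-Real.log n) = 1 := by
    rw [Finset.sum_const, Finset.card_univ, Fintype.card_fin, nsmul_eq_mul, Real.exp_neg,
      Real.exp_log hn, mul_inv_cancel₀ hn.ne']
  refine timeOfOne_spec ?_
  have hcont : ContinuousOn (lonelySum G) (Set.Icc (Real.log n / (1 + D / c₁)) (Real.log n)) := by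
    unfold lonelySum
    fun_prop
  have hle : Real.log n / (1 + D / c₁) ≤ Real.log n :=
    div_le_self hlog (by linarith [div_pos hD hc₁])
  have h1 : lonelySum G (Real.log n) ≤ 1 := by
    rw [← hexp]
    refine Finset.sum_le_sum fun v _ => Real.exp_le_exp.2 (neg_le_neg ?_)
    exact le_mul_of_one_le_left hlog (h.one_le_totalRate hd hc₁ v)
  have h2 : 1 ≤ lonelySum G (Real.log n / (1 + D / c₁)) := by
    refine hexp.symm.le.trans ?_
    refine Finset.sum_le_sum fun v _ => Real.exp_le_exp.2 (neg_le_neg ?_)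
    rw [mul_div_assoc', div_le_iff₀ hR, mul_comm]
    exact mul_le_mul_of_nonneg_left (h.totalRate_le hd hc₁ v) hlog
  obtain ⟨t, _, ht⟩ := intermediate_value_Icc' hle hcont ⟨h1, h2⟩
  exact ⟨t, ht⟩

/-- The finishing time is at least of order `log n`, so a margin `θ * finishTime G` yields a power
of `n`. -/
theorem log_le_mul_finishTime [NeZero n] (h : GoodGraph G B d c₁ D ε ν δ γ) (hd : 0 < d)
    (hc₁ : 0 < c₁) (hD : 0 < D) : Real.log n ≤ (1 + D / c₁) * finishTime G := by
  have hn : (0 : ℝ) < n := by exact_mod_cast Nat.pos_of_ne_zero (NeZero.ne n)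
  have hF := h.lonelySum_finishTime hd hc₁ hD
  have hlog : 0 ≤ Real.log n := Real.log_natCast_nonneg n
  by_contra hlt
  rw [not_le] at hlt
  have hR : 0 < 1 + D / c₁ := by positivity
  have : ∀ v, Real.exp (-Real.log n) < Real.exp (-(totalRate G v * finishTime G)) := by
    intro v
    refine Real.exp_lt_exp.2 (neg_lt_neg ?_)
    rcases le_or_gt 0 (finishTime G) with h0 | h0
    · exact lt_of_le_of_lt (mul_le_mul_of_nonneg_right (h.totalRate_le hd hc₁ v) h0) hlt
    · have := mul_lt_mul_of_neg_right (lt_of_lt_of_le zero_lt_one (h.one_le_totalRate hd hc₁ v)) h0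
      linarith
  have h2 : ∑ _v : Fin n, Real.exp (-Real.log n) < lonelySum G (finishTime G) :=
    Finset.sum_lt_sum_of_nonempty ⟨⟨0, Nat.pos_of_ne_zero (NeZero.ne n)⟩, Finset.mem_univ _⟩
      fun v _ => this v
  rw [hF, Finset.sum_const, Finset.card_univ, Fintype.card_fin, nsmul_eq_mul, Real.exp_neg,
    Real.exp_log hn, mul_inv_cancel₀ hn.ne'] at h2
  exact lt_irrefl _ h2

theorem finishTime_nonneg [NeZero n] (h : GoodGraph G B d c₁ D ε ν δ γ) (hd : 0 < d)
    (hc₁ : 0 < c₁) (hD : 0 < D) : 0 ≤ finishTime G := by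
  have h1 := h.log_le_mul_finishTime hd hc₁ hD
  have hR : 0 < 1 + D / c₁ := by positivity
  have hlog : 0 ≤ Real.log n := Real.log_natCast_nonneg n
  exact nonneg_of_mul_nonneg_right (hlog.trans h1) hR

/-- Running the growth phase for `(1 + θ) log n / 2` with exponent `a = θ / 10` beats the price `n ^
a` by a definite factor. -/
theorem growth_margin {θ ε ν : ℝ} (hθ : 0 < θ) (hθ1 : θ ≤ 1) (hε : 0 < ε) (hεθ : ε ≤ θ / 100)
    (hνθ : ν ≤ θ / 100) :
    1 + θ / 4 ≤ (1 - ε - 3 * ν) / (1 + ε) / (1 + θ / 10) * (1 + θ) := by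
  rw [div_div, div_mul_eq_mul_div, le_div_iff₀ (by positivity)]
  have hθ2 : θ * θ ≤ θ := mul_le_of_le_one_left hθ.le hθ1
  have hθ3 : θ * (θ * θ) ≤ θ := mul_le_of_le_one_right hθ.le (hθ2.trans hθ1)
  calc (1 + θ / 4) * ((1 + ε) * (1 + θ / 10))
      ≤ (1 + θ / 4) * ((1 + θ / 100) * (1 + θ / 10)) := by gcongr
    _ ≤ (1 - θ / 100 - 3 * (θ / 100)) * (1 + θ) := by linarith
    _ ≤ (1 - ε - 3 * ν) * (1 + θ) := mul_le_mul_of_nonneg_right (by linarith) (by linarith)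

set_option maxHeartbeats 1000000 in
/-- Upper bound for the probability that the rumor needs more than the asymptotic spreading time. -/
theorem not_univ_le_of_scale [NeZero n] (h : GoodGraph G B d c₁ D ε ν δ γ) (hc₁ : 0 < c₁)
    (hD : 0 < D) (hε : 0 < ε) (hν : 0 < ν) (hδ : 0 < δ) (hδ1 : δ ≤ 1) (hγ : 0 < γ)
    {θ ν₂ K : ℝ} (hθ : 0 < θ) (hθ1 : θ ≤ 1) (hεθ : ε ≤ θ / 100) (hνθ : ν ≤ θ / 100)
    (hν₂ : 0 < ν₂) (hν₂c : 2 * (ν₂ + ν) / c₁ ≤ θ / 4) (hνc' : ν ≤ c₁ / 4)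
    (hK : 4 * (D + 3) / ν₂ / θ + 1 ≤ Real.log K) (hK1 : 1 ≤ K) (hKν : 6 * K * ν < ν₂)
    (hlogd : Real.log n ≤ d) (hlogn : 4 * (D + 3) / ν₂ / θ ≤ Real.log n)
    (hn2 : 2 ≤ n) (hI : (I \ B).Nonempty) :
    evolve G B ((1 + 9 * θ) * spreadScale G) (ind fun J => J ≠ Finset.univ) I ≤
      Real.exp (-(θ / 2 * Real.log n)) + (
      Real.exp (θ / 10 - θ ^ 2 / 40 * Real.log n) + (
      4 / δ * Real.exp (-(2 * γ / D * θ * Real.log n)) + (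
      Real.exp (-Real.log n) +
      Real.exp (-(θ / 2 / (1 + D / c₁) * Real.log n))))) := by
  have hn : (0 : ℝ) < n := by exact_mod_cast Nat.pos_of_ne_zero (NeZero.ne n)
  have hlogpos : 0 < Real.log n := Real.log_pos (by exact_mod_cast hn2)
  have hd : 0 < d := hlogpos.trans_le hlogd
  set τ := 4 * (D + 3) / ν₂ with hτ
  set t₂ := finishTime G with ht₂
  have ht₂0 : 0 ≤ t₂ := h.finishTime_nonneg hd hc₁ hD
  have hτ0 : 0 < τ := by positivity
  have hlogK : 1 ≤ Real.log K := by
    have : 0 ≤ τ / θ := by positivity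
    linarith
  -- Enough rounds to have `K ^ k > n`; `K` is so large that all of them together take at most `2 θ
  -- log n`.
  set k := ⌊Real.log n / Real.log K⌋₊ + 1 with hk
  have hk_gt : Real.log n / Real.log K < k := by
    rw [hk]; push_cast; exact Nat.lt_floor_add_one _
  have hk_le : (k : ℝ) ≤ Real.log n / Real.log K + 1 := by
    rw [hk]; push_cast
    linarith [Nat.floor_le (a := Real.log n / Real.log K) (by positivity)]
  have hnK : (n : ℝ) < K ^ k := by
    rw [← Real.log_lt_log_iff hn (by positivity), Real.log_pow]
    rwa [div_lt_iff₀ (by linarith)] at hk_gt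
  have hkτ : k * τ ≤ 2 * θ * Real.log n := by
    have h1 : Real.log n / Real.log K * τ ≤ θ * Real.log n := by
      rw [div_mul_eq_mul_div, div_le_iff₀ (by linarith)]
      have : τ ≤ θ * Real.log K := by
        have := mul_le_mul_of_nonneg_left hK hθ.le
        rw [mul_add, mul_div_cancel₀ _ hθ.ne'] at this
        linarith
      nlinarith
    have h2 : τ ≤ θ * Real.log n := by
      have := mul_le_mul_of_nonneg_left hlogn hθ.le
      rwa [mul_div_cancel₀ _ hθ.ne'] at this
    nlinarith
  have hkn : (k : ℝ) ≤ n := by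
    have h1 : Real.log n / Real.log K ≤ Real.log n := div_le_self hlogpos.le hlogK
    have h2 := Real.log_le_sub_one_of_pos hn
    linarith
  set s₁ := (1 + θ) * (Real.log n / 2) with hs₁
  set s₂ := θ * Real.log n with hs₂
  set s₃ := (1 + θ) * t₂ with hs₃
  -- The first phase receives all remaining time. The other phases use at most `(1 + θ) log n / 2 +
  -- 3 θ log n + (1 + θ) t₂`, and the constant `9` then leaves at least `θ log n`.
  set s₀ := (1 + 9 * θ) * spreadScale G - (s₁ + (s₂ + (k * τ + s₃))) with hs₀
  have hs₀ge : θ * Real.log n ≤ s₀ := by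
    rw [hs₀, hs₁, hs₂, hs₃, spreadScale]
    have : 0 ≤ θ * t₂ := by positivity
    nlinarith
  have hs₀0 : 0 ≤ s₀ := le_trans (by positivity) hs₀ge
  have hmain := h.not_univ_le hd hc₁ hD hε hν hδ hδ1 hγ (by linarith) hν₂
    (by
      have h1 := (div_le_iff₀ hc₁).1 hν₂c
      nlinarith) hνc' hK1 hKν (a := θ / 10) (by positivity) hnK hI hs₀0
    (s₁ := s₁) (by positivity) (s₂ := s₂) (by positivity) (s₃ := s₃) (by positivity)
  have hT : s₀ + (s₁ + (s₂ + (k * τ + s₃))) = (1 + 9 * θ) * spreadScale G := by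
    rw [hs₀]; ring
  rw [hT] at hmain
  refine hmain.trans ?_
  refine add_le_add ?_ (add_le_add ?_ (add_le_add ?_ (add_le_add ?_ ?_)))
  · refine Real.exp_le_exp.2 (neg_le_neg ?_)
    linarith
  · refine Real.exp_le_exp.2 ?_
    have hkey := growth_margin hθ hθ1 hε hεθ hνθ
    have : 2 * (1 - ε - 3 * ν) / (1 + ε) * (θ / 10) / (1 + θ / 10) * s₁ =
        θ / 10 * ((1 - ε - 3 * ν) / (1 + ε) / (1 + θ / 10) * (1 + θ)) * Real.log n := by
      rw [hs₁]
      field_simp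
    rw [this]
    have h1 := mul_le_mul_of_nonneg_right (mul_le_mul_of_nonneg_left hkey
      (by positivity : 0 ≤ θ / 10)) hlogpos.le
    linarith
  · refine mul_le_mul_of_nonneg_left (Real.exp_le_exp.2 (neg_le_neg ?_)) (by positivity)
    rw [hs₂]
    exact le_of_eq (by ring)
  · calc (k : ℝ) * (n * Real.exp (-(3 * d))) ≤ n * (n * Real.exp (-(3 * Real.log n))) := by
          have : Real.exp (-(3 * d)) ≤ Real.exp (-(3 * Real.log n)) :=
            Real.exp_le_exp.2 (by linarith)
          gcongr
      _ = Real.exp (-Real.log n) := by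
          conv_lhs => rw [← Real.exp_log hn]
          rw [← Real.exp_add, ← Real.exp_add, Real.log_exp]
          congr 1
          ring
  · have h1 : ∀ v, Real.exp (-((totalRate G v - 2 * (ν₂ + ν) / c₁) * s₃)) ≤
        Real.exp (-(θ / 2 * t₂)) * Real.exp (-(totalRate G v * t₂)) := by
      intro v
      rw [← Real.exp_add]
      refine Real.exp_le_exp.2 ?_
      have hr := h.one_le_totalRate hd hc₁ v
      -- As the total rate is at least `1`, the surplus factor `1 + θ` pays for the missing rate, at
      -- most `θ / 4`, and leaves `θ / 2`; the sum becomes `exp (-(θ / 2) t₂)` times `lonelySum G t₂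
      -- = 1`.
      have : totalRate G v + θ / 2 ≤ (totalRate G v - 2 * (ν₂ + ν) / c₁) * (1 + θ) := by
        nlinarith
      have := mul_le_mul_of_nonneg_right this ht₂0
      rw [hs₃]
      linarith
    refine (Finset.sum_le_sum fun v _ => h1 v).trans ?_
    rw [← Finset.mul_sum]
    have hF := h.lonelySum_finishTime hd hc₁ hD
    unfold lonelySum at hF
    rw [hF, mul_one]
    refine Real.exp_le_exp.2 (neg_le_neg ?_)
    rw [div_mul_eq_mul_div, div_le_iff₀ (by positivity)]
    have := h.log_le_mul_finishTime hd hc₁ hD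
    nlinarith

/-- Approximate eigenvector of the edge rates with eigenvalue near `2`. Atypical nodes can have
total rate up to `1 + D / c₁`; weighting them by `2 + D / c₁` absorbs this, and typical nodes hardly
notice since they have few atypical neighbours. -/
theorem sum_edgeRate_mul_le (h : GoodGraph G B d c₁ D ε ν δ γ) (hd : 0 < d) (hc₁ : 0 < c₁)
    (hD : 0 < D) (hε : 0 ≤ ε) (hε1 : ε < 1) (hν : 0 ≤ ν) (hνc : ν ≤ c₁ / 2) (v : Fin n) :
    ∑ u, edgeRate G v u * (if u ∈ typical G d ε then 1 else 2 + D / c₁) ≤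
      (2 * (1 + ε) / (1 - ε) + 2 * ν * (2 + D / c₁) / c₁) *
        (if v ∈ typical G d ε then 1 else 2 + D / c₁) := by
  classical
  set R := 1 + D / c₁ with hR
  have hR0 : 0 < R := by positivity
  have hR2 : 2 + D / c₁ = 1 + R := by rw [hR]; ring
  rw [hR2]
  have hinv : ∀ x, (deg G x)⁻¹ ≤ (c₁ * d)⁻¹ := fun x =>
    inv_anti₀ (mul_pos hc₁ hd) (h.deg_lower x)
  have hatyp : ∑ u ∈ nbr G v \ typical G d ε, edgeRate G u v ≤ 2 * ν / c₁ := by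
    calc ∑ u ∈ nbr G v \ typical G d ε, edgeRate G u v
        ≤ ∑ u ∈ nbr G v \ typical G d ε, 2 * (c₁ * d)⁻¹ := by
          refine Finset.sum_le_sum fun u hu => ?_
          rw [edgeRate_of_adj (mem_nbr.1 (Finset.mem_sdiff.1 hu).1).symm]
          linarith [hinv u, hinv v]
      _ = ((nbr G v \ typical G d ε).card : ℝ) * (2 * (c₁ * d)⁻¹) := by
          rw [Finset.sum_const, nsmul_eq_mul]
      _ ≤ ν * d * (2 * (c₁ * d)⁻¹) := mul_le_mul_of_nonneg_right (h.atypical v) (by positivity)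
      _ = _ := by field_simp
  have hsplit : ∑ u, edgeRate G v u * (if u ∈ typical G d ε then 1 else 1 + R) =
      ∑ u ∈ nbr G v ∩ typical G d ε, edgeRate G u v +
        (1 + R) * ∑ u ∈ nbr G v \ typical G d ε, edgeRate G u v := by
    rw [← Finset.sum_subset (Finset.subset_univ (nbr G v)), ← Finset.sum_inter_add_sum_sdiff
      (nbr G v) (typical G d ε), Finset.mul_sum]
    · congr 1
      · refine Finset.sum_congr rfl fun u hu => ?_
        rw [if_pos (Finset.mem_inter.1 hu).2, mul_one, edgeRate_comm]
      · refine Finset.sum_congr rfl fun u hu => ?_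
        rw [if_neg (Finset.mem_sdiff.1 hu).2, edgeRate_comm]
        ring
    · intro u _ hu
      rw [edgeRate_of_not_adj fun h => hu (mem_nbr.2 h), zero_mul]
  rw [hsplit]
  have hnu0 : 0 ≤ 2 * ν * (1 + R) / c₁ := by positivity
  have h1 : (1 + R) * ∑ u ∈ nbr G v \ typical G d ε, edgeRate G u v ≤ 2 * ν * (1 + R) / c₁ := by
    calc _ ≤ (1 + R) * (2 * ν / c₁) := mul_le_mul_of_nonneg_left hatyp (by positivity)
      _ = _ := by ring
  have h2 : 2 ≤ 2 * (1 + ε) / (1 - ε) := by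
    rw [le_div_iff₀ (by linarith)]
    linarith
  split_ifs with hv
  · rw [mul_one]
    refine add_le_add ?_ h1
    have htyp : ∀ x ∈ typical G d ε, deg G x ≤ (1 + ε) * d ∧ (1 - ε) * d ≤ deg G x := by
      intro x hx
      rw [typical, Finset.mem_filter, abs_le] at hx
      exact ⟨by linarith [hx.2.2], by linarith [hx.2.1]⟩
    have hpos : 0 < (1 - ε) * d := mul_pos (by linarith) hd
    calc ∑ u ∈ nbr G v ∩ typical G d ε, edgeRate G u v
        ≤ ∑ u ∈ nbr G v ∩ typical G d ε, 2 * ((1 - ε) * d)⁻¹ := by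
          refine Finset.sum_le_sum fun u hu => ?_
          rw [Finset.mem_inter] at hu
          rw [edgeRate_of_adj (mem_nbr.1 hu.1).symm]
          linarith [inv_anti₀ hpos (htyp u hu.2).2, inv_anti₀ hpos (htyp v hv).2]
      _ = ((nbr G v ∩ typical G d ε).card : ℝ) * (2 * ((1 - ε) * d)⁻¹) := by
          rw [Finset.sum_const, nsmul_eq_mul]
      _ ≤ (1 + ε) * d * (2 * ((1 - ε) * d)⁻¹) := by
          refine mul_le_mul_of_nonneg_right (le_trans ?_ (htyp v hv).1) (by positivity)
          unfold deg
          exact_mod_cast Finset.card_le_card Finset.inter_subset_left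
      _ = _ := by
          have : (1 - ε) ≠ 0 := by linarith
          field_simp
  · have h3 : ∑ u ∈ nbr G v ∩ typical G d ε, edgeRate G u v ≤ R := by
      refine le_trans ?_ (h.totalRate_le hd hc₁ v)
      exact Finset.sum_le_sum_of_subset_of_nonneg (Finset.subset_univ _)
        fun _ _ _ => edgeRate_nonneg _ _
    have h4 : (1 + R) * ∑ u ∈ nbr G v \ typical G d ε, edgeRate G u v ≤ 1 + R := by
      refine mul_le_of_le_one_right (by positivity) (hatyp.trans ?_)
      rw [div_le_one hc₁]
      linarith
    nlinarith

/-- Lower bound for the spreading time, averaged over the source. -/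
theorem sum_univ_le_of_scale [NeZero n] (h : GoodGraph G B d c₁ D ε ν δ γ) (hc₁ : 0 < c₁)
    (hD : 0 < D) (hε : 0 < ε) (hν : 0 < ν) {θ : ℝ} (hθ : 0 < θ) (hθ1 : θ ≤ 1)
    (hεθ : ε ≤ θ / 100) (hνc : ν ≤ c₁ / 2) (hνR : 2 * ν * (2 + D / c₁) / c₁ ≤ θ / 20)
    (hlogd : Real.log n ≤ d) (hn2 : 2 ≤ n) (B' : Finset (Fin n)) :
    ∑ s, evolve G B' ((1 - θ) * spreadScale G) (ind fun J => J = Finset.univ) {s} ≤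
      n * (2 * (2 + D / c₁) * Real.exp (-(θ / 2 * Real.log n)) +
        Real.exp (-(Real.exp (θ / (1 + D / c₁) * Real.log n) / 2))) := by
  classical
  have hn : (0 : ℝ) < n := by exact_mod_cast Nat.pos_of_ne_zero (NeZero.ne n)
  have hlogpos : 0 < Real.log n := Real.log_pos (by exact_mod_cast hn2)
  have hd : 0 < d := hlogpos.trans_le hlogd
  set t₂ := finishTime G with ht₂
  have ht₂0 : 0 ≤ t₂ := h.finishTime_nonneg hd hc₁ hD
  set w : Fin n → ℝ := fun v => Real.exp (-(totalRate G v * ((1 - θ) * t₂))) with hw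
  set F := ∑ v, w v with hF
  -- Stopping at `(1 - θ) t₂` multiplies each term of `lonelySum G t₂ = 1` by at least `exp (θ t₂)`,
  -- a power of `n`.
  have hFge : Real.exp (θ / (1 + D / c₁) * Real.log n) ≤ F := by
    have h1 : Real.exp (θ * t₂) * lonelySum G t₂ ≤ F := by
      unfold lonelySum
      rw [Finset.mul_sum]
      refine Finset.sum_le_sum fun v _ => ?_
      rw [← Real.exp_add]
      refine Real.exp_le_exp.2 ?_
      have := mul_le_mul_of_nonneg_right (h.one_le_totalRate hd hc₁ v)
        (by positivity : 0 ≤ θ * t₂)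
      linarith
    rw [h.lonelySum_finishTime hd hc₁ hD, mul_one] at h1
    refine le_trans (Real.exp_le_exp.2 ?_) h1
    rw [div_mul_eq_mul_div, div_le_iff₀ (by positivity)]
    have := h.log_le_mul_finishTime hd hc₁ hD
    nlinarith
  have hF0 : 0 < F := (Real.exp_pos _).trans_le hFge
  have ht₁ : 0 ≤ (1 - θ) * (Real.log n / 2) := mul_nonneg (by linarith) (by linarith)
  have ht₃ : 0 ≤ (1 - θ) * t₂ := mul_nonneg (by linarith) ht₂0
  have hT : (1 - θ) * spreadScale G = (1 - θ) * (Real.log n / 2) + (1 - θ) * t₂ := by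
    rw [spreadScale]; ring
  rw [hT]
  set y : Fin n → ℝ := fun s =>
    evolve G B' ((1 - θ) * (Real.log n / 2)) (fun J => ∑ v ∈ J, w v) {s} with hy
  have hy0 : ∀ s, 0 ≤ y s := fun s =>
    evolve_nonneg ht₁ fun J _ => Finset.sum_nonneg fun v _ => Real.exp_nonneg _
  set g : Fin n → ℝ := fun u => if u ∈ typical G d ε then 1 else 2 + D / c₁ with hg
  have hR0 : 0 < D / c₁ := by positivity
  have hg1 : ∀ u, 1 ≤ g u := fun u => by
    simp only [hg]; split_ifs <;> linarith
  have hg2 : ∀ u, g u ≤ 2 + D / c₁ := fun u => by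
    simp only [hg]; split_ifs <;> linarith
  set κ := 2 * (1 + ε) / (1 - ε) + 2 * ν * (2 + D / c₁) / c₁ with hκ
  have hκle : κ ≤ 2 + θ / 10 := by
    have : 2 * (1 + ε) / (1 - ε) ≤ 2 + θ / 20 := by
      rw [div_le_iff₀ (by linarith)]
      nlinarith
    linarith
  have hsum := sum_evolve_weight_le (G := G) (B := B') (w := w) (h := g)
    (fun v => Real.exp_nonneg _) (fun v => by linarith [hg1 v])
    (h.sum_edgeRate_mul_le hd hc₁ hD hε.le (by linarith) hν.le hνc) ht₁
  -- With `κ ≤ 2 + θ / 10`, growth until `(1 - θ) log n / 2` gives at most `n ^ (1 - θ / 2)`: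
  -- averaged over the source, a vanishing fraction of the weight is informed.
  have hysum : ∑ s, y s ≤ n * Real.exp (-(θ / 2 * Real.log n)) * ((2 + D / c₁) * F) := by
    calc ∑ s, y s ≤ ∑ s, g s * y s :=
          Finset.sum_le_sum fun s _ => le_mul_of_one_le_left (hy0 s) (hg1 s)
      _ ≤ Real.exp (κ * ((1 - θ) * (Real.log n / 2))) * ∑ s, g s * w s := hsum
      _ ≤ (n * Real.exp (-(θ / 2 * Real.log n))) * ((2 + D / c₁) * F) := by
          refine mul_le_mul ?_ ?_ (Finset.sum_nonneg fun s _ => mul_nonneg (by linarith [hg1 s])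
            (Real.exp_nonneg _)) (by positivity)
          · conv_rhs => rw [← Real.exp_log hn, ← Real.exp_add, Real.log_exp]
            refine Real.exp_le_exp.2 ?_
            have h1 : κ * (1 - θ) ≤ 2 - θ := by nlinarith
            have := mul_le_mul_of_nonneg_right h1 (by linarith : 0 ≤ Real.log n / 2)
            linarith
          · rw [hF, Finset.mul_sum]
            exact Finset.sum_le_sum fun s _ =>
              mul_le_mul_of_nonneg_right (hg2 s) (Real.exp_nonneg _)
  calc _ ≤ ∑ s, (2 / F * y s + Real.exp (-(F / 2))) :=
        Finset.sum_le_sum fun s _ => evolve_univ_le_of_weight ht₁ ht₃ hF0 le_rfl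
    _ = 2 / F * ∑ s, y s + n * Real.exp (-(F / 2)) := by
        rw [Finset.sum_add_distrib, ← Finset.mul_sum, Finset.sum_const, Finset.card_univ,
          Fintype.card_fin, nsmul_eq_mul]
    _ ≤ 2 / F * (n * Real.exp (-(θ / 2 * Real.log n)) * ((2 + D / c₁) * F)) +
        n * Real.exp (-(Real.exp (θ / (1 + D / c₁) * Real.log n) / 2)) := by
        refine add_le_add (mul_le_mul_of_nonneg_left hysum (by positivity))
          (mul_le_mul_of_nonneg_left (Real.exp_le_exp.2 ?_) hn.le)
        linarith
    _ = _ := by field_simp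

end GoodGraph

/-! ### From the informed set to the spreading time -/

section SpreadTime

variable {n : ℕ} {G : SimpleGraph (Fin n)} {s : Fin n} {B : Finset (Fin n)}
  {ω : Waits n × Contacts n} {t : ℝ}

theorem spreadTime_le_of_univ (ht : 0 ≤ t) (h : informedSet {s} B ω t = Finset.univ) :
    spreadTime s B ω ≤ ENNReal.ofReal t := by
  refine iInf₂_le (⟨t, ht⟩ : ℝ≥0) (fun v => ?_) |>.trans ?_
  · rw [informed_iff_informedFrom, ← mem_informedSet]
    change v ∈ informedSet {s} B ω t
    rw [h]
    exact Finset.mem_univ v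
  · rw [ENNReal.ofReal, Real.toNNReal_of_nonneg ht]
    rfl

theorem le_spreadTime_of_ne_univ (h : informedSet {s} B ω t ≠ Finset.univ) :
    ENNReal.ofReal t ≤ spreadTime s B ω := by
  refine le_iInf₂ fun r hr => ?_
  by_contra hlt
  rw [not_le] at hlt
  have hrt : (r : ℝ) ≤ t := by
    have h1 : (r : ℝ≥0∞) = ENNReal.ofReal (r : ℝ) := by simp
    rw [h1] at hlt
    exact ((ENNReal.ofReal_lt_ofReal_iff_of_nonneg r.2).1 hlt).le
  refine h (Finset.eq_univ_of_forall fun v => mem_informedSet.2 ?_)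
  exact (informed_iff_informedFrom.1 (hr v)).mono_time hrt

theorem informedSet_anti_faulty {I B' : Finset (Fin n)} (h : B' ⊆ B) :
    informedSet I B ω t ⊆ informedSet I B' ω t := fun _ hv =>
  mem_informedSet.2 ((mem_informedSet.1 hv).anti_faulty h)

theorem measurableSet_informedSet_setOf (I : Finset (Fin n)) (A : Finset (Fin n) → Prop) (t : ℝ) :
    MeasurableSet {ω | A (informedSet I B ω t)} := by
  have : {ω | A (informedSet I B ω t)} =
      ⋃ J ∈ {J | A J}, {ω | informedSet I B ω t = J} := by
    ext ω
    simp
  rw [this]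
  exact MeasurableSet.biUnion (Set.to_countable _) fun J _ =>
    measurableSet_informedSet_eq_at I B J t

theorem protocolLaw_setOf (I : Finset (Fin n)) (A : Finset (Fin n) → Prop) (t : ℝ) :
    protocolLaw G {ω | A (informedSet I B ω t)} = ENNReal.ofReal (evolve G B t (ind A) I) := by
  rw [← protocolLaw_real_setOf, measureReal_def, ENNReal.ofReal_toReal (measure_ne_top _ _)]

-- Rounding the spreading time up to a multiple of `T`: it is at most `T` times the number of
-- multiples at which somebody is still uninformed.
open Classical in
theorem spreadTime_le_tsum {T : ℝ} (hT : 0 < T) :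
    spreadTime s B ω ≤ ∑' k : ℕ, {ω | informedSet {s} B ω (k * T) ≠ Finset.univ}.indicator
      (fun _ => ENNReal.ofReal T) ω := by
  by_cases h : ∃ k : ℕ, informedSet {s} B ω (k * T) = Finset.univ
  · refine (spreadTime_le_of_univ (by positivity) (Nat.find_spec h)).trans ?_
    refine le_trans ?_ (ENNReal.sum_le_tsum (Finset.range (Nat.find h)))
    have hk : ∀ k ∈ Finset.range (Nat.find h), {ω | informedSet {s} B ω (k * T) ≠
        Finset.univ}.indicator (fun _ => ENNReal.ofReal T) ω = ENNReal.ofReal T := fun k hk =>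
      Set.indicator_of_mem (s := {ω | informedSet {s} B ω (k * T) ≠ Finset.univ})
        (Nat.find_min h (Finset.mem_range.1 hk)) _
    rw [Finset.sum_congr rfl hk, Finset.sum_const, Finset.card_range, nsmul_eq_mul, ENNReal.ofReal_mul (by positivity),
      ENNReal.ofReal_natCast]
  · push Not at h
    have : ∀ k : ℕ, {ω | informedSet {s} B ω (k * T) ≠ Finset.univ}.indicator
        (fun _ => ENNReal.ofReal T) ω = ENNReal.ofReal T := fun k =>
      Set.indicator_of_mem (s := {ω | informedSet {s} B ω (k * T) ≠ Finset.univ}) (h k) _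
    rw [tsum_congr this, ENNReal.tsum_const_eq_top_of_ne_zero]
    · exact le_top
    · rw [Ne, ENNReal.ofReal_eq_zero, not_le]
      exact hT

/-- Each period of length `T` restarts from whatever set is informed by then, which is why the
hypothesis must cover every nonempty start. -/
theorem evolve_ne_univ_le_pow [NeZero n] {T ρ : ℝ} (hT : 0 ≤ T)
    (h : ∀ I : Finset (Fin n), I.Nonempty →
      evolve G B T (ind fun J => J ≠ Finset.univ) I ≤ ρ)
    {I : Finset (Fin n)} (hI : I.Nonempty) (k : ℕ) :
    evolve G B (k * T) (ind fun J => J ≠ Finset.univ) I ≤ ρ ^ k := by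
  have hρ : 0 ≤ ρ := (evolve_nonneg hT fun J _ => ind_nonneg _ J).trans (h I hI)
  induction k with
  | zero =>
    rw [Nat.cast_zero, zero_mul, pow_zero]
    exact evolve_ind_le_one le_rfl
  | succ k ih =>
    have hsplit : ((k + 1 : ℕ) : ℝ) * T = k * T + T := by push_cast; ring
    have hkT : 0 ≤ (k : ℝ) * T := by positivity
    rw [hsplit, evolve_add _ _ _ hkT hT]
    calc evolve G B (k * T) (evolve G B T (ind fun J => J ≠ Finset.univ)) I
        ≤ evolve G B (k * T) (ρ • ind fun J => J ≠ Finset.univ) I := by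
          refine evolve_mono (by positivity) fun J hJ => ?_
          rw [Pi.smul_apply, smul_eq_mul]
          by_cases hJu : J = Finset.univ
          · rw [ind_of_not (A := fun J => J ≠ Finset.univ) (by simpa using hJu), mul_zero]
            refine (evolve_mono hT (Ψ := fun _ => 0) fun J' hJ' => ?_).trans
              (evolve_const T 0).le
            rw [ind_of_not (A := fun J => J ≠ Finset.univ)]
            rw [hJu] at hJ'
            simpa using Finset.univ_subset_iff.1 hJ'
          · rw [ind_of (A := fun J => J ≠ Finset.univ) hJu, mul_one]
            exact h J (hI.mono hJ)
      _ = ρ * evolve G B (k * T) (ind fun J => J ≠ Finset.univ) I := by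
          rw [map_smul, Pi.smul_apply, smul_eq_mul]
      _ ≤ ρ ^ (k + 1) := by
          rw [pow_succ']
          exact mul_le_mul_of_nonneg_left ih hρ

theorem expectedSpreadTime_le [NeZero n] {T ρ : ℝ} (hT : 0 < T) (hρ1 : ρ < 1)
    (h : ∀ I : Finset (Fin n), I.Nonempty →
      evolve G ∅ T (ind fun J => J ≠ Finset.univ) I ≤ ρ) (s : Fin n) :
    expectedSpreadTime s G ≤ ENNReal.ofReal (T / (1 - ρ)) := by
  have hρ : 0 ≤ ρ := (evolve_nonneg hT.le fun J _ => ind_nonneg _ J).trans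
    (h {s} (Finset.singleton_nonempty s))
  calc expectedSpreadTime s G
      ≤ ∫⁻ ω, ∑' k : ℕ, {ω | informedSet {s} ∅ ω (k * T) ≠ Finset.univ}.indicator
          (fun _ => ENNReal.ofReal T) ω ∂(protocolLaw G) :=
        lintegral_mono fun ω => spreadTime_le_tsum hT
    _ = ∑' k : ℕ, ENNReal.ofReal T *
          ENNReal.ofReal (evolve G ∅ (k * T) (ind fun J => J ≠ Finset.univ) {s}) := by
        rw [lintegral_tsum fun k : ℕ => (measurable_const.indicator
          (measurableSet_informedSet_setOf {s} (fun J => J ≠ Finset.univ) (k * T))).aemeasurable]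
        refine tsum_congr fun k => ?_
        rw [lintegral_indicator_const (measurableSet_informedSet_setOf {s}
          (fun J => J ≠ Finset.univ) (k * T)), protocolLaw_setOf (A := fun J => J ≠ Finset.univ)]
    _ ≤ ∑' k : ℕ, ENNReal.ofReal (T * ρ ^ k) := by
        refine ENNReal.tsum_le_tsum fun k => ?_
        rw [← ENNReal.ofReal_mul hT.le]
        exact ENNReal.ofReal_le_ofReal (mul_le_mul_of_nonneg_left
          (evolve_ne_univ_le_pow hT.le h (Finset.singleton_nonempty s) k) hT.le)
    _ = ENNReal.ofReal (T / (1 - ρ)) := by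
        rw [← ENNReal.ofReal_tsum_of_nonneg (fun k => by positivity)
          ((summable_geometric_of_lt_one hρ hρ1).mul_left T), tsum_mul_left,
          tsum_geometric_of_lt_one hρ hρ1, div_eq_mul_inv]

theorem evolve_not [NeZero n] (A : Finset (Fin n) → Prop) (I : Finset (Fin n)) (t : ℝ) :
    evolve G B t (ind fun J => ¬ A J) I = 1 - evolve G B t (ind A) I := by
  have : (ind fun J => ¬ A J) = (fun _ => (1 : ℝ)) - ind A := by
    ext J
    by_cases hJ : A J
    · rw [ind_of_not (A := fun J => ¬ A J) (not_not.2 hJ), Pi.sub_apply, ind_of hJ, sub_self]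
    · rw [ind_of (A := fun J => ¬ A J) hJ, Pi.sub_apply, ind_of_not hJ, sub_zero]
  rw [this, map_sub, Pi.sub_apply, evolve_const]

theorem le_expectedSpreadTime [NeZero n] (ht : 0 ≤ t) (s : Fin n) :
    ENNReal.ofReal (t * (1 - evolve G ∅ t (ind fun J => J = Finset.univ) {s})) ≤
      expectedSpreadTime s G := by
  calc _ = ENNReal.ofReal t * protocolLaw G {ω | informedSet {s} ∅ ω t ≠ Finset.univ} := by
        rw [protocolLaw_setOf (A := fun J => J ≠ Finset.univ), ← ENNReal.ofReal_mul ht]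
        rw [evolve_not (fun J => J = Finset.univ)]
    _ = ∫⁻ ω, {ω | informedSet {s} ∅ ω t ≠ Finset.univ}.indicator
          (fun _ => ENNReal.ofReal t) ω ∂(protocolLaw G) := by
        rw [lintegral_indicator_const (measurableSet_informedSet_setOf _ (fun J =>
          J ≠ Finset.univ) _)]
    _ ≤ _ := by
        refine lintegral_mono fun ω => ?_
        refine Set.indicator_le (s := {ω | informedSet {s} ∅ ω t ≠ Finset.univ})
          (fun ω hω => ?_) ω
        exact le_spreadTime_of_ne_univ hω

/-- If the spreading time is close to `L` with high probability from every start, then it is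
close to its expectation. -/
theorem le_protocolLaw_concentrated [NeZero n] {L θ : ℝ} (hL : 0 < L) (hθ : 0 < θ)
    (hθ1 : θ ≤ 1 / 20)
    (hup : ∀ I : Finset (Fin n), I.Nonempty →
      evolve G ∅ ((1 + 9 * θ) * L) (ind fun J => J ≠ Finset.univ) I ≤ θ)
    (hupB : evolve G B ((1 + 9 * θ) * L) (ind fun J => J ≠ Finset.univ) {s} ≤ θ)
    (hlow : evolve G ∅ ((1 - θ) * L) (ind fun J => J = Finset.univ) {s} ≤ θ) :
    ENNReal.ofReal (1 - 2 * θ) ≤ protocolLaw G {ω | expectedSpreadTime s G ≠ ∞ ∧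
      spreadTime s B ω ≠ ∞ ∧ |(spreadTime s B ω).toReal - (expectedSpreadTime s G).toReal| ≤
        20 * θ * (expectedSpreadTime s G).toReal} := by
  have hT1 : 0 < (1 + 9 * θ) * L := by positivity
  have hT0 : 0 ≤ (1 - θ) * L := mul_nonneg (by linarith) hL.le
  have hE1 := expectedSpreadTime_le hT1 (by linarith) hup s
  have hE0 := le_expectedSpreadTime (G := G) hT0 s
  have hE : expectedSpreadTime s G ≠ ∞ := ne_top_of_le_ne_top ENNReal.ofReal_ne_top hE1
  set E := (expectedSpreadTime s G).toReal with hEdef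
  have hE1' : E ≤ (1 + 9 * θ) * L / (1 - θ) :=
    ENNReal.toReal_le_of_le_ofReal (div_nonneg hT1.le (by linarith)) hE1
  have hE0' : (1 - θ) * L * (1 - θ) ≤ E := by
    refine le_trans (mul_le_mul_of_nonneg_left (by linarith) hT0)
      ((ENNReal.ofReal_le_iff_le_toReal hE).1 hE0)
  set A := {ω | informedSet {s} B ω ((1 + 9 * θ) * L) ≠ Finset.univ} with hA
  set A' := {ω | informedSet {s} ∅ ω ((1 - θ) * L) = Finset.univ} with hA'
  have hmeas : protocolLaw G (A ∪ A') ≤ ENNReal.ofReal (2 * θ) := by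
    refine (measure_union_le _ _).trans ?_
    rw [hA, hA', protocolLaw_setOf (A := fun J => J ≠ Finset.univ),
      protocolLaw_setOf (A := fun J => J = Finset.univ), two_mul, ENNReal.ofReal_add hθ.le hθ.le]
    exact add_le_add (ENNReal.ofReal_le_ofReal hupB) (ENNReal.ofReal_le_ofReal hlow)
  have hmeasS : MeasurableSet (A ∪ A') :=
    (measurableSet_informedSet_setOf _ (fun J => J ≠ Finset.univ) _).union
      (measurableSet_informedSet_setOf _ (fun J => J = Finset.univ) _)
  calc ENNReal.ofReal (1 - 2 * θ) = 1 - ENNReal.ofReal (2 * θ) := by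
        rw [ENNReal.ofReal_sub _ (by positivity), ENNReal.ofReal_one]
    _ ≤ 1 - protocolLaw G (A ∪ A') := tsub_le_tsub_left hmeas 1
    _ = protocolLaw G (A ∪ A')ᶜ := (prob_compl_eq_one_sub hmeasS).symm
    _ ≤ _ := by
        refine measure_mono fun ω hω => ?_
        rw [Set.compl_union] at hω
        have h1 : informedSet {s} B ω ((1 + 9 * θ) * L) = Finset.univ := not_not.1 hω.1
        -- The early event is controlled without faults only; by coupling, faults can only slow the
        -- rumor down.
        have h2 : informedSet {s} B ω ((1 - θ) * L) ≠ Finset.univ := fun h =>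
          hω.2 (Finset.univ_subset_iff.1 (h ▸ informedSet_anti_faulty (Finset.empty_subset B)))
        have hle := spreadTime_le_of_univ hT1.le h1
        have hge := le_spreadTime_of_ne_univ h2
        have hS : spreadTime s B ω ≠ ∞ := ne_top_of_le_ne_top ENNReal.ofReal_ne_top hle
        refine ⟨hE, hS, ?_⟩
        have hle' := ENNReal.toReal_le_of_le_ofReal hT1.le hle
        have hge' := (ENNReal.ofReal_le_iff_le_toReal hS).1 hge
        -- The expectation lies in `[(1 - 2θ) L, (1 + 11θ) L]` and the spreading time in `[(1 - θ)
        -- L, (1 + 9θ) L]`, so they differ by at most `12 θ L ≤ 20 θ E`.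
        have hE1'' : E ≤ (1 + 11 * θ) * L := by
          refine hE1'.trans ?_
          rw [div_le_iff₀ (by linarith)]
          nlinarith [mul_pos hθ hL]
        have hE2 : (1 - 2 * θ) * L ≤ E := by nlinarith [mul_pos hθ hL, mul_pos hθ (mul_pos hθ hL)]
        have hθL : 12 * θ * L ≤ 20 * θ * E := by nlinarith [mul_pos hθ hL]
        rw [abs_le]
        constructor <;> nlinarith [mul_pos hθ hL]

end SpreadTime

/-! ### The binomial random graph -/

section BinomialRandom

variable {n : ℕ} {p : unitInterval}

instance instMeasurableSingletonClassSimpleGraph : MeasurableSingletonClass (SimpleGraph (Fin n)) :=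
  ⟨fun G => by
    rw [← SimpleGraph.measurableEmbedding_edgeSet.measurableSet_image]
    exact (Set.toFinite _).measurableSet⟩

open Classical in
/-- The possible edges of a graph. -/
noncomputable def allEdges (n : ℕ) : Finset (Sym2 (Fin n)) := Finset.univ.filter fun e => ¬ e.IsDiag

open Classical in
theorem binomialRandom_real_singleton (G : SimpleGraph (Fin n)) :
    (SimpleGraph.binomialRandom (Fin n) p).real {G} =
      ∏ e ∈ allEdges n, if e ∈ G.edgeSet then (p : ℝ) else 1 - p := by
  rw [measureReal_def, SimpleGraph.binomialRandom_singleton, Finset.prod_ite, Finset.prod_const,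
    Finset.prod_const]
  have h1 : ((allEdges n).filter fun e => e ∈ G.edgeSet).card = G.edgeSet.ncard := by
    rw [← Set.ncard_coe_finset]
    congr 1
    ext e
    simp only [allEdges, Finset.coe_filter, Finset.mem_filter, Finset.mem_univ, true_and,
      Set.mem_ofPred_eq]
    exact ⟨fun h => h.2, fun h => ⟨G.not_isDiag_of_mem_edgeSet h, h⟩⟩
  have h2 : (allEdges n).card = (Nat.card (Fin n)).choose 2 := by
    rw [Nat.card_eq_fintype_card, ← Sym2.card_subtype_not_diag, allEdges,
      Fintype.card_subtype]
  have h3 : ((allEdges n).filter fun e => ¬ e ∈ G.edgeSet).card =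
      (Nat.card (Fin n)).choose 2 - G.edgeSet.ncard := by
    have := Finset.card_filter_add_card_filter_not (s := allEdges n) (fun e => e ∈ G.edgeSet)
    omega
  rw [h1, h3]
  simp

theorem integral_binomialRandom [Fintype (SimpleGraph (Fin n))] (f : SimpleGraph (Fin n) → ℝ) :
    ∫ G, f G ∂(SimpleGraph.binomialRandom (Fin n) p) =
      ∑ G, (SimpleGraph.binomialRandom (Fin n) p).real {G} * f G := by
  rw [integral_fintype Integrable.of_finite]
  rfl

-- Independence of the edges in a usable form: graphs correspond to subsets of `allEdges`, and
-- summing over subsets expands the product of the two-term factors.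
open Classical in
theorem integral_prod_allEdges (a b : Sym2 (Fin n) → ℝ) :
    ∫ G : SimpleGraph (Fin n), (∏ e ∈ allEdges n, if e ∈ G.edgeSet then a e else b e)
        ∂(SimpleGraph.binomialRandom (Fin n) p) =
      ∏ e ∈ allEdges n, (p * a e + (1 - p) * b e) := by
  have := Fintype.ofFinite (SimpleGraph (Fin n))
  rw [integral_binomialRandom, Finset.prod_add]
  symm
  refine Finset.sum_bij' (fun T _ => SimpleGraph.fromEdgeSet (T : Set (Sym2 (Fin n))))
    (fun G _ => (allEdges n).filter fun e => e ∈ G.edgeSet) (fun _ _ => Finset.mem_univ _)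
    (fun G _ => Finset.mem_powerset.2 (Finset.filter_subset _ _)) ?_ ?_ ?_
  · intro T hT
    rw [Finset.mem_powerset] at hT
    ext e
    simp only [Finset.mem_filter, SimpleGraph.edgeSet_fromEdgeSet, Set.mem_sdiff, Finset.mem_coe]
    refine ⟨fun h => h.2.1, fun h => ⟨hT h, h, ?_⟩⟩
    have := hT h
    simpa [allEdges] using this
  · intro G _
    conv_rhs => rw [← SimpleGraph.fromEdgeSet_edgeSet G]
    congr 1
    ext e
    simp only [allEdges, Finset.coe_filter, Finset.mem_filter, Finset.mem_univ, true_and,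
      Set.mem_ofPred_eq]
    exact ⟨fun h => h.2, fun h => ⟨G.not_isDiag_of_mem_edgeSet h, h⟩⟩
  · intro T hT
    rw [Finset.mem_powerset] at hT
    rw [binomialRandom_real_singleton, ← Finset.prod_mul_distrib,
      ← Finset.prod_sdiff hT, mul_comm]
    congr 1
    · refine Finset.prod_congr rfl fun e he => ?_
      rw [Finset.mem_sdiff] at he
      have : e ∉ (SimpleGraph.fromEdgeSet (T : Set (Sym2 (Fin n)))).edgeSet := by
        rw [SimpleGraph.edgeSet_fromEdgeSet]
        exact fun h => he.2 h.1
      rw [if_neg this, if_neg this]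
    · refine Finset.prod_congr rfl fun e he => ?_
      have : e ∈ (SimpleGraph.fromEdgeSet (T : Set (Sym2 (Fin n)))).edgeSet := by
        rw [SimpleGraph.edgeSet_fromEdgeSet]
        refine ⟨he, ?_⟩
        have := hT he
        simpa [allEdges] using this
      rw [if_pos this, if_pos this]

open Classical in
/-- Exponential moments of the number of edges in a set, on the event that another set of edges
is present. -/
theorem integral_edges_le (A F : Finset (Sym2 (Fin n))) (hA : A ⊆ allEdges n)
    (hF : F ⊆ allEdges n) (hAF : Disjoint A F) (s : ℝ) :
    ∫ G : SimpleGraph (Fin n), (if ∀ e ∈ A, e ∈ G.edgeSet then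
        Real.exp (s * (F.filter fun e => e ∈ G.edgeSet).card) else 0)
        ∂(SimpleGraph.binomialRandom (Fin n) p) ≤
      (p : ℝ) ^ A.card * Real.exp (p * (Real.exp s - 1) * F.card) := by
  have hp0 : 0 ≤ (p : ℝ) := p.2.1
  have hp1 : (p : ℝ) ≤ 1 := p.2.2
  have hintegrand : ∀ G : SimpleGraph (Fin n), (if ∀ e ∈ A, e ∈ G.edgeSet then
        Real.exp (s * (F.filter fun e => e ∈ G.edgeSet).card) else 0) =
      ∏ e ∈ allEdges n, if e ∈ G.edgeSet then (if e ∈ F then Real.exp s else 1) else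
        (if e ∈ A then 0 else 1) := by
    intro G
    split_ifs with h
    · have h1 : Real.exp (s * (F.filter fun e => e ∈ G.edgeSet).card) =
          ∏ e ∈ F.filter fun e => e ∈ G.edgeSet, Real.exp s := by
        rw [Finset.prod_const, ← Real.exp_nat_mul, mul_comm]
      rw [h1]
      refine Finset.prod_subset_one_on_sdiff ((Finset.filter_subset _ _).trans hF) ?_ ?_
      · intro e he
        rw [Finset.mem_sdiff, Finset.mem_filter] at he
        by_cases heG : e ∈ G.edgeSet
        · rw [if_pos heG, if_neg fun h => he.2 ⟨h, heG⟩]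
        · rw [if_neg heG, if_neg fun h' => heG (h e h')]
      · intro e he
        rw [Finset.mem_filter] at he
        rw [if_pos he.2, if_pos he.1]
    · push Not at h
      obtain ⟨e, heA, heG⟩ := h
      symm
      refine Finset.prod_eq_zero (hA heA) ?_
      rw [if_neg heG, if_pos heA]
  simp_rw [hintegrand]
  rw [integral_prod_allEdges]
  calc ∏ e ∈ allEdges n, ((p : ℝ) * (if e ∈ F then Real.exp s else 1) +
          (1 - p) * (if e ∈ A then 0 else 1))
      ≤ ∏ e ∈ allEdges n, ((if e ∈ A then (p : ℝ) else 1) *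
          (if e ∈ F then Real.exp (p * (Real.exp s - 1)) else 1)) := by
        refine Finset.prod_le_prod (fun e _ => ?_) fun e _ => ?_
        · refine add_nonneg (mul_nonneg hp0 ?_) (mul_nonneg (by linarith) ?_)
          · split_ifs <;> positivity
          · split_ifs <;> positivity
        · by_cases heA : e ∈ A
          · have heF : e ∉ F := Finset.disjoint_left.1 hAF heA
            rw [if_neg heF, if_pos heA, if_pos heA, if_neg heF]
            simp
          · by_cases heF : e ∈ F
            -- Moment generating function of one edge: `1 + p (exp s - 1) ≤ exp (p (exp s - 1))`.
            · rw [if_pos heF, if_neg heA, if_neg heA, if_pos heF]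
              have := Real.add_one_le_exp (p * (Real.exp s - 1))
              linarith
            · rw [if_neg heF, if_neg heA, if_neg heA, if_neg heF]
              simp
    _ = (p : ℝ) ^ A.card * Real.exp (p * (Real.exp s - 1) * F.card) := by
        rw [Finset.prod_mul_distrib, Finset.prod_ite_mem, Finset.prod_ite_mem, Finset.prod_const,
          Finset.prod_const, Finset.inter_eq_right.2 hA, Finset.inter_eq_right.2 hF,
          ← Real.exp_nat_mul]
        congr 2
        ring

theorem measureReal_le_integral {S : Set (SimpleGraph (Fin n))} {f : SimpleGraph (Fin n) → ℝ}
    (hf : ∀ G, 0 ≤ f G) (h : ∀ G ∈ S, 1 ≤ f G) :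
    (SimpleGraph.binomialRandom (Fin n) p).real S ≤
      ∫ G, f G ∂(SimpleGraph.binomialRandom (Fin n) p) := by
  rw [← integral_indicator_one (Set.toFinite S).measurableSet]
  refine integral_mono Integrable.of_finite Integrable.of_finite fun G => ?_
  by_cases hG : G ∈ S
  · rw [Set.indicator_of_mem hG]
    exact h G hG
  · rw [Set.indicator_of_notMem hG]
    exact hf G

open Classical in
/-- Chernoff bound for the number of edges among the pairs in `P`, on the event that the pairs
in `A` are edges. -/
theorem binomialRandom_chernoff {A P : Finset (Fin n × Fin n)}
    (hdiag : ∀ x ∈ A ∪ P, x.1 ≠ x.2)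
    (hinj : ∀ x ∈ A ∪ P, ∀ y ∈ A ∪ P, s(x.1, x.2) = s(y.1, y.2) → x = y)
    (hAP : Disjoint A P) (s a : ℝ) :
    (SimpleGraph.binomialRandom (Fin n) p).real
        {G | (∀ x ∈ A, G.Adj x.1 x.2) ∧ a ≤ s * (P.filter fun x => G.Adj x.1 x.2).card} ≤
      (p : ℝ) ^ A.card * Real.exp (p * (Real.exp s - 1) * P.card - a) := by
  set m : Fin n × Fin n → Sym2 (Fin n) := fun x => s(x.1, x.2) with hm
  have hinjA : Set.InjOn m A := fun x hx y hy h =>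
    hinj x (Finset.mem_union_left _ hx) y (Finset.mem_union_left _ hy) h
  have hinjP : Set.InjOn m P := fun x hx y hy h =>
    hinj x (Finset.mem_union_right _ hx) y (Finset.mem_union_right _ hy) h
  have hmem : ∀ Q : Finset (Fin n × Fin n), Q ⊆ A ∪ P → Q.image m ⊆ allEdges n := by
    intro Q hQ e he
    obtain ⟨x, hx, rfl⟩ := Finset.mem_image.1 he
    simp only [allEdges, hm, Finset.mem_filter, Finset.mem_univ, true_and, Sym2.mk_isDiag_iff]
    exact hdiag x (hQ hx)
  have hdisj : Disjoint (A.image m) (P.image m) := by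
    rw [Finset.disjoint_left]
    intro e he he'
    obtain ⟨x, hx, rfl⟩ := Finset.mem_image.1 he
    obtain ⟨y, hy, hxy⟩ := Finset.mem_image.1 he'
    have := hinj y (Finset.mem_union_right _ hy) x (Finset.mem_union_left _ hx) hxy
    subst this
    exact Finset.disjoint_left.1 hAP hx hy
  have hmain := integral_edges_le (p := p) (A.image m) (P.image m)
    (hmem A Finset.subset_union_left) (hmem P Finset.subset_union_right) hdisj s
  rw [Finset.card_image_of_injOn hinjA, Finset.card_image_of_injOn hinjP] at hmain
  have hcard : ∀ G : SimpleGraph (Fin n), ((P.image m).filter fun e => e ∈ G.edgeSet).card =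
      (P.filter fun x => G.Adj x.1 x.2).card := by
    intro G
    rw [Finset.filter_image, Finset.card_image_of_injOn]
    · rfl
    · exact hinjP.mono fun x hx => (Finset.mem_filter.1 hx).1
  rw [Real.exp_sub, ← mul_div_assoc]
  refine le_trans ?_ (div_le_div_of_nonneg_right hmain (Real.exp_pos a).le)
  rw [← integral_div]
  refine measureReal_le_integral (fun G => ?_) fun G hG => ?_
  · split_ifs <;> positivity
  · have h1 : ∀ e ∈ A.image m, e ∈ G.edgeSet := by
      intro e he
      obtain ⟨x, hx, rfl⟩ := Finset.mem_image.1 he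
      exact hG.1 x hx
    rw [if_pos h1, hcard, ← Real.exp_sub]
    exact Real.one_le_exp (sub_nonneg.2 hG.2)

end BinomialRandom

/-! ### Exchangeability -/

section Exchangeable

variable {n : ℕ} {p : unitInterval} {G : SimpleGraph (Fin n)} (σ : Equiv.Perm (Fin n))

theorem binomialRandom_real_comap (G : SimpleGraph (Fin n)) :
    (SimpleGraph.binomialRandom (Fin n) p).real {G.comap σ} =
      (SimpleGraph.binomialRandom (Fin n) p).real {G} := by
  have : (G.comap σ).edgeSet.ncard = G.edgeSet.ncard :=
    Nat.card_congr (SimpleGraph.Iso.comap σ G).mapEdgeSet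
  rw [measureReal_def, measureReal_def, SimpleGraph.binomialRandom_singleton,
    SimpleGraph.binomialRandom_singleton, this]

theorem integral_comap (f : SimpleGraph (Fin n) → ℝ) :
    ∫ G, f (SimpleGraph.comap σ G) ∂(SimpleGraph.binomialRandom (Fin n) p) =
      ∫ G, f G ∂(SimpleGraph.binomialRandom (Fin n) p) := by
  have := Fintype.ofFinite (SimpleGraph (Fin n))
  rw [integral_binomialRandom, integral_binomialRandom]
  refine Fintype.sum_equiv σ.symm.simpleGraph _ _ fun G => ?_
  rw [← binomialRandom_real_comap σ G]
  rfl

theorem nbr_comap (v : Fin n) : nbr G (σ v) = (nbr (G.comap σ) v).map σ.toEmbedding := by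
  ext u
  rw [Finset.mem_map_equiv, mem_nbr, mem_nbr, SimpleGraph.comap_adj, Equiv.apply_symm_apply]

theorem deg_comap (v : Fin n) : deg (G.comap σ) v = deg G (σ v) := by
  rw [deg, deg, nbr_comap, Finset.card_map]

theorem edgeRate_comap (u v : Fin n) : edgeRate (G.comap σ) u v = edgeRate G (σ u) (σ v) := by
  unfold edgeRate
  rw [deg_comap, deg_comap]
  rfl

theorem totalRate_comap (v : Fin n) : totalRate (G.comap σ) v = totalRate G (σ v) :=
  Fintype.sum_equiv σ _ _ fun u => edgeRate_comap σ u v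

/-- The finishing time is chosen from the function `lonelySum G` alone, so equal functions give
equal choices even on bad graphs. -/
theorem spreadScale_comap : spreadScale (G.comap σ) = spreadScale G := by
  have : lonelySum (G.comap σ) = lonelySum G := by
    ext t
    exact Fintype.sum_equiv σ _ _ fun v => by rw [totalRate_comap]
  rw [spreadScale, spreadScale, finishTime, finishTime, this]

theorem generator_comap (Φ : Finset (Fin n) → ℝ) (I : Finset (Fin n)) :
    generator (G.comap σ) ∅ (fun J => Φ (J.map σ.toEmbedding)) I =
      generator G ∅ Φ (I.map σ.toEmbedding) := by
  rw [generator_eq, generator_eq]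
  have hcompl : (I.map σ.toEmbedding)ᶜ = Iᶜ.map σ.toEmbedding := by
    ext x
    simp [Finset.mem_map_equiv]
  rw [hcompl, Finset.sum_map]
  refine Finset.sum_congr rfl fun x _ => ?_
  congr 1
  · unfold rate
    rw [Finset.sdiff_empty, Finset.sdiff_empty, Finset.sum_map]
    exact Finset.sum_congr rfl fun u _ => edgeRate_comap σ u x
  · rw [Finset.map_insert]

/-- The relabelled expectations solve the backward equation of the relabelled graph, so ODE
uniqueness replaces a relabelling of clocks and contacts. -/
theorem evolve_comap [NeZero n] (Φ : Finset (Fin n) → ℝ) (I : Finset (Fin n)) {t : ℝ}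
    (ht : 0 ≤ t) :
    evolve (G.comap σ) ∅ t (fun J => Φ (J.map σ.toEmbedding)) I =
      evolve G ∅ t Φ (I.map σ.toEmbedding) := by
  have h := eq_evolve (G := G.comap σ) (B := ∅)
    (u := fun t J => evolve G ∅ t Φ (J.map σ.toEmbedding)) (fun t ht => ?_) ht
  · rw [evolve_zero] at h
    exact (congrFun h I).symm
  · rw [hasDerivWithinAt_pi]
    intro J
    rw [generator_comap σ (evolve G ∅ t Φ) J]
    exact (hasDerivWithinAt_pi.1 (hasDerivWithinAt_evolve _ _ Φ ht)) (J.map σ.toEmbedding)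

theorem evolve_univ_comap [NeZero n] (s : Fin n) {t : ℝ} (ht : 0 ≤ t) :
    evolve (G.comap σ) ∅ t (ind fun J => J = Finset.univ) {s} =
      evolve G ∅ t (ind fun J => J = Finset.univ) {σ s} := by
  have h := evolve_comap (G := G) σ (ind fun J => J = Finset.univ) {s} ht
  rw [Finset.map_singleton] at h
  rw [Equiv.coe_toEmbedding] at h
  rw [← h]
  refine congrArg (fun Φ => evolve (G.comap σ) ∅ t Φ {s}) (funext fun J => ?_)
  have : J.map σ.toEmbedding = Finset.univ ↔ J = Finset.univ := by
    rw [← Finset.card_eq_iff_eq_univ, ← Finset.card_eq_iff_eq_univ, Finset.card_map]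
  by_cases hJ : J = Finset.univ
  · rw [ind_of (A := fun J => J = Finset.univ) hJ,
      ind_of (A := fun J => J = Finset.univ) (this.2 hJ)]
  · rw [ind_of_not (A := fun J => J = Finset.univ) hJ,
      ind_of_not (A := fun J => J = Finset.univ) (fun h => hJ (this.1 h))]

/-- Swapping `s` and `v` preserves the law of the graph, so a bound averaged over sources holds for
a fixed source in the mean over the graph. -/
theorem mul_integral_eq_integral_sum {f : Fin n → SimpleGraph (Fin n) → ℝ}
    (hf : ∀ (σ : Equiv.Perm (Fin n)) v G, f v (SimpleGraph.comap σ G) = f (σ v) G) (s : Fin n) :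
    n * ∫ G, f s G ∂(SimpleGraph.binomialRandom (Fin n) p) =
      ∫ G, ∑ v, f v G ∂(SimpleGraph.binomialRandom (Fin n) p) := by
  rw [integral_finsetSum _ fun v _ => Integrable.of_finite]
  have : ∀ v, ∫ G, f v G ∂(SimpleGraph.binomialRandom (Fin n) p) =
      ∫ G, f s G ∂(SimpleGraph.binomialRandom (Fin n) p) := by
    intro v
    rw [← integral_comap (Equiv.swap s v) (f s)]
    simp_rw [hf, Equiv.swap_apply_left]
  rw [Finset.sum_congr rfl fun v _ => this v, Finset.sum_const, Finset.card_univ,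
    Fintype.card_fin, nsmul_eq_mul]

end Exchangeable

/-! ### Typical properties of the binomial random graph -/

section Typical

variable {n : ℕ} {p : unitInterval}

theorem measureReal_exists_le {ι : Type*} (s : Finset ι) {Q : ι → SimpleGraph (Fin n) → Prop}
    {b : ι → ℝ} (h : ∀ i ∈ s, (SimpleGraph.binomialRandom (Fin n) p).real {G | Q i G} ≤ b i) :
    (SimpleGraph.binomialRandom (Fin n) p).real {G | ∃ i ∈ s, Q i G} ≤ ∑ i ∈ s, b i := by
  have : {G | ∃ i ∈ s, Q i G} = ⋃ i ∈ s, {G | Q i G} := by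
    ext G
    simp
  rw [this]
  exact (measureReal_biUnion_finset_le _ _).trans (Finset.sum_le_sum h)

open Classical in
theorem card_filter_adj_product (G : SimpleGraph (Fin n)) (T S : Finset (Fin n)) :
    ((T ×ˢ S).filter fun x => G.Adj x.1 x.2).card = ∑ x ∈ T, (nbr G x ∩ S).card := by
  rw [Finset.card_filter, Finset.sum_product]
  refine Finset.sum_congr rfl fun x _ => ?_
  rw [← Finset.card_filter]
  congr 1
  ext y
  simp [and_comm]

theorem binomialRandom_chernoff_product {T S : Finset (Fin n)} (hTS : Disjoint T S) (s a : ℝ) :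
    (SimpleGraph.binomialRandom (Fin n) p).real
        {G | a ≤ s * ∑ x ∈ T, ((nbr G x ∩ S).card : ℝ)} ≤
      Real.exp (p * (Real.exp s - 1) * (T.card * S.card) - a) := by
  classical
  have hne : ∀ x ∈ T ×ˢ S, x.1 ∈ T ∧ x.2 ∈ S := fun x hx => Finset.mem_product.1 hx
  have h := binomialRandom_chernoff (p := p) (A := ∅) (P := T ×ˢ S) ?_ ?_
    (Finset.disjoint_empty_left _) s a
  · rw [Finset.card_empty, pow_zero, one_mul, Finset.card_product, Nat.cast_mul] at h
    refine le_trans (measureReal_mono fun G hG => ?_) h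
    refine ⟨fun x hx => absurd hx (Finset.notMem_empty x), ?_⟩
    rw [card_filter_adj_product, Nat.cast_sum]
    exact hG
  · intro x hx
    rw [Finset.empty_union] at hx
    exact fun h => Finset.disjoint_left.1 hTS (hne x hx).1 (h ▸ (hne x hx).2)
  · intro x hx y hy hxy
    rw [Finset.empty_union] at hx hy
    rw [Sym2.eq_iff] at hxy
    rcases hxy with h | h
    · exact Prod.ext h.1 h.2
    · exact absurd (h.1 ▸ (hne y hy).2) (Finset.disjoint_left.1 hTS (hne x hx).1)

theorem binomialRandom_chernoff_star {v : Fin n} {S : Finset (Fin n)} (hv : v ∉ S) (s a : ℝ) :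
    (SimpleGraph.binomialRandom (Fin n) p).real {G | a ≤ s * ((nbr G v ∩ S).card : ℝ)} ≤
      Real.exp (p * (Real.exp s - 1) * S.card - a) := by
  have h := binomialRandom_chernoff_product (p := p) (T := {v}) (S := S)
    (Finset.disjoint_singleton_left.2 hv) s a
  simpa using h

theorem nbr_inter_erase (G : SimpleGraph (Fin n)) (v : Fin n) (S : Finset (Fin n)) :
    nbr G v ∩ S.erase v = nbr G v ∩ S := by
  ext u
  simp only [Finset.mem_inter, mem_nbr, Finset.mem_erase]
  exact ⟨fun h => ⟨h.1, h.2.2⟩, fun h => ⟨h.1, h.1.ne', h.2⟩⟩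

/-- Large degrees are unlikely. -/
theorem measureReal_deg_upper_le :
    (SimpleGraph.binomialRandom (Fin n) p).real
        {G | ∃ v ∈ Finset.univ, 8 * (n * p : ℝ) < deg G v} ≤ n * Real.exp (-(6 * (n * p))) := by
  have hp0 : 0 ≤ (p : ℝ) := p.2.1
  refine (measureReal_exists_le _ (b := fun _ => Real.exp (-(6 * (n * p)))) fun v _ => ?_).trans ?_
  · refine le_trans (measureReal_mono fun G hG => ?_) ((binomialRandom_chernoff_star (p := p)
      (Finset.notMem_erase v Finset.univ) 1 (8 * (n * p))).trans (Real.exp_le_exp.2 ?_))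
    · rw [Set.mem_ofPred_eq, nbr_inter_erase, Finset.inter_univ, one_mul]
      exact le_of_lt hG
    · have h1 : ((Finset.univ.erase v).card : ℝ) ≤ n := by
        exact_mod_cast (Finset.card_le_univ _).trans (Fintype.card_fin n).le
      have h2 : Real.exp 1 - 1 ≤ 2 := by linarith [Real.exp_one_lt_d9]
      have h3 : 0 ≤ Real.exp 1 - 1 := by linarith [Real.add_one_le_exp 1]
      calc p * (Real.exp 1 - 1) * ((Finset.univ.erase v).card : ℝ) - 8 * (n * p)
          ≤ p * 2 * n - 8 * (n * p) := by gcongr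
        _ = -(6 * (n * p)) := by ring
  · simp

/-- Small degrees are unlikely. -/
theorem measureReal_deg_lower_le (c₁ : ℝ) {s : ℝ} (hs : 0 ≤ s) :
    (SimpleGraph.binomialRandom (Fin n) p).real
        {G | ∃ v ∈ Finset.univ, deg G v < c₁ * (n * p)} ≤
      n * Real.exp (1 - (1 - Real.exp (-s) - s * c₁) * (n * p)) := by
  have hp0 : 0 ≤ (p : ℝ) := p.2.1
  have hp1 : (p : ℝ) ≤ 1 := p.2.2
  refine (measureReal_exists_le _
    (b := fun _ => Real.exp (1 - (1 - Real.exp (-s) - s * c₁) * (n * p))) fun v _ => ?_).trans ?_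
  · refine le_trans (measureReal_mono fun G hG => ?_) ((binomialRandom_chernoff_star (p := p)
      (Finset.notMem_erase v Finset.univ) (-s) (-(s * (c₁ * (n * p))))).trans
      (Real.exp_le_exp.2 ?_))
    · rw [Set.mem_ofPred_eq, nbr_inter_erase, Finset.inter_univ, neg_mul]
      exact neg_le_neg (mul_le_mul_of_nonneg_left (le_of_lt hG) hs)
    · have h1 : ((Finset.univ.erase v).card : ℝ) = n - 1 := by
        rw [Finset.card_erase_of_mem (Finset.mem_univ v), Finset.card_univ, Fintype.card_fin,
          Nat.cast_sub (Nat.one_le_iff_ne_zero.2 fun h => by subst h; exact v.elim0), Nat.cast_one]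
      rw [h1]
      have h2 : Real.exp (-s) ≤ 1 := Real.exp_le_one_iff.2 (by linarith)
      have h3 := Real.exp_pos (-s)
      -- A node has only `n - 1` possible neighbours; this correction costs the summand `1` in the
      -- exponent.
      have h4 : p * (1 - Real.exp (-s)) ≤ 1 := mul_le_one₀ hp1 (by linarith) (by linarith)
      linarith
  · simp

/-- Many neighbours in a small set are unlikely. -/
theorem measureReal_faulty_le {B : Finset (Fin n)} {ν : ℝ} (hν : 0 < ν)
    (hB : (B.card : ℝ) ≤ Real.exp (-(4 / ν)) * n) :
    (SimpleGraph.binomialRandom (Fin n) p).real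
        {G | ∃ v ∈ Finset.univ, ν * (n * p) < ((nbr G v ∩ B).card : ℝ)} ≤
      n * Real.exp (-(3 * (n * p))) := by
  have hp0 : 0 ≤ (p : ℝ) := p.2.1
  refine (measureReal_exists_le _ (b := fun _ => Real.exp (-(3 * (n * p)))) fun v _ => ?_).trans ?_
  · refine le_trans (measureReal_mono fun G hG => ?_) ((binomialRandom_chernoff_star (p := p)
      (Finset.notMem_erase v B) (4 / ν) (4 / ν * (ν * (n * p)))).trans (Real.exp_le_exp.2 ?_))
    · rw [Set.mem_ofPred_eq, nbr_inter_erase]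
      exact mul_le_mul_of_nonneg_left (le_of_lt hG) (by positivity)
    · have h1 : ((B.erase v).card : ℝ) ≤ Real.exp (-(4 / ν)) * n :=
        le_trans (by exact_mod_cast Finset.card_le_card (Finset.erase_subset v B)) hB
      -- With tilt `4 / ν` the threshold contributes `-4 np`, while the smallness of `B` keeps the
      -- moment term below `np`.
      have h2 : 0 ≤ Real.exp (4 / ν) - 1 := by
        linarith [Real.add_one_le_exp (4 / ν), div_pos four_pos hν]
      calc p * (Real.exp (4 / ν) - 1) * ((B.erase v).card : ℝ) - 4 / ν * (ν * (n * p))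
          ≤ p * (Real.exp (4 / ν) - 1) * (Real.exp (-(4 / ν)) * n) - 4 / ν * (ν * (n * p)) := by
            gcongr
        _ ≤ p * Real.exp (4 / ν) * (Real.exp (-(4 / ν)) * n) - 4 / ν * (ν * (n * p)) := by
            gcongr
            linarith
        _ = -(3 * (n * p)) := by
            rw [Real.exp_neg]
            have := Real.exp_pos (4 / ν)
            field_simp
            ring
  · simp

/-- Sparse cuts between large sets are unlikely. -/
theorem measureReal_cut_le {δ : ℝ} (hδ : 0 < δ) :
    (SimpleGraph.binomialRandom (Fin n) p).real
        {G | ∃ S : Finset (Fin n) × Finset (Fin n), S ∈ Finset.univ ∧ (Disjoint S.1 S.2 ∧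
          δ / 4 * n ≤ S.1.card ∧ δ / 4 * n ≤ S.2.card ∧
          ∑ x ∈ S.2, ((nbr G x ∩ S.1).card : ℝ) < δ ^ 2 / 64 * (n * p) * n)} ≤
      4 ^ n * Real.exp (-(δ ^ 2 / 64 * (n * p) * n)) := by
  have hp0 : 0 ≤ (p : ℝ) := p.2.1
  refine (measureReal_exists_le _
    (b := fun _ => Real.exp (-(δ ^ 2 / 64 * (n * p) * n))) fun S _ => ?_).trans ?_
  · by_cases hS : Disjoint S.1 S.2 ∧ δ / 4 * n ≤ S.1.card ∧ δ / 4 * n ≤ S.2.card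
    · refine le_trans (measureReal_mono fun G hG => ?_) ((binomialRandom_chernoff_product (p := p)
        hS.1.symm (-1) (-(δ ^ 2 / 64 * (n * p) * n))).trans (Real.exp_le_exp.2 ?_))
      · rw [Set.mem_ofPred_eq, neg_one_mul]
        exact neg_le_neg hG.2.2.2.le
      · have h1 : Real.exp (-1) ≤ 1 / 2 := by
          rw [Real.exp_neg, one_div]
          exact inv_anti₀ two_pos (by linarith [Real.add_one_le_exp 1])
        have h2 : (δ / 4 * n) * (δ / 4 * n) ≤ (S.2.card : ℝ) * S.1.card :=
          mul_le_mul hS.2.2 hS.2.1 (by positivity) (by positivity)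
        have h3 : (1 / 2 : ℝ) * ((δ / 4 * n) * (δ / 4 * n)) ≤
            (1 - Real.exp (-1)) * ((S.2.card : ℝ) * S.1.card) :=
          mul_le_mul (by linarith) h2 (by positivity) (by linarith)
        have h4 := mul_le_mul_of_nonneg_left h3 hp0
        linarith
    · have : {G : SimpleGraph (Fin n) | Disjoint S.1 S.2 ∧
          δ / 4 * n ≤ S.1.card ∧ δ / 4 * n ≤ S.2.card ∧
          ∑ x ∈ S.2, ((nbr G x ∩ S.1).card : ℝ) < δ ^ 2 / 64 * (n * p) * n} = ∅ := by
        ext G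
        simp only [Set.mem_ofPred_eq, Set.mem_empty_iff_false, iff_false]
        tauto
      rw [this, measureReal_empty]
      exact (Real.exp_pos _).le
  · rw [Finset.sum_const, nsmul_eq_mul, Finset.card_univ, Fintype.card_prod, Fintype.card_finset,
      Fintype.card_fin, ← mul_pow]
    norm_num

-- The sum of inner degrees counts each edge twice, whereas the Chernoff bound needs each unordered
-- pair once; ordered pairs with `x.1 < x.2` represent them.
open Classical in
theorem card_filter_product_eq_two_mul {R : Fin n → Fin n → Prop} (hsymm : ∀ x y, R x y → R y x)
    (hirr : ∀ x, ¬ R x x) (S : Finset (Fin n)) :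
    ((S ×ˢ S).filter fun x => R x.1 x.2).card =
      2 * (((S ×ˢ S).filter fun x => x.1 < x.2).filter fun x => R x.1 x.2).card := by
  rw [← Finset.card_filter_add_card_filter_not (s := (S ×ˢ S).filter fun x => R x.1 x.2)
    (fun x => x.1 < x.2), two_mul]
  congr 1
  · congr 1
    ext x
    simp only [Finset.mem_filter]
    tauto
  · refine Finset.card_bij (fun x _ => (x.2, x.1)) ?_ ?_ ?_
    · intro x hx
      simp only [Finset.mem_filter, Finset.mem_product] at hx ⊢
      obtain ⟨⟨⟨h1, h2⟩, h3⟩, h4⟩ := hx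
      refine ⟨⟨⟨h2, h1⟩, lt_of_le_of_ne (not_lt.1 h4) fun h => ?_⟩, hsymm _ _ h3⟩
      rw [h] at h3
      exact hirr _ h3
    · intro x _ y _ h
      rw [Prod.ext_iff] at h ⊢
      exact ⟨h.2, h.1⟩
    · intro x hx
      simp only [Finset.mem_filter, Finset.mem_product] at hx
      obtain ⟨⟨⟨h1, h2⟩, h3⟩, h4⟩ := hx
      refine ⟨(x.2, x.1), ?_, rfl⟩
      simp only [Finset.mem_filter, Finset.mem_product]
      exact ⟨⟨⟨h2, h1⟩, hsymm _ _ h4⟩, not_lt.2 h3.le⟩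

/-- Chernoff with tilt `8 / ν`: the threshold gives `4 np` per node of `S`, and the size bound on
`S` keeps the moment term below `np / 2` per node. -/
theorem measureReal_dense_le (S : Finset (Fin n)) {ν : ℝ} (hν : 0 < ν)
    (hS : (S.card : ℝ) ≤ Real.exp (-(8 / ν)) * n) :
    (SimpleGraph.binomialRandom (Fin n) p).real
        {G | ν * (n * p) * S.card < ∑ v ∈ S, ((nbr G v ∩ S).card : ℝ)} ≤
      Real.exp (-(3 * (n * p))) ^ S.card := by
  classical
  have hp0 : 0 ≤ (p : ℝ) := p.2.1
  set P := (S ×ˢ S).filter fun x : Fin n × Fin n => x.1 < x.2 with hP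
  have hlt : ∀ x ∈ P, x.1 < x.2 := fun x hx => (Finset.mem_filter.1 hx).2
  have hcard : (2 : ℝ) * P.card ≤ S.card * S.card := by
    have h := card_filter_product_eq_two_mul (R := fun x y : Fin n => x ≠ y)
      (fun x y h => h.symm) (fun x h => h rfl) S
    have h1 : ((S ×ˢ S).filter fun x => x.1 ≠ x.2).card = 2 * P.card := by
      convert h using 3
      ext x
      simp only [hP, Finset.mem_filter]
      exact ⟨fun h => ⟨h, h.2.ne⟩, fun h => h.1⟩
    have h2 := (Finset.card_filter_le (S ×ˢ S) fun x => x.1 ≠ x.2)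
    rw [h1, Finset.card_product] at h2
    exact_mod_cast h2
  have h := binomialRandom_chernoff (p := p) (A := ∅) (P := P)
    (fun x hx => (hlt x (by simpa using hx)).ne) ?_ (Finset.disjoint_empty_left _) (8 / ν)
    (4 * (n * p) * S.card)
  · rw [Finset.card_empty, pow_zero, one_mul] at h
    refine le_trans (measureReal_mono fun G hG => ?_) (h.trans ?_)
    · refine ⟨fun x hx => absurd hx (Finset.notMem_empty x), ?_⟩
      have h1 := card_filter_product_eq_two_mul (R := G.Adj) (fun x y h => h.symm)
        (fun x => G.irrefl) S
      rw [card_filter_adj_product] at h1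
      have h2 : ∑ v ∈ S, ((nbr G v ∩ S).card : ℝ) =
          2 * (P.filter fun x => G.Adj x.1 x.2).card := by exact_mod_cast h1
      rw [Set.mem_ofPred_eq, h2] at hG
      rw [div_mul_eq_mul_div, le_div_iff₀ hν]
      linarith
    · rw [← Real.exp_nat_mul]
      refine Real.exp_le_exp.2 ?_
      have h1 : p * (Real.exp (8 / ν) - 1) * P.card ≤ n * p * S.card / 2 := by
        calc p * (Real.exp (8 / ν) - 1) * P.card ≤ p * Real.exp (8 / ν) * P.card := by
              gcongr
              linarith
          _ ≤ p * Real.exp (8 / ν) * (S.card * (Real.exp (-(8 / ν)) * n) / 2) := by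
              refine mul_le_mul_of_nonneg_left ?_ (by positivity)
              have := mul_le_mul_of_nonneg_left hS (Nat.cast_nonneg (α := ℝ) S.card)
              linarith
          _ = n * p * S.card / 2 := by
              rw [Real.exp_neg]
              have := Real.exp_pos (8 / ν)
              field_simp
      have h2 : 0 ≤ (n : ℝ) * p * S.card := by positivity
      linarith
  · intro x hx y hy hxy
    rw [Finset.empty_union] at hx hy
    rw [Sym2.eq_iff] at hxy
    rcases hxy with h | h
    · exact Prod.ext h.1 h.2
    · have h1 := hlt x hx
      have h2 := hlt y hy
      rw [h.1, h.2] at h1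
      exact absurd h1 (not_lt.2 h2.le)

/-- Dense small sets are unlikely. -/
theorem measureReal_sparse_le {ν : ℝ} (hν : 0 < ν) :
    (SimpleGraph.binomialRandom (Fin n) p).real
        {G | ∃ S : Finset (Fin n), S ∈ Finset.univ.erase ∅ ∧
          ((S.card : ℝ) ≤ Real.exp (-(8 / ν)) * n ∧
          ν * (n * p) * S.card < ∑ v ∈ S, ((nbr G v ∩ S).card : ℝ))} ≤
      (1 + Real.exp (-(3 * (n * p)))) ^ n - 1 := by
  refine (measureReal_exists_le _
    (b := fun S => Real.exp (-(3 * (n * p))) ^ S.card) fun S _ => ?_).trans ?_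
  · by_cases hS : (S.card : ℝ) ≤ Real.exp (-(8 / ν)) * n
    · exact (measureReal_mono fun G hG => hG.2).trans (measureReal_dense_le S hν hS)
    · have : {G : SimpleGraph (Fin n) | (S.card : ℝ) ≤ Real.exp (-(8 / ν)) * n ∧
          ν * (n * p) * S.card < ∑ v ∈ S, ((nbr G v ∩ S).card : ℝ)} = ∅ := by
        ext G
        simp only [Set.mem_ofPred_eq, Set.mem_empty_iff_false, iff_false]
        tauto
      rw [this, measureReal_empty]
      positivity
  -- The sum of `q ^ S.card` over all sets is `(1 + q) ^ n`; without the empty set it is small as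
  -- soon as `n q` is.
  · have h := Finset.sum_pow_mul_eq_add_pow (Real.exp (-(3 * (n * p)))) 1
      (Finset.univ : Finset (Fin n))
    simp only [one_pow, mul_one, Finset.powerset_univ, Finset.card_univ, Fintype.card_fin] at h
    rw [← Finset.add_sum_erase _ _ (Finset.mem_univ ∅), Finset.card_empty, pow_zero] at h
    rw [add_comm 1 (Real.exp _), ← h]
    linarith

end Typical

/-! ### Neighbours of atypical degree -/

section Atypical

variable {n : ℕ} {p : unitInterval}

/-- The edges from `v` to `W` and those leaving `insert v W` from `W` are disjoint sets of pairs,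
hence independent. The factor `p ^ W.card` later compensates the number of choices of `W`. -/
theorem binomialRandom_chernoff_broom {v : Fin n} {W : Finset (Fin n)} (hv : v ∉ W) (s a : ℝ) :
    (SimpleGraph.binomialRandom (Fin n) p).real
        {G | (∀ w ∈ W, G.Adj v w) ∧ a ≤ s * ∑ w ∈ W, ((nbr G w ∩ (insert v W)ᶜ).card : ℝ)} ≤
      (p : ℝ) ^ W.card *
        Real.exp (p * (Real.exp s - 1) * (W.card * (n - (W.card + 1))) - a) := by
  classical
  set A := ({v} : Finset (Fin n)) ×ˢ W with hA
  set P := W ×ˢ (insert v W)ᶜ with hP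
  have hmA : ∀ x ∈ A, x.1 = v ∧ x.2 ∈ W := fun x hx => by
    rw [hA, Finset.mem_product, Finset.mem_singleton] at hx
    exact hx
  have hmP : ∀ x ∈ P, x.1 ∈ W ∧ x.2 ≠ v ∧ x.2 ∉ W := fun x hx => by
    rw [hP, Finset.mem_product, Finset.mem_compl, Finset.mem_insert, not_or] at hx
    exact hx
  have h := binomialRandom_chernoff (p := p) (A := A) (P := P) ?_ ?_ ?_ s a
  · have hcard : (P.card : ℝ) = W.card * (n - (W.card + 1)) := by
      rw [hP, Finset.card_product, Finset.card_compl, Fintype.card_fin,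
        Finset.card_insert_of_notMem hv, Nat.cast_mul, Nat.cast_sub]
      · push_cast
        ring
      · rw [← Finset.card_insert_of_notMem hv]
        exact (Finset.card_le_univ _).trans (Fintype.card_fin n).le
    have hcardA : A.card = W.card := by
      rw [hA, Finset.card_product, Finset.card_singleton, one_mul]
    rw [hcard, hcardA] at h
    refine le_trans (measureReal_mono fun G hG => ?_) h
    refine ⟨fun x hx => ?_, ?_⟩
    · rw [(hmA x hx).1]
      exact hG.1 _ (hmA x hx).2
    · rw [card_filter_adj_product, Nat.cast_sum]
      exact hG.2
  · intro x hx
    rcases Finset.mem_union.1 hx with hx | hx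
    · have := hmA x hx
      exact fun h => hv (this.1 ▸ h ▸ this.2)
    · have := hmP x hx
      exact fun h => this.2.2 (h ▸ this.1)
  · intro x hx y hy hxy
    rw [Sym2.eq_iff] at hxy
    rcases hxy with h | h
    · exact Prod.ext h.1 h.2
    · exfalso
      rcases Finset.mem_union.1 hx with hx | hx <;> rcases Finset.mem_union.1 hy with hy | hy
      · have h1 := hmA x hx
        have h2 := hmA y hy
        exact hv (h1.1 ▸ h.1 ▸ h2.2)
      · have h1 := hmA x hx
        have h2 := hmP y hy
        exact h2.2.1 (h.1 ▸ h1.1)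
      · have h1 := hmP x hx
        have h2 := hmA y hy
        exact h1.2.1 (h.2.trans h2.1)
      · have h1 := hmP x hx
        have h2 := hmP y hy
        exact h2.2.2 (h.1 ▸ h1.1)
  · rw [Finset.disjoint_left]
    intro x hx hx'
    exact hv ((hmA x hx).1 ▸ (hmP x hx').1)

theorem card_nbr_inter_le (G : SimpleGraph (Fin n)) (w : Fin n) (S : Finset (Fin n)) :
    ((nbr G w ∩ S).card : ℝ) ≤ deg G w := by
  unfold deg
  exact_mod_cast Finset.card_le_card Finset.inter_subset_left

theorem deg_le_card_nbr_inter_compl (G : SimpleGraph (Fin n)) (w : Fin n) (S : Finset (Fin n)) :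
    deg G w ≤ ((nbr G w ∩ Sᶜ).card : ℝ) + S.card := by
  have h : nbr G w ⊆ (nbr G w ∩ Sᶜ) ∪ S := by
    intro x hx
    by_cases hS : x ∈ S
    · exact Finset.mem_union_right _ hS
    · exact Finset.mem_union_left _ (Finset.mem_inter.2 ⟨hx, Finset.mem_compl.2 hS⟩)
  unfold deg
  exact_mod_cast (Finset.card_le_card h).trans (Finset.card_union_le _ _)

/-- At most `W.card + 1` neighbours lie in `insert v W`, which is half of the excess `ε np`; the
other half is an excess of outgoing edges, and the tilt `ε / 4` bounds its probability. -/
theorem measureReal_broom_over_le {v : Fin n} {W : Finset (Fin n)} (hv : v ∉ W) {ε : ℝ}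
    (hε : 0 < ε) (hε1 : ε ≤ 1) (hW : (W.card : ℝ) + 1 ≤ ε / 2 * (n * p)) :
    (SimpleGraph.binomialRandom (Fin n) p).real
        {G | (∀ w ∈ W, G.Adj v w) ∧ ∀ w ∈ W, (1 + ε) * (n * p) < deg G w} ≤
      (p : ℝ) ^ W.card * Real.exp (-(ε ^ 2 / 16 * (n * p))) ^ W.card := by
  have hp0 : 0 ≤ (p : ℝ) := p.2.1
  have hdW : 0 ≤ (n : ℝ) * p * W.card := by positivity
  refine le_trans (measureReal_mono fun G hG => ?_) ((binomialRandom_chernoff_broom (p := p) hv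
    (ε / 4) (ε / 4 * (W.card * ((1 + ε / 2) * (n * p))))).trans
      (mul_le_mul_of_nonneg_left ?_ (by positivity)))
  · refine ⟨hG.1, mul_le_mul_of_nonneg_left ?_ (by positivity)⟩
    rw [← nsmul_eq_mul, ← Finset.sum_const]
    refine Finset.sum_le_sum fun w hw => ?_
    have h1 := deg_le_card_nbr_inter_compl G w (insert v W)
    have h2 := hG.2 w hw
    rw [Finset.card_insert_of_notMem hv, Nat.cast_add, Nat.cast_one] at h1
    linarith
  · rw [← Real.exp_nat_mul]
    refine Real.exp_le_exp.2 ?_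
    have h1 : Real.exp (ε / 4) - 1 ≤ ε / 4 + (ε / 4) ^ 2 := by
      have := (abs_le.1 (Real.abs_exp_sub_one_sub_id_le (x := ε / 4)
        (by rw [abs_of_pos (by positivity)]; linarith))).2
      linarith
    have h2 : 0 ≤ Real.exp (ε / 4) - 1 := by linarith [Real.add_one_le_exp (ε / 4)]
    have h3 : (W.card : ℝ) * (n - (W.card + 1)) ≤ W.card * n :=
      mul_le_mul_of_nonneg_left (by linarith [Nat.cast_nonneg (α := ℝ) W.card])
        (Nat.cast_nonneg _)
    calc p * (Real.exp (ε / 4) - 1) * (W.card * (n - (W.card + 1))) -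
          ε / 4 * (W.card * ((1 + ε / 2) * (n * p)))
        ≤ p * (Real.exp (ε / 4) - 1) * (W.card * n) -
          ε / 4 * (W.card * ((1 + ε / 2) * (n * p))) :=
          sub_le_sub_right (mul_le_mul_of_nonneg_left h3 (mul_nonneg hp0 h2)) _
      _ = (n * p * W.card) * (Real.exp (ε / 4) - 1) -
          ε / 4 * (W.card * ((1 + ε / 2) * (n * p))) := by ring
      _ ≤ (n * p * W.card) * (ε / 4 + (ε / 4) ^ 2) -
          ε / 4 * (W.card * ((1 + ε / 2) * (n * p))) :=
          sub_le_sub_right (mul_le_mul_of_nonneg_left h1 hdW) _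
      _ = W.card * -(ε ^ 2 / 16 * (n * p)) := by ring

theorem measureReal_broom_under_le {v : Fin n} {W : Finset (Fin n)} (hv : v ∉ W) {ε : ℝ}
    (hε : 0 < ε) (hε1 : ε ≤ 1) (hW : (W.card : ℝ) + 1 ≤ ε / 2 * (n * p)) :
    (SimpleGraph.binomialRandom (Fin n) p).real
        {G | (∀ w ∈ W, G.Adj v w) ∧ ∀ w ∈ W, deg G w < (1 - ε) * (n * p)} ≤
      (p : ℝ) ^ W.card * Real.exp (-(ε ^ 2 / 16 * (n * p))) ^ W.card := by
  have hp0 : 0 ≤ (p : ℝ) := p.2.1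
  have hp1 : (p : ℝ) ≤ 1 := p.2.2
  have hd0 : 0 ≤ (n : ℝ) * p := by positivity
  have hdW : 0 ≤ (n : ℝ) * p * W.card := by positivity
  refine le_trans (measureReal_mono fun G hG => ?_) ((binomialRandom_chernoff_broom (p := p) hv
    (-(ε / 4)) (-(ε / 4 * (W.card * ((1 - ε) * (n * p)))))).trans
      (mul_le_mul_of_nonneg_left ?_ (by positivity)))
  · refine ⟨hG.1, ?_⟩
    rw [neg_mul]
    refine neg_le_neg (mul_le_mul_of_nonneg_left ?_ (by positivity))
    rw [← nsmul_eq_mul, ← Finset.sum_const]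
    exact Finset.sum_le_sum fun w hw => (card_nbr_inter_le G w _).trans (hG.2 w hw).le
  · rw [← Real.exp_nat_mul]
    refine Real.exp_le_exp.2 ?_
    have h1 : ε / 4 - (ε / 4) ^ 2 ≤ 1 - Real.exp (-(ε / 4)) := by
      have := (abs_le.1 (Real.abs_exp_sub_one_sub_id_le (x := -(ε / 4))
        (by rw [abs_neg, abs_of_pos (by positivity)]; linarith))).2
      linarith
    have h2 : 0 ≤ ε / 4 - (ε / 4) ^ 2 := by nlinarith
    have h3 : (1 - ε / 2) * (n * p) ≤ p * (n - (W.card + 1)) := by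
      have := mul_le_of_le_one_left (by positivity : 0 ≤ (W.card : ℝ) + 1) hp1
      linarith
    have h4 : (ε / 4 - (ε / 4) ^ 2) * ((1 - ε / 2) * (n * p)) ≤
        (1 - Real.exp (-(ε / 4))) * (p * (n - (W.card + 1))) :=
      mul_le_mul h1 h3 (mul_nonneg (by linarith) hd0) (h2.trans h1)
    have h5 := mul_le_mul_of_nonneg_left h4 (Nat.cast_nonneg (α := ℝ) W.card)
    have h6 : 0 ≤ ε ^ 3 * (n * p * W.card) := by positivity
    nlinarith

/-- More than `ν d` atypical neighbours include `ν d / 2` of too high or too low degree. The union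
over `v` and over at most `n ^ m` sets `W` turns `p ^ m` into `(np) ^ m`. -/
theorem measureReal_atypical_le {ε ν : ℝ} (hε : 0 < ε) (hε1 : ε ≤ 1)
    (hW : (⌈ν * (n * p) / 2⌉₊ : ℝ) + 1 ≤ ε / 2 * (n * p)) :
    (SimpleGraph.binomialRandom (Fin n) p).real
        {G | ∃ v, ν * (n * p) < ((nbr G v \ typical G (n * p) ε).card : ℝ)} ≤
      2 * n * (n * p * Real.exp (-(ε ^ 2 / 16 * (n * p)))) ^ ⌈ν * (n * p) / 2⌉₊ := by
  classical
  have hp0 : 0 ≤ (p : ℝ) := p.2.1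
  set m := ⌈ν * (n * p) / 2⌉₊ with hm
  set b := (p : ℝ) ^ m * Real.exp (-(ε ^ 2 / 16 * (n * p))) ^ m with hb
  have hb0 : 0 ≤ b := by positivity
  set Q : Fin n × Finset (Fin n) → SimpleGraph (Fin n) → Prop := fun x G =>
    (∀ w ∈ x.2, G.Adj x.1 w) ∧ ((∀ w ∈ x.2, (1 + ε) * (n * p) < deg G w) ∨
      ∀ w ∈ x.2, deg G w < (1 - ε) * (n * p)) with hQ
  have hQle : ∀ x ∈ (Finset.univ : Finset (Fin n)) ×ˢ
      Finset.powersetCard m (Finset.univ : Finset (Fin n)),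
      (SimpleGraph.binomialRandom (Fin n) p).real {G | Q x G} ≤ 2 * b := by
    rintro ⟨v, W⟩ hx
    have hWm : W.card = m := (Finset.mem_powersetCard.1 (Finset.mem_product.1 hx).2).2
    by_cases hv : v ∈ W
    · have : {G | Q (v, W) G} = ∅ := by
        ext G
        simp only [hQ, Set.mem_ofPred_eq, Set.mem_empty_iff_false, iff_false]
        exact fun h => G.irrefl (h.1 v hv)
      rw [this, measureReal_empty]
      positivity
    · have h1 := measureReal_broom_over_le (p := p) hv hε hε1 (by rw [hWm]; exact hW)
      have h2 := measureReal_broom_under_le (p := p) hv hε hε1 (by rw [hWm]; exact hW)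
      rw [hWm] at h1 h2
      rw [two_mul]
      refine le_trans (measureReal_mono fun G hG => ?_)
        ((measureReal_union_le _ _).trans (add_le_add h1 h2))
      rcases hG.2 with h | h
      · exact Or.inl ⟨hG.1, h⟩
      · exact Or.inr ⟨hG.1, h⟩
  refine le_trans (measureReal_mono fun G hG => ?_) ((measureReal_exists_le _ hQle).trans ?_)
  · obtain ⟨v, hv⟩ := hG
    set S₁ := (nbr G v).filter fun w => (1 + ε) * (n * p) < deg G w with hS₁
    set S₂ := (nbr G v).filter fun w => deg G w < (1 - ε) * (n * p) with hS₂
    have hsub : nbr G v \ typical G (n * p) ε ⊆ S₁ ∪ S₂ := by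
      intro w hw
      rw [Finset.mem_sdiff, typical, Finset.mem_filter, not_and, not_le] at hw
      have := hw.2 (Finset.mem_univ w)
      rw [lt_abs] at this
      rw [Finset.mem_union, hS₁, hS₂, Finset.mem_filter, Finset.mem_filter]
      rcases this with h | h
      · exact Or.inl ⟨hw.1, by linarith⟩
      · exact Or.inr ⟨hw.1, by linarith⟩
    have hcard : ν * (n * p) < (S₁.card : ℝ) + S₂.card := hv.trans_le (by
      exact_mod_cast (Finset.card_le_card hsub).trans (Finset.card_union_le _ _))
    rcases le_or_gt (ν * (n * p) / 2) (S₁.card : ℝ) with h | h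
    · obtain ⟨W, hWS, hWm⟩ := Finset.exists_subset_card_eq (Nat.ceil_le.2 h)
      refine ⟨(v, W), ?_, fun w hw => ?_, Or.inl fun w hw => ?_⟩
      · exact Finset.mem_product.2 ⟨Finset.mem_univ v,
          Finset.mem_powersetCard.2 ⟨Finset.subset_univ W, hWm⟩⟩
      · exact mem_nbr.1 (Finset.mem_filter.1 (hWS hw)).1
      · exact (Finset.mem_filter.1 (hWS hw)).2
    · have h' : ν * (n * p) / 2 ≤ (S₂.card : ℝ) := by linarith
      obtain ⟨W, hWS, hWm⟩ := Finset.exists_subset_card_eq (Nat.ceil_le.2 h')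
      refine ⟨(v, W), ?_, fun w hw => ?_, Or.inr fun w hw => ?_⟩
      · exact Finset.mem_product.2 ⟨Finset.mem_univ v,
          Finset.mem_powersetCard.2 ⟨Finset.subset_univ W, hWm⟩⟩
      · exact mem_nbr.1 (Finset.mem_filter.1 (hWS hw)).1
      · exact (Finset.mem_filter.1 (hWS hw)).2
  · rw [Finset.sum_const, nsmul_eq_mul, Finset.card_product, Finset.card_powersetCard,
      Finset.card_univ, Fintype.card_fin]
    have h1 : ((n.choose m : ℕ) : ℝ) ≤ (n : ℝ) ^ m := by exact_mod_cast Nat.choose_le_pow n m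
    push_cast
    calc (n : ℝ) * (n.choose m) * (2 * b) ≤ n * (n : ℝ) ^ m * (2 * b) := by gcongr
      _ = 2 * n * (n * p * Real.exp (-(ε ^ 2 / 16 * (n * p)))) ^ m := by
        rw [hb, mul_pow, mul_pow]
        ring

end Atypical

/-! ### The random graph is good -/

section Good

variable {n : ℕ} {p : unitInterval}

theorem four_pow_mul_exp_le {n : ℕ} (hn : (0 : ℝ) < n) {x : ℝ} (hx : 3 ≤ x) :
    4 ^ n * Real.exp (-(x * n)) ≤ 1 / n := by
  have e1 : (4 : ℝ) ≤ Real.exp 2 := by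
    have h := Real.add_one_le_exp (1 : ℝ)
    rw [(by norm_num : (2 : ℝ) = 1 + 1), Real.exp_add]
    nlinarith
  have e2 : (4 : ℝ) ^ n ≤ Real.exp (2 * n) := by
    rw [mul_comm, Real.exp_nat_mul]
    exact pow_le_pow_left₀ (by norm_num) e1 n
  have e3 : Real.exp (-(x * n)) ≤ Real.exp (-(3 * n)) :=
    Real.exp_le_exp.2 (neg_le_neg (mul_le_mul_of_nonneg_right hx hn.le))
  calc 4 ^ n * Real.exp (-(x * n)) ≤ Real.exp (2 * n) * Real.exp (-(3 * n)) := by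
        gcongr
    _ = (Real.exp n)⁻¹ := by
        rw [← Real.exp_add, ← Real.exp_neg]
        congr 1
        ring
    _ ≤ 1 / n := by
        rw [one_div]
        exact inv_anti₀ hn (by linarith [Real.add_one_le_exp (n : ℝ)])

theorem one_add_pow_sub_one_le {n : ℕ} {x : ℝ} (hx : 0 ≤ x) (h : n * x ≤ 1) :
    (1 + x) ^ n - 1 ≤ 2 * (n * x) := by
  have h0 : 0 ≤ n * x := by positivity
  have h1 : (1 + x) ^ n ≤ Real.exp (n * x) := by
    rw [Real.exp_nat_mul]
    refine pow_le_pow_left₀ (by positivity) ?_ n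
    rw [add_comm]
    exact Real.add_one_le_exp _
  have h2 := (abs_le.1 (Real.abs_exp_sub_one_le (x := n * x)
    (by rw [abs_of_nonneg h0]; exact h))).2
  rw [abs_of_nonneg h0] at h2
  linarith

/-- For large `d`, half of the exponent absorbs the factor `d`, and the power then gives an exponent
quadratic in `d`, more than `2 d`. -/
theorem mul_exp_neg_pow_ceil_le {d κ ν : ℝ} (hκ : 0 < κ) (hν : 0 < ν) (hd : 0 < d)
    (hdκ : 8 / κ ^ 2 ≤ d) (hdν : 8 / (κ * ν) ≤ d) :
    (d * Real.exp (-(κ * d))) ^ ⌈ν * d / 2⌉₊ ≤ Real.exp (-((2 : ℕ) * d)) := by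
  have e1 : d ≤ Real.exp (κ * d / 2) := by
    have h := Real.quadratic_le_exp_of_nonneg (by positivity : 0 ≤ κ * d / 2)
    rw [div_le_iff₀ (by positivity)] at hdκ
    have : 8 * d ≤ d * κ ^ 2 * d := mul_le_mul_of_nonneg_right hdκ hd.le
    have : 0 ≤ κ * d := by positivity
    linarith
  have e2 : d * Real.exp (-(κ * d)) ≤ Real.exp (-(κ * d / 2)) := by
    calc d * Real.exp (-(κ * d)) ≤ Real.exp (κ * d / 2) * Real.exp (-(κ * d)) := by gcongr
      _ = _ := by
        rw [← Real.exp_add]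
        congr 1
        ring
  calc (d * Real.exp (-(κ * d))) ^ ⌈ν * d / 2⌉₊
      ≤ Real.exp (-(κ * d / 2)) ^ ⌈ν * d / 2⌉₊ := pow_le_pow_left₀ (by positivity) e2 _
    _ = Real.exp (-(κ * d / 2 * ⌈ν * d / 2⌉₊)) := by
      rw [← Real.exp_nat_mul]
      congr 1
      ring
    _ ≤ Real.exp (-((2 : ℕ) * d)) := by
      refine Real.exp_le_exp.2 (neg_le_neg ?_)
      have h := Nat.le_ceil (ν * d / 2)
      have h' := mul_le_mul_of_nonneg_left h (by positivity : 0 ≤ κ * d / 2)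
      rw [div_le_iff₀ (by positivity)] at hdν
      have h'' := mul_le_mul_of_nonneg_right hdν hd.le
      push_cast
      linarith

/-- The probability that the random graph does not have the degree, sparsity and expansion
properties. -/
theorem measureReal_not_goodGraph_le {B : Finset (Fin n)} {c₁ ε ν δ s ξ : ℝ} (hn : 2 ≤ n)
    (hε : 0 < ε) (hε1 : ε ≤ 1) (hν : 0 < ν) (hνε : ν ≤ ε / 2) (hδ : δ = Real.exp (-(8 / ν)))
    (hs : 0 ≤ s) (hlog : Real.log n ≤ n * p)
    (hlow : (1 + ξ) * Real.log n ≤ (1 - Real.exp (-s) - s * c₁) * (n * p))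
    (hdε : 8 / ε ≤ n * p) (hdκ : 8 / (ε ^ 2 / 16) ^ 2 ≤ n * p)
    (hdν : 8 / (ε ^ 2 / 16 * ν) ≤ n * p) (hdδ : 3 ≤ δ ^ 2 / 64 * (n * p))
    (hB : (B.card : ℝ) ≤ Real.exp (-(4 / ν)) * n) :
    (SimpleGraph.binomialRandom (Fin n) p).real
        {G | ¬ GoodGraph G B (n * p) c₁ 8 ε ν δ (δ ^ 2 / 64)} ≤
      7 / n + Real.exp (1 - ξ * Real.log n) := by
  have hn0 : (0 : ℝ) < n := by exact_mod_cast (by omega : 0 < n)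
  have hd : 0 < (n : ℝ) * p := lt_of_lt_of_le (by positivity) hdε
  have hδ0 : 0 < δ := hδ ▸ Real.exp_pos _
  set d := (n : ℝ) * p with hd_def
  set κ := ε ^ 2 / 16 with hκ
  have hκ0 : 0 < κ := by positivity
  -- As `d ≥ log n`, one has `n q ≤ 1`; most error terms below are `n` times a power of `q` with
  -- exponent at least `2`, hence `O(1 / n)`.
  set q := Real.exp (-d) with hq
  have hq0 : 0 < q := Real.exp_pos _
  have hnq : n * q ≤ 1 := by
    rw [← Real.exp_log hn0, hq, ← Real.exp_add]
    exact Real.exp_le_one_iff.2 (by linarith)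
  have hq1 : q ≤ 1 := Real.exp_le_one_iff.2 (by linarith)
  have hqn : q ≤ 1 / n := by rw [le_div_iff₀ hn0]; linarith
  have hqpow : ∀ k : ℕ, Real.exp (-(k * d)) = q ^ k := fun k => by
    rw [hq, ← Real.exp_nat_mul]
    congr 1
    ring
  have hnqpow : ∀ k : ℕ, n * q ^ (k + 2) ≤ 1 / n := fun k => by
    calc n * q ^ (k + 2) = (n * q) * (q ^ k * q) := by ring
      _ ≤ 1 * (1 * q) := by
          refine mul_le_mul hnq ?_ (by positivity) zero_le_one
          exact mul_le_mul_of_nonneg_right (pow_le_one₀ hq0.le hq1) hq0.le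
      _ ≤ 1 / n := by rw [one_mul, one_mul]; exact hqn
  have h1 := measureReal_deg_upper_le (n := n) (p := p)
  have h2 := measureReal_deg_lower_le (n := n) (p := p) c₁ hs
  have h3 := measureReal_faulty_le (p := p) hν hB
  have h4 := measureReal_cut_le (n := n) (p := p) hδ0
  have h5 := measureReal_sparse_le (n := n) (p := p) hν
  have hm : (⌈ν * d / 2⌉₊ : ℝ) + 1 ≤ ε / 2 * d := by
    have h := (Nat.ceil_lt_add_one (by positivity : 0 ≤ ν * d / 2)).le
    have h' : 8 ≤ ε * d := by rwa [div_le_iff₀ hε, mul_comm] at hdε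
    have h'' : ν * d ≤ ε / 2 * d := mul_le_mul_of_nonneg_right hνε hd.le
    linarith
  have h6 := measureReal_atypical_le (n := n) (p := p) hε hε1 hm
  rw [← hδ] at h5
  rw [← hd_def] at h1 h2 h3 h4 h5 h6
  have b1 : n * Real.exp (-(6 * d)) ≤ 1 / n := by
    have := hqpow 6
    push_cast at this
    rw [this]
    exact hnqpow 4
  -- The minimum degree is the critical event: its exponent beats `log n` only by `ξ log n`, and
  -- this margin comes from `c > 1`.
  have b2 : n * Real.exp (1 - (1 - Real.exp (-s) - s * c₁) * d) ≤
      Real.exp (1 - ξ * Real.log n) := by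
    conv_lhs => rw [← Real.exp_log hn0]
    rw [← Real.exp_add]
    exact Real.exp_le_exp.2 (by linarith)
  have b3 : n * Real.exp (-(3 * d)) ≤ 1 / n := by
    have := hqpow 3
    push_cast at this
    rw [this]
    exact hnqpow 1
  have b4 : 4 ^ n * Real.exp (-(δ ^ 2 / 64 * d * n)) ≤ 1 / n :=
    four_pow_mul_exp_le hn0 hdδ
  have b5 : (1 + Real.exp (-(3 * d))) ^ n - 1 ≤ 2 / n := by
    have := hqpow 3
    push_cast at this
    rw [this]
    refine (one_add_pow_sub_one_le (by positivity) ((hnqpow 1).trans ?_)).trans ?_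
    · rw [div_le_one hn0]
      exact_mod_cast (by omega : 1 ≤ n)
    · calc (2 : ℝ) * (n * q ^ 3) ≤ 2 * (1 / n) :=
            mul_le_mul_of_nonneg_left (hnqpow 1) zero_le_two
        _ = 2 / n := by ring
  have b6 : 2 * n * (d * Real.exp (-(κ * d))) ^ ⌈ν * d / 2⌉₊ ≤ 2 / n := by
    have e3 := (mul_exp_neg_pow_ceil_le hκ0 hν hd hdκ hdν).trans_eq (hqpow 2)
    calc 2 * n * (d * Real.exp (-(κ * d))) ^ ⌈ν * d / 2⌉₊ ≤ 2 * n * q ^ 2 := by gcongr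
      _ = 2 * (n * q ^ 2) := by ring
      _ ≤ 2 * (1 / n) := mul_le_mul_of_nonneg_left (hnqpow 0) (by norm_num)
      _ = 2 / n := by ring
  have hunion : {G : SimpleGraph (Fin n) | ¬ GoodGraph G B d c₁ 8 ε ν δ (δ ^ 2 / 64)} ⊆
      ((((({G | ∃ v ∈ Finset.univ, 8 * d < deg G v} ∪
        {G | ∃ v ∈ Finset.univ, deg G v < c₁ * d}) ∪
        {G | ∃ v ∈ Finset.univ, ν * d < ((nbr G v ∩ B).card : ℝ)}) ∪
        {G | ∃ S : Finset (Fin n) × Finset (Fin n), S ∈ Finset.univ ∧ (Disjoint S.1 S.2 ∧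
          δ / 4 * n ≤ S.1.card ∧ δ / 4 * n ≤ S.2.card ∧
          ∑ x ∈ S.2, ((nbr G x ∩ S.1).card : ℝ) < δ ^ 2 / 64 * d * n)}) ∪
        {G | ∃ S : Finset (Fin n), S ∈ Finset.univ.erase ∅ ∧
          ((S.card : ℝ) ≤ δ * n ∧ ν * d * S.card < ∑ v ∈ S, ((nbr G v ∩ S).card : ℝ))}) ∪
        {G | ∃ v, ν * d < ((nbr G v \ typical G d ε).card : ℝ)}) := by
    intro G hG
    by_contra hcon
    simp only [Set.mem_union, Set.mem_ofPred_eq, not_or] at hcon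
    obtain ⟨⟨⟨⟨⟨g1, g2⟩, g3⟩, g4⟩, g5⟩, g6⟩ := hcon
    push Not at g1 g2 g3 g6
    refine hG ⟨fun v => g2 v (Finset.mem_univ v), fun v => g1 v (Finset.mem_univ v), ?_,
      fun v => g3 v (Finset.mem_univ v), g6, ?_⟩
    · intro S hS
      by_contra hlt
      rw [not_le] at hlt
      refine g5 ⟨S, Finset.mem_erase.2 ⟨fun h => ?_, Finset.mem_univ S⟩, hS, hlt⟩
      subst h
      simp at hlt
    · intro S S' hdis hS hS'
      by_contra hlt
      rw [not_le] at hlt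
      exact g4 ⟨(S, S'), Finset.mem_univ _, hdis, hS, hS', hlt⟩
  refine (measureReal_mono hunion).trans ?_
  have hsum := (measureReal_union_le _ _).trans (add_le_add ((measureReal_union_le _ _).trans
    (add_le_add ((measureReal_union_le _ _).trans (add_le_add ((measureReal_union_le _ _).trans
    (add_le_add ((measureReal_union_le _ _).trans (add_le_add h1 h2)) h3)) h4)) h5)) h6)
  refine hsum.trans ?_
  have hseven : (7 : ℝ) / n = 1 / n + 1 / n + 1 / n + 2 / n + 2 / n := by ring
  rw [hseven]
  linarith

end Good

/-! ### Concentration on the random graph -/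

theorem GoodGraph.empty_faulty {n : ℕ} {G : SimpleGraph (Fin n)} {B : Finset (Fin n)}
    {d c₁ D ε ν δ γ : ℝ} (h : GoodGraph G B d c₁ D ε ν δ γ) (hνd : 0 ≤ ν * d) :
    GoodGraph G ∅ d c₁ D ε ν δ γ where
  deg_lower := h.deg_lower
  deg_upper := h.deg_upper
  sparse := h.sparse
  faulty v := by simpa using hνd
  atypical := h.atypical
  cut := h.cut

/-- The probability that the rumor has reached everybody clearly before the asymptotic spreading
time. -/
noncomputable def earlyProb {n : ℕ} (θ : ℝ) (s : Fin n) (G : SimpleGraph (Fin n)) : ℝ :=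
  evolve G ∅ ((1 - θ) * max 0 (spreadScale G)) (ind fun J => J = Finset.univ) {s}

/-! ### From the average over sources to a fixed source -/

section Average

variable {n : ℕ} {p : unitInterval} {θ : ℝ}

/-- The truncation at `0` in `earlyProb` makes it a probability on every graph, including those
where `finishTime` has no useful value; averaging over all graphs needs this. -/
theorem earlyTime_nonneg (hθ1 : θ ≤ 1) (G : SimpleGraph (Fin n)) :
    0 ≤ (1 - θ) * max 0 (spreadScale G) := mul_nonneg (by linarith) (le_max_left _ _)

theorem earlyProb_nonneg (hθ1 : θ ≤ 1) (s : Fin n) (G : SimpleGraph (Fin n)) :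
    0 ≤ earlyProb θ s G :=
  evolve_nonneg (earlyTime_nonneg hθ1 G) fun J _ => ind_nonneg _ J

variable [NeZero n]

theorem earlyProb_le_one (hθ1 : θ ≤ 1) (s : Fin n) (G : SimpleGraph (Fin n)) :
    earlyProb θ s G ≤ 1 :=
  evolve_ind_le_one (earlyTime_nonneg hθ1 G)

theorem earlyProb_comap (hθ1 : θ ≤ 1) (σ : Equiv.Perm (Fin n)) (s : Fin n)
    (G : SimpleGraph (Fin n)) :
    earlyProb θ s (SimpleGraph.comap σ G) = earlyProb θ (σ s) G := by
  unfold earlyProb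
  rw [spreadScale_comap, evolve_univ_comap σ s (earlyTime_nonneg hθ1 G)]

/-- Exchangeability replaces the fixed source by the average; bad graphs contribute at most their
probability. -/
theorem integral_earlyProb_le (hθ1 : θ ≤ 1) {Good : SimpleGraph (Fin n) → Prop} {ℓ b : ℝ}
    (hℓ0 : 0 ≤ ℓ) (hℓ : ∀ G, Good G → ∑ s, earlyProb θ s G ≤ n * ℓ)
    (hb : (SimpleGraph.binomialRandom (Fin n) p).real {G | ¬ Good G} ≤ b) (s : Fin n) :
    ∫ G, earlyProb θ s G ∂(SimpleGraph.binomialRandom (Fin n) p) ≤ ℓ + b := by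
  classical
  have hn : (0 : ℝ) < n := by exact_mod_cast Nat.pos_of_ne_zero (NeZero.ne n)
  have h1 := mul_integral_eq_integral_sum (p := p) (f := fun s G => earlyProb θ s G)
    (fun σ v G => earlyProb_comap hθ1 σ v G) s
  have h2 : ∫ G, ∑ v, earlyProb θ v G ∂(SimpleGraph.binomialRandom (Fin n) p) ≤
      ∫ G, (n * ℓ + n * {G | ¬ Good G}.indicator 1 G)
        ∂(SimpleGraph.binomialRandom (Fin n) p) := by
    refine integral_mono Integrable.of_finite Integrable.of_finite fun G => ?_
    by_cases hG : Good G
    · rw [Set.indicator_of_notMem (by simpa using hG), mul_zero, add_zero]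
      exact hℓ G hG
    · rw [Set.indicator_of_mem (by simpa using hG), Pi.one_apply, mul_one]
      refine le_trans (Finset.sum_le_sum fun v _ => earlyProb_le_one hθ1 v G) ?_
      rw [Finset.sum_const, Finset.card_univ, Fintype.card_fin, nsmul_eq_mul, mul_one]
      exact le_add_of_nonneg_left (by positivity)
  rw [integral_add Integrable.of_finite Integrable.of_finite, integral_const, integral_const_mul,
    integral_indicator_one (Set.toFinite _).measurableSet, probReal_univ, one_smul] at h2
  have h3 : (n : ℝ) * ∫ G, earlyProb θ s G ∂(SimpleGraph.binomialRandom (Fin n) p) ≤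
      n * (ℓ + b) := by
    rw [h1]
    refine h2.trans ?_
    rw [mul_add]
    gcongr
  exact le_of_mul_le_mul_left h3 hn

theorem measureReal_lt_earlyProb_le (hθ : 0 < θ) (hθ1 : θ ≤ 1)
    {Good : SimpleGraph (Fin n) → Prop} {ℓ b : ℝ}
    (hℓ0 : 0 ≤ ℓ) (hℓ : ∀ G, Good G → ∑ s, earlyProb θ s G ≤ n * ℓ)
    (hb : (SimpleGraph.binomialRandom (Fin n) p).real {G | ¬ Good G} ≤ b) (s : Fin n) :
    (SimpleGraph.binomialRandom (Fin n) p).real {G | θ < earlyProb θ s G} ≤ (ℓ + b) / θ := by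
  refine (measureReal_le_integral (f := fun G => earlyProb θ s G / θ)
    (fun G => div_nonneg (earlyProb_nonneg hθ1 s G) hθ.le) fun G hG => ?_).trans ?_
  · rw [one_le_div hθ]
    exact le_of_lt hG
  · rw [integral_div]
    exact div_le_div_of_nonneg_right (integral_earlyProb_le hθ1 hℓ0 hℓ hb s) hθ.le

end Average

/-- The event that both the expected spreading time and the spreading time with faulty nodes are
finite and differ by a factor of at most `1 ± ε`. -/
def Close {n : ℕ} (s : Fin n) (ε : ℝ) (G : SimpleGraph (Fin n)) (B : Finset (Fin n))
    (ω : Waits n × Contacts n) : Prop :=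
  expectedSpreadTime s G ≠ ∞ ∧ spreadTime s B ω ≠ ∞ ∧
    |(spreadTime s B ω).toReal - (expectedSpreadTime s G).toReal| ≤
      ε * (expectedSpreadTime s G).toReal

theorem Close.mono {n : ℕ} {s : Fin n} {ε ε' : ℝ} {G : SimpleGraph (Fin n)}
    {B : Finset (Fin n)} {ω : Waits n × Contacts n} (h : Close s ε G B ω) (hε : ε ≤ ε') :
    Close s ε' G B ω :=
  ⟨h.1, h.2.1, h.2.2.trans (mul_le_mul_of_nonneg_right hε ENNReal.toReal_nonneg)⟩

/-! ### Averaging over the faulty set and over the graph -/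

section Joint

variable {n : ℕ} {p : unitInterval} {β : PMF (Finset (Fin n))}

theorem sum_pmf (β : PMF (Finset (Fin n))) : ∑ B, β B = 1 := by
  have h := β.tsum_coe
  rwa [tsum_fintype] at h

theorem jointProb_mono {A A' : SimpleGraph (Fin n) → Finset (Fin n) → Waits n × Contacts n → Prop}
    (h : ∀ G B ω, A G B ω → A' G B ω) : jointProb p β A ≤ jointProb p β A' := by
  refine lintegral_mono fun G => Finset.sum_le_sum fun B _ => ?_
  gcongr
  exact h G B _

theorem jointProb_le_one
    (A : SimpleGraph (Fin n) → Finset (Fin n) → Waits n × Contacts n → Prop) :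
    jointProb p β A ≤ 1 := by
  calc jointProb p β A ≤ ∫⁻ _, 1 ∂(SimpleGraph.binomialRandom (Fin n) p) := by
        refine lintegral_mono fun G => ?_
        rw [← sum_pmf β]
        exact Finset.sum_le_sum fun B _ => mul_le_of_le_one_right' prob_le_one
    _ = 1 := by simp

/-- The faulty set is independent of the graph, so it can be fixed first; sets outside `S`, the too
large ones in the application, cost at most `y`. -/
theorem le_jointProb {A : SimpleGraph (Fin n) → Finset (Fin n) → Waits n × Contacts n → Prop}
    {S : Set (Finset (Fin n))} {x y : ℝ≥0∞} (hS : β.toOuterMeasure Sᶜ ≤ y)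
    (h : ∀ B ∈ S, B ∈ β.support → x ≤
      ∫⁻ G, protocolLaw G {ω | A G B ω} ∂(SimpleGraph.binomialRandom (Fin n) p)) :
    (1 - y) * x ≤ jointProb p β A := by
  classical
  have hmeas : ∀ f : SimpleGraph (Fin n) → ℝ≥0∞, Measurable f := fun f => measurable_of_finite f
  unfold jointProb
  rw [lintegral_finsetSum _ fun B _ => hmeas _]
  have h1 : ∑ B ∈ Finset.univ.filter (· ∈ S), β B + β.toOuterMeasure Sᶜ = 1 := by
    rw [PMF.toOuterMeasure_apply_fintype, ← sum_pmf β, Finset.sum_filter,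
      ← Finset.sum_add_distrib]
    refine Finset.sum_congr rfl fun B _ => ?_
    by_cases hB : B ∈ S <;> simp [hB]
  have h2 : 1 - y ≤ ∑ B ∈ Finset.univ.filter (· ∈ S), β B := by
    rw [tsub_le_iff_right, ← h1]
    gcongr
  calc (1 - y) * x ≤ (∑ B ∈ Finset.univ.filter (· ∈ S), β B) * x := by gcongr
    _ = ∑ B ∈ Finset.univ.filter (· ∈ S), β B * x := Finset.sum_mul _ _ _
    _ ≤ ∑ B ∈ Finset.univ.filter (· ∈ S), ∫⁻ G, β B * protocolLaw G {ω | A G B ω}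
          ∂(SimpleGraph.binomialRandom (Fin n) p) := by
        refine Finset.sum_le_sum fun B hB => ?_
        rw [lintegral_const_mul _ (hmeas _)]
        by_cases hsupp : B ∈ β.support
        · gcongr
          exact h B (Finset.mem_filter.1 hB).2 hsupp
        · rw [PMF.mem_support_iff, not_not] at hsupp
          rw [hsupp, zero_mul]
          exact zero_le
    _ ≤ _ := Finset.sum_le_sum_of_subset (Finset.filter_subset _ _)

/-- The spreading time with a given set of faulty nodes is close to the expected spreading time
with high probability, over the random graph and the protocol. -/
theorem le_lintegral_close [NeZero n] {s : Fin n} {B : Finset (Fin n)} {θ : ℝ} (hθ : 0 < θ)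
    (hθ1 : θ ≤ 1 / 20) (hsB : s ∉ B) {Good : Finset (Fin n) → SimpleGraph (Fin n) → Prop}
    {ℓ b : ℝ} (hscale : ∀ G, Good ∅ G → 0 < spreadScale G) (hempty : ∀ G, Good B G → Good ∅ G)
    (hup : ∀ B' G I, Good B' G → (I \ B').Nonempty →
      evolve G B' ((1 + 9 * θ) * spreadScale G) (ind fun J => J ≠ Finset.univ) I ≤ θ)
    (hℓ0 : 0 ≤ ℓ) (hlow : ∀ G, Good ∅ G →
      ∑ v, evolve G ∅ ((1 - θ) * spreadScale G) (ind fun J => J = Finset.univ) {v} ≤ n * ℓ)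
    (hb : (SimpleGraph.binomialRandom (Fin n) p).real {G | ¬ Good B G} ≤ b)
    (hx : b + (ℓ + b) / θ ≤ θ) :
    ENNReal.ofReal (1 - 3 * θ) ≤
      ∫⁻ G, protocolLaw G {ω | Close s (20 * θ) G B ω}
        ∂(SimpleGraph.binomialRandom (Fin n) p) := by
  set μ := SimpleGraph.binomialRandom (Fin n) p with hμ
  have hmax : ∀ G, Good ∅ G → max 0 (spreadScale G) = spreadScale G := fun G hG =>
    max_eq_right (hscale G hG).le
  have hlow' : ∀ G, Good B G → ∑ v, earlyProb θ v G ≤ n * ℓ := by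
    intro G hG
    unfold earlyProb
    rw [hmax G (hempty G hG)]
    exact hlow G (hempty G hG)
  have hearly := measureReal_lt_earlyProb_le (p := p) hθ (by linarith) hℓ0 hlow' hb s
  set S := {G | ¬ Good B G} ∪ {G | θ < earlyProb θ s G} with hS
  have hSle : μ.real S ≤ θ :=
    (measureReal_union_le _ _).trans ((add_le_add hb hearly).trans hx)
  have hSc : ENNReal.ofReal (1 - θ) ≤ μ Sᶜ := by
    rw [← ofReal_measureReal, measureReal_compl (Set.toFinite S).measurableSet, probReal_univ]
    exact ENNReal.ofReal_le_ofReal (by linarith)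
  have hG : ∀ G ∈ Sᶜ, ENNReal.ofReal (1 - 2 * θ) ≤
      protocolLaw G {ω | Close s (20 * θ) G B ω} := by
    -- On such a graph the upper bound is used twice: without faults from every start, to control
    -- the expectation, and with `B` from `s`.
    intro G hG
    rw [hS, Set.compl_union] at hG
    have hgood : Good B G := not_not.1 hG.1
    have hz : earlyProb θ s G ≤ θ := not_lt.1 hG.2
    have hgood' := hempty G hgood
    refine le_protocolLaw_concentrated (hscale G hgood') hθ hθ1 (fun I hI => ?_)
      (hup B G {s} hgood ?_) ?_
    · exact hup ∅ G I hgood' (by rwa [Finset.sdiff_empty])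
    · exact ⟨s, Finset.mem_sdiff.2 ⟨Finset.mem_singleton_self s, hsB⟩⟩
    · unfold earlyProb at hz
      rwa [hmax G hgood'] at hz
  calc ENNReal.ofReal (1 - 3 * θ) ≤ ENNReal.ofReal ((1 - 2 * θ) * (1 - θ)) :=
        ENNReal.ofReal_le_ofReal (by nlinarith)
    _ = ENNReal.ofReal (1 - 2 * θ) * ENNReal.ofReal (1 - θ) :=
        ENNReal.ofReal_mul (by linarith)
    _ ≤ ENNReal.ofReal (1 - 2 * θ) * μ Sᶜ := by gcongr
    _ = ∫⁻ _ in Sᶜ, ENNReal.ofReal (1 - 2 * θ) ∂μ := by rw [setLIntegral_const]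
    _ ≤ ∫⁻ G in Sᶜ, protocolLaw G {ω | Close s (20 * θ) G B ω} ∂μ :=
        setLIntegral_mono' (Set.toFinite _).measurableSet hG
    _ ≤ _ := setLIntegral_le_lintegral _ _

end Joint

/-- A diagonal argument. -/
theorem exists_tendsto_zero_of_eventually {P : ℕ+ → ℝ → Prop}
    (hmono : ∀ n θ θ', θ ≤ θ' → P n θ → P n θ') (h : ∀ θ, 0 < θ → ∀ᶠ n in atTop, P n θ) :
    ∃ ε : ℕ+ → ℝ, Tendsto ε atTop (𝓝 0) ∧ ∀ᶠ n in atTop, P n (ε n) := by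
  set S : ℕ+ → Set ℝ := fun n => {θ | 0 < θ ∧ P n θ} with hS
  have hbdd : ∀ n, BddBelow (S n) := fun n => ⟨0, fun θ hθ => hθ.1.le⟩
  have hinv : Tendsto (fun n : ℕ+ => (1 : ℝ) / n) atTop (𝓝 0) := by
    have h1 : Tendsto (fun n : ℕ+ => (n : ℕ)) atTop atTop :=
      tendsto_atTop_mono (fun n => le_rfl) tendsto_PNat_val_atTop_atTop
    exact (tendsto_one_div_atTop_nhds_zero_nat (𝕜 := ℝ)).comp h1
  have hpos : ∀ n : ℕ+, (0 : ℝ) < 1 / n := fun n => by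
    have : (0 : ℝ) < n := by exact_mod_cast n.pos
    positivity
  -- The infimum of the admissible errors need not be admissible; the extra `1 / n` leaves an
  -- admissible one below.
  refine ⟨fun n => sInf (S n) + 1 / n, ?_, ?_⟩
  · have h0 : Tendsto (fun n => sInf (S n)) atTop (𝓝 0) := by
      rw [Metric.tendsto_atTop']
      intro a ha
      obtain ⟨N, hN⟩ := eventually_atTop.1 (h (a / 2) (by positivity))
      refine ⟨N, fun n hn => ?_⟩
      have h1 : sInf (S n) ≤ a / 2 := csInf_le (hbdd n) ⟨by positivity, hN n hn.le⟩
      have h2 : 0 ≤ sInf (S n) := Real.sInf_nonneg fun θ hθ => hθ.1.le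
      rw [Real.dist_eq, sub_zero, abs_of_nonneg h2]
      linarith
    simpa using h0.add hinv
  · filter_upwards [h 1 one_pos] with n hn
    obtain ⟨θ, hθ, hlt⟩ := exists_lt_of_csInf_lt (⟨1, one_pos, hn⟩ : (S n).Nonempty)
      (lt_add_of_pos_right (sInf (S n)) (hpos n))
    exact hmono n _ _ hlt.le hθ.2

/-! ### Choice of the constants and the limit -/

/-- The Chernoff exponent for a degree below `c₁ np` is `(1 - exp (-s) - s c₁) np`. Large `s` and
then small `c₁` bring its factor to `(c + 1) / (2 c)`; multiplied by `c` this exceeds `1` by `ξ = (c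
- 1) / 2`. -/
theorem exists_degree_constants {c : ℝ} (hc : 1 < c) :
    ∃ s c₁ ξ : ℝ, 0 ≤ s ∧ 0 < c₁ ∧ 0 < ξ ∧ 0 ≤ 1 - Real.exp (-s) - s * c₁ ∧
      1 + ξ = (1 - Real.exp (-s) - s * c₁) * c := by
  have hc0 : 0 < c := by linarith
  have hx : 1 < 4 * c / (c - 1) := by
    rw [lt_div_iff₀ (by linarith)]
    linarith
  set s := Real.log (4 * c / (c - 1)) with hs
  have hs0 : 0 < s := Real.log_pos hx
  have hexp : Real.exp (-s) = (c - 1) / (4 * c) := by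
    rw [Real.exp_neg, hs, Real.exp_log (by linarith), inv_div]
  have hval : 1 - Real.exp (-s) - s * ((c - 1) / (4 * c * s)) = (c + 1) / (2 * c) := by
    rw [hexp]
    field_simp
    ring
  refine ⟨s, (c - 1) / (4 * c * s), (c - 1) / 2, hs0.le,
    div_pos (by linarith) (by positivity), by linarith, ?_, ?_⟩
  · rw [hval]
    positivity
  · rw [hval]
    field_simp
    ring

/-- The order of choice matters: `ν₂` from `θ` and `c₁`, then `K` from `ν₂`, then `ν` small compared
with all of them. The constant `8` is the factor in the upper degree bound. -/
theorem exists_spread_constants {c₁ θ : ℝ} (hc₁ : 0 < c₁) (hθ : 0 < θ) :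
    ∃ ν₂ K ν : ℝ, 0 < ν₂ ∧ 1 ≤ K ∧ 0 < ν ∧ 2 * (ν₂ + ν) / c₁ ≤ θ / 4 ∧ ν ≤ c₁ / 4 ∧
      4 * (8 + 3) / ν₂ / θ + 1 ≤ Real.log K ∧ 6 * K * ν < ν₂ ∧ ν ≤ θ / 200 ∧
      2 * ν * (2 + 8 / c₁) / c₁ ≤ θ / 20 := by
  set ν₂ := θ * c₁ / 32 with hν₂
  have hν₂0 : 0 < ν₂ := by positivity
  set K := Real.exp (4 * (8 + 3) / ν₂ / θ + 1) with hK
  have hK1 : 1 ≤ K := Real.one_le_exp (by positivity)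
  have hR : 0 < 2 + 8 / c₁ := by positivity
  refine ⟨ν₂, K, min (ν₂ / (7 * K)) (min (c₁ / 4) (min (θ / 200)
    (θ * c₁ / (40 * (2 + 8 / c₁))))), hν₂0, hK1, by positivity, ?_, ?_, ?_, ?_, ?_, ?_⟩
  · have h1 : min (ν₂ / (7 * K)) (min (c₁ / 4) (min (θ / 200)
        (θ * c₁ / (40 * (2 + 8 / c₁))))) ≤ ν₂ :=
      (min_le_left _ _).trans (div_le_self hν₂0.le (by linarith))
    rw [div_le_iff₀ hc₁]
    have h2 : 32 * ν₂ = θ * c₁ := by rw [hν₂]; ring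
    linarith
  · exact (min_le_right _ _).trans (min_le_left _ _)
  · rw [hK, Real.log_exp]
  · have h1 : min (ν₂ / (7 * K)) (min (c₁ / 4) (min (θ / 200)
        (θ * c₁ / (40 * (2 + 8 / c₁))))) ≤ ν₂ / (7 * K) := min_le_left _ _
    calc _ ≤ 6 * K * (ν₂ / (7 * K)) := mul_le_mul_of_nonneg_left h1 (by positivity)
      _ = 6 / 7 * ν₂ := by
        have : K ≠ 0 := by positivity
        field_simp
      _ < ν₂ := by linarith
  · exact (min_le_right _ _).trans ((min_le_right _ _).trans (min_le_left _ _))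
  · have h1 : min (ν₂ / (7 * K)) (min (c₁ / 4) (min (θ / 200)
        (θ * c₁ / (40 * (2 + 8 / c₁))))) ≤ θ * c₁ / (40 * (2 + 8 / c₁)) :=
      (min_le_right _ _).trans ((min_le_right _ _).trans (min_le_right _ _))
    calc _ ≤ 2 * (θ * c₁ / (40 * (2 + 8 / c₁))) * (2 + 8 / c₁) / c₁ := by gcongr
      _ = θ / 20 := by
        field_simp
        norm_num

theorem tendsto_exp_neg_mul {a : ℝ} (ha : 0 < a) :
    Tendsto (fun x => Real.exp (-(a * x))) atTop (𝓝 0) :=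
  Real.tendsto_exp_neg_atTop_nhds_zero.comp (tendsto_id.const_mul_atTop ha)

theorem tendsto_log_pnat : Tendsto (fun n : ℕ+ => Real.log (n : ℝ)) atTop atTop :=
  Real.tendsto_log_atTop.comp
    ((tendsto_natCast_atTop_atTop (R := ℝ)).comp tendsto_PNat_val_atTop_atTop)

theorem tendsto_upper_error {θ γ δ D R : ℝ} (hθ : 0 < θ) (hγ : 0 < γ) (hD : 0 < D) (hR : 0 < R) :
    Tendsto (fun x => Real.exp (-(θ / 2 * x)) + (Real.exp (θ / 10 - θ ^ 2 / 40 * x) + (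
      4 / δ * Real.exp (-(2 * γ / D * θ * x)) + (Real.exp (-x) +
      Real.exp (-(θ / 2 / R * x)))))) atTop (𝓝 0) := by
  have h2 : Tendsto (fun x => Real.exp (θ / 10 - θ ^ 2 / 40 * x)) atTop (𝓝 0) := by
    have h := (tendsto_exp_neg_mul (by positivity : 0 < θ ^ 2 / 40)).const_mul (Real.exp (θ / 10))
    simp_rw [← Real.exp_add, mul_zero, ← sub_eq_add_neg] at h
    exact h
  have h3 := (tendsto_exp_neg_mul (by positivity : 0 < 2 * γ / D * θ)).const_mul (4 / δ)
  have h := (tendsto_exp_neg_mul (by positivity : 0 < θ / 2)).add (h2.add (h3.add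
    (Real.tendsto_exp_neg_atTop_nhds_zero.add
      (tendsto_exp_neg_mul (by positivity : 0 < θ / 2 / R)))))
  simpa only [mul_zero, add_zero] using h

theorem tendsto_lower_error {θ R : ℝ} (A : ℝ) (hθ : 0 < θ) (hR : 0 < R) :
    Tendsto (fun x => A * Real.exp (-(θ / 2 * x)) +
      Real.exp (-(Real.exp (θ / R * x) / 2))) atTop (𝓝 0) := by
  have h1 := (tendsto_exp_neg_mul (by positivity : 0 < θ / 2)).const_mul A
  have h2 : Tendsto (fun x => Real.exp (θ / R * x) / 2) atTop atTop :=
    (Real.tendsto_exp_atTop.comp (tendsto_id.const_mul_atTop (by positivity))).atTop_div_const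
      two_pos
  have h := h1.add (Real.tendsto_exp_neg_atTop_nhds_zero.comp h2)
  simpa only [mul_zero, add_zero, Function.comp_def] using h

theorem tendsto_graph_error {ξ : ℝ} (hξ : 0 < ξ) :
    Tendsto (fun n : ℕ+ => 7 / (n : ℝ) + Real.exp (1 - ξ * Real.log n)) atTop (𝓝 0) := by
  have h1 : Tendsto (fun n : ℕ+ => 7 / (n : ℝ)) atTop (𝓝 0) :=
    tendsto_const_nhds.div_atTop
      ((tendsto_natCast_atTop_atTop (R := ℝ)).comp tendsto_PNat_val_atTop_atTop)
  have h2 : Tendsto (fun x => Real.exp (1 - ξ * x)) atTop (𝓝 0) := by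
    have h := (tendsto_exp_neg_mul hξ).const_mul (Real.exp 1)
    simp_rw [← Real.exp_add, mul_zero, ← sub_eq_add_neg] at h
    exact h
  simpa only [add_zero, Function.comp_def] using h1.add (h2.comp tendsto_log_pnat)

set_option maxHeartbeats 800000 in
/-- The spreading time with few faulty nodes is concentrated around the expected spreading time
of the protocol without faulty nodes. -/
theorem eventually_le_jointProb {p : ℕ+ → unitInterval} {c : ℝ} (hc : 1 < c)
    (hp : ∀ᶠ n : ℕ+ in atTop, c * Real.log (n : ℝ) ≤ n * (p n : ℝ)) {s : ∀ n : ℕ+, Fin n}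
    {β : ∀ n : ℕ+, PMF (Finset (Fin n))} (hs : ∀ n, ∀ B ∈ (β n).support, s n ∉ B)
    (hβ : ∀ δ : ℝ, 0 < δ →
      Tendsto (fun n : ℕ+ => (β n).toOuterMeasure {B | δ * (n : ℝ) < (B.card : ℝ)})
        atTop (𝓝 0))
    {θ : ℝ} (hθ : 0 < θ) (hθ1 : θ ≤ 1 / 20) :
    ∀ᶠ n : ℕ+ in atTop,
      ENNReal.ofReal (1 - 4 * θ) ≤ jointProb (p n) (β n) (Close (s n) (20 * θ)) := by
  obtain ⟨r, c₁, ξ, hr, hc₁, hξ, hx0, hx⟩ := exists_degree_constants hc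
  obtain ⟨ν₂, K, ν, hν₂, hK1, hν, hν₂c, hνc, hK, hKν, hνθ, hνR⟩ := exists_spread_constants hc₁ hθ
  set ε := θ / 100 with hε
  have hε0 : 0 < ε := by positivity
  set δ := Real.exp (-(8 / ν)) with hδ
  have hδ0 : 0 < δ := Real.exp_pos _
  have hδ1 : δ ≤ 1 := Real.exp_le_one_iff.2 (neg_nonpos.2 (by positivity))
  set γ := δ ^ 2 / 64 with hγ
  have hγ0 : 0 < γ := by positivity
  have hR : 0 < 1 + 8 / c₁ := by positivity
  have hup := (tendsto_upper_error (δ := δ) hθ hγ0 (by norm_num : (0 : ℝ) < 8) hR).comp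
    tendsto_log_pnat
  have hlow := (tendsto_lower_error (2 * (2 + 8 / c₁)) hθ hR).comp tendsto_log_pnat
  -- Markov's inequality divides the errors `ℓ` and `b` by `θ`; with both at most `θ ^ 2 / 4` the
  -- total stays below `θ`.
  have hsq : 0 < θ ^ 2 / 4 := by positivity
  filter_upwards [hp, hup.eventually (ge_mem_nhds hθ), hlow.eventually (ge_mem_nhds hsq),
    (tendsto_graph_error hξ).eventually (ge_mem_nhds hsq),
    (hβ (Real.exp (-(4 / ν))) (Real.exp_pos _)).eventually
      (ge_mem_nhds (ENNReal.ofReal_pos.2 hθ)),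
    tendsto_log_pnat.eventually_ge_atTop (4 * (8 + 3) / ν₂ / θ),
    tendsto_log_pnat.eventually_ge_atTop (8 / ε),
    tendsto_log_pnat.eventually_ge_atTop (8 / (ε ^ 2 / 16) ^ 2),
    tendsto_log_pnat.eventually_ge_atTop (8 / (ε ^ 2 / 16 * ν)),
    tendsto_log_pnat.eventually_ge_atTop (3 / γ), eventually_ge_atTop 2] with
    n hpn hupn hlown hgraph hβn hn1 hn2 hn3 hn4 hn5 hn
  simp only [Function.comp_apply] at hupn hlown
  have hn' : 2 ≤ (n : ℕ) := hn
  have hlog : 0 < Real.log (n : ℝ) := Real.log_pos (by exact_mod_cast hn')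
  have hlogd : Real.log (n : ℝ) ≤ n * (p n : ℝ) := (le_mul_of_one_le_left hlog.le hc.le).trans hpn
  have hd0 : 0 < (n : ℝ) * (p n : ℝ) := hlog.trans_le hlogd
  set d := (n : ℝ) * (p n : ℝ) with hd
  set ℓ := 2 * (2 + 8 / c₁) * Real.exp (-(θ / 2 * Real.log n)) +
    Real.exp (-(Real.exp (θ / (1 + 8 / c₁) * Real.log n) / 2)) with hℓ
  set b := 7 / (n : ℝ) + Real.exp (1 - ξ * Real.log n) with hb
  have hgood : ∀ B : Finset (Fin n), (B.card : ℝ) ≤ Real.exp (-(4 / ν)) * n →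
      (SimpleGraph.binomialRandom (Fin n) (p n)).real
        {G | ¬ GoodGraph G B d c₁ 8 ε ν δ γ} ≤ b := by
    intro B hB
    refine measureReal_not_goodGraph_le hn' hε0 (by linarith) hν (by linarith) hδ hr hlogd ?_
      (hn2.trans hlogd) (hn3.trans hlogd) (hn4.trans hlogd) ?_ hB
    · rw [hx, mul_assoc]
      exact mul_le_mul_of_nonneg_left hpn hx0
    · have := hn5.trans hlogd
      rwa [div_le_iff₀ hγ0, mul_comm] at this
  have hmain := le_jointProb (p := p n) (β := β n) (A := Close (s n) (20 * θ))
    (S := {B | (B.card : ℝ) ≤ Real.exp (-(4 / ν)) * n}) (x := ENNReal.ofReal (1 - 3 * θ))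
    (y := ENNReal.ofReal θ) ?_ ?_
  -- The faulty set is too large with probability at most `θ`, and `(1 - θ) (1 - 3θ) ≥ 1 - 4θ`.
  · refine le_trans ?_ hmain
    rw [← ENNReal.ofReal_one, ← ENNReal.ofReal_sub _ hθ.le,
      ← ENNReal.ofReal_mul (by linarith)]
    exact ENNReal.ofReal_le_ofReal (by linarith [mul_pos hθ hθ])
  · refine le_trans (measure_mono fun B hB => ?_) hβn
    simpa using hB
  · intro B hB hsupp
    refine le_lintegral_close hθ hθ1 (hs n B hsupp)
      (Good := fun B G => GoodGraph G B d c₁ 8 ε ν δ γ) (ℓ := ℓ) (b := b) ?_ ?_ ?_ (by positivity)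
      ?_ (hgood B hB) ?_
    · intro G hG
      have := hG.finishTime_nonneg hd0 hc₁ (by norm_num)
      rw [spreadScale]
      linarith
    · intro G hG
      exact hG.empty_faulty (by positivity)
    · intro B' G I hG hI
      exact (hG.not_univ_le_of_scale hc₁ (by norm_num) hε0 hν hδ0 hδ1 hγ0 hθ (by linarith) le_rfl
        (by linarith) hν₂ hν₂c hνc hK hK1 hKν hlogd hn1 hn' hI).trans hupn
    · intro G hG
      exact hG.sum_univ_le_of_scale hc₁ (by norm_num) hε0 hν hθ (by linarith) le_rfl
        (by linarith) hνR hlogd hn' ∅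
    · have h1 : (ℓ + b) / θ ≤ θ / 2 := by
        rw [div_le_iff₀ hθ]
        linarith
      have h2 : θ ^ 2 ≤ θ * 1 := by
        rw [sq]
        exact mul_le_mul_of_nonneg_left (by linarith) hθ.le
      linarith

end RumorSpreading

/-! ### The theorem -/

theorem proposition4
    (p : ℕ+ → unitInterval)
    (hp : (∃ α : ℕ+ → ℝ, Tendsto α atTop atTop ∧
              ∀ᶠ n : ℕ+ in atTop, (p n : ℝ) = α n * Real.log (n : ℝ) / (n : ℝ)) ∨
          (∃ c : ℝ, 1 < c ∧
              ∀ᶠ n : ℕ+ in atTop, (p n : ℝ) = c * Real.log (n : ℝ) / (n : ℝ)))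
    -- the initially informed node
    (s : ∀ n : ℕ+, Fin n)
    -- the law of the random set of faulty nodes
    (β : ∀ n : ℕ+, PMF (Finset (Fin n)))
    (hs : ∀ n, ∀ B ∈ (β n).support, s n ∉ B)
    (hβ : ∀ δ : ℝ, 0 < δ →
      Tendsto (fun n : ℕ+ => (β n).toOuterMeasure {B | δ * (n : ℝ) < (B.card : ℝ)})
        atTop (𝓝 0)) :
    ∃ ε : ℕ+ → ℝ, Tendsto ε atTop (𝓝 0) ∧
      Tendsto
        (fun n : ℕ+ => RumorSpreading.jointProb (p n) (β n) fun G B ω =>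
          RumorSpreading.expectedSpreadTime (s n) G ≠ ∞ ∧
          RumorSpreading.spreadTime (s n) B ω ≠ ∞ ∧
          |(RumorSpreading.spreadTime (s n) B ω).toReal
              - (RumorSpreading.expectedSpreadTime (s n) G).toReal|
            ≤ ε n * (RumorSpreading.expectedSpreadTime (s n) G).toReal)
        atTop (𝓝 1) := by
  have hpos : ∀ n : ℕ+, (0 : ℝ) < n := fun n => by exact_mod_cast n.pos
  obtain ⟨c, hc, hd⟩ : ∃ c : ℝ, 1 < c ∧
      ∀ᶠ n : ℕ+ in atTop, c * Real.log (n : ℝ) ≤ n * (p n : ℝ) := by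
    rcases hp with ⟨α, hα, h⟩ | ⟨c, hc, h⟩
    -- Only a lower bound on `np` is needed, so the first regime reduces to the constant `2`.
    · refine ⟨2, one_lt_two, ?_⟩
      filter_upwards [h, hα.eventually_ge_atTop 2] with n hn hn2
      rw [hn, mul_div_cancel₀ _ (hpos n).ne']
      exact mul_le_mul_of_nonneg_right hn2 (Real.log_natCast_nonneg n)
    · refine ⟨c, hc, ?_⟩
      filter_upwards [h] with n hn
      rw [hn, mul_div_cancel₀ _ (hpos n).ne']
  set P : ℕ+ → ℝ → Prop := fun n θ => ENNReal.ofReal (1 - θ) ≤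
    RumorSpreading.jointProb (p n) (β n) (RumorSpreading.Close (s n) θ) with hPdef
  have hmono : ∀ n θ θ', θ ≤ θ' → P n θ → P n θ' := fun n θ θ' hθ h =>
    (ENNReal.ofReal_le_ofReal (by linarith)).trans (h.trans
      (RumorSpreading.jointProb_mono fun G B ω hω => hω.mono hθ))
  have hev : ∀ θ, 0 < θ → ∀ᶠ n in atTop, P n θ := by
    intro θ hθ
    -- The relative error is `20` times this parameter and the lost probability `4` times, so both
    -- are at most `θ`.
    have hmin : 0 < min (θ / 20) (1 / 20) := by positivity
    have h1 : min (θ / 20) (1 / 20) ≤ θ / 20 := min_le_left _ _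
    filter_upwards [RumorSpreading.eventually_le_jointProb hc hd hs hβ hmin (min_le_right _ _)]
      with n hn
    exact (ENNReal.ofReal_le_ofReal (by linarith)).trans (hn.trans
      (RumorSpreading.jointProb_mono fun G B ω hω => hω.mono (by linarith)))
  obtain ⟨ε, hε, hP⟩ := RumorSpreading.exists_tendsto_zero_of_eventually hmono hev
  refine ⟨ε, hε, ?_⟩
  have hlim : Tendsto (fun n : ℕ+ => ENNReal.ofReal (1 - ε n)) atTop (𝓝 1) := by
    have h := ENNReal.tendsto_ofReal (hε.const_sub 1)
    rwa [sub_zero, ENNReal.ofReal_one] at h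
  exact tendsto_of_tendsto_of_tendsto_of_le_of_le' hlim tendsto_const_nhds hP
    (Eventually.of_forall fun n => RumorSpreading.jointProb_le_one _)
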